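/- **Setting.** Let $m\ge 2$ and let $\kappa_0,\kappa_1,\kappa_m>0$ be real, with $\kappa_1=\kappa_m$ if $m$ is odd. Let $\delta\in\{-1,1\}$ and let $e_1=\begin{pmatrix}0&1\\1&0\end{pmatrix}$, $e_2=\begin{pmatrix}0&-i\\i&0\end{pmatrix}$, $e_3=\begin{pmatrix}\delta&0\\0&-\delta\end{pmatrix}$ act on $\mathbb C^2$. For the reflection group $W=\mathbb Z_2\times D_{2m}$ on $\mathbb R^3$ take the positive roots $\alpha_0=(0,0,1)$ and $\alpha_j=(\sin\frac{j\pi}m,-\cos\frac{j\pi}m,0)$, $1\le j\le m$, with multiplicities $\kappa(\alpha_0)=\kappa_0$ and, for $j\ge 1$, $\kappa(\alpha_j)=\kappa_m$ if $j$ is even and $\kappa(\alpha_j)=\kappa_1$ if $j$ is odd. With $\sigma_r$ the orthogonal reflection in $r^\perp$, the Dunkl operators are $$\mathcal D_j f(x)=\partial_{x_j}f(x)+\sum_{l=0}^m\kappa(\alpha_l)(\alpha_l)_j\,\frac{f(x)-f(\sigma_{\alpha_l}x)}{\langle x,\alpha_l\rangle},\qquad j=1,2,3.$$ Let $\underline D=e_1\mathcal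 D_1+e_2\mathcal D_2+e_3\mathcal D_3$ and $\widehat{\underline D}=e_1\mathcal D_1+e_2\mathcal D_2$ act on $\mathbb C^2$-valued polynomials on $\mathbb R^3$, and let $\mathcal M_n(\mathbb R^3,\mathbb C^2)$ be the space of $\mathbb C^2$-valued polynomials, homogeneous of degree $n$, that are annihilated by $\underline D$. Write $\underline x=e_1x_1+e_2x_2+e_3x_3$ (so $\underline x^2=|x|^2$), $\hat{\underline x}=e_1x_1+e_2x_2$ and $\hat\gamma=\frac m2(\kappa_1+\kappa_m)$. **Special functions.** Let $(a)_n=a(a+1)\cdots(a+n-1)$, let $$P_n^{(a,b)}(x)=\frac{(a+1)_n}{n!}\,{}_2F_1\!\left(-n,\,n+a+b+1;\,a+1;\,\tfrac{1-x}2\right),\qquad P_{-1}^{(a,b)}=0,$$ and let $$G_{2t}^{(\lambda,\mu)}(x)=\tfrac{(\lambda+\mu)_t}{(\mu+1/2)_t}P_t^{(\lambda-\frac12,\mu-\frac12)}(2x^2-1),\quad G_{2t+1}^{(\lambda,\mu)}(x)=\tfrac{(\lambda+\mu)_{t+1}}{(\mu+1/2)_{t+1}}\,x\,P_t^{(\lambda-\frac12,\mu+\frac12)}(2x^2-1),\quad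 G_{-1}^{(\lambda,\mu)}=0.$$ **Planar monogenics.** Let $z=x_1+ix_2$. If $m$ is odd and $k=am+\ell$ with $0\le\ell<m$, let $$\phi_k^+=z^\ell\sum_{j=0}^a\frac{(\kappa_1)_j(\kappa_1+1)_{a-j}}{j!\,(a-j)!}\,\bar z^{mj}z^{m(a-j)},\qquad \phi_k^-=\overline{\phi_k^+}.$$ If $m=2p$ is even and $k=ap+\ell$ with $0\le\ell<p$, let $\phi_k^+=z^\ell f_a(z^p,\bar z^p)$ and $\phi_k^-=\bar z^\ell f_a(\bar z^p,z^p)$, where for $w=re^{i\theta}$ $$f_a(w,\bar w)=r^a\left(\tfrac{a+2\kappa_m+(1+(-1)^a)\kappa_1}{2(\kappa_m+\kappa_1)}\,G_a^{(\kappa_m,\kappa_1)}(\cos\theta)+i\sin\theta\;G_{a-1}^{(\kappa_m+1,\kappa_1)}(\cos\theta)\right).$$ Put $\Phi_k^+=\phi_k^+\,(1,0)^T$ and $\Phi_k^-=\phi_k^-\,(0,1)^T$. **Claim.** For every $n\ge 0$ the $2n+2$ functions $$\psi^\pm_{n,k}(x)=B_{n,k}(x)\,\Phi_k^\pm(x_1,x_2),\qquad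 k=0,\dots,n,$$ (defined for $x\ne 0$) are polynomials and form a basis of $\mathcal M_n(\mathbb R^3,\mathbb C^2)$ over $\mathbb C$. Here, with $\Upsilon(x)=(x_1^2+x_2^2-x_3^2)/|x|^2$, $$B_{n,k}=\frac{t!}{(\kappa_0+\frac12)_t}\,\underline x^{2t}\left(\hat{\underline x}\,P_t^{(\kappa_0-\frac12,\,k+1+\hat\gamma)}(\Upsilon)-e_3x_3\,\frac{t+k+1+\hat\gamma}{t+\kappa_0+\frac12}\,P_t^{(\kappa_0+\frac12,\,k+\hat\gamma)}(\Upsilon)\right)\quad\text{if } n-k=2t+1,$$ $$B_{n,k}=\frac{t!}{(\kappa_0+\frac12)_t}\,\underline x^{2t}\left(P_t^{(\kappa_0-\frac12,\,k+\hat\gamma)}(\Upsilon)-\frac{e_3x_3\hat{\underline x}}{\underline x^2}\,P_{t-1}^{(\kappa_0+\frac12,\,k+1+\hat\gamma)}(\Upsilon)\right)\quad\text{if } n-k=2t.$$ Moreover $\psi^\pm_{n,k}=\mathbf{CK}\big(\hat{\underline x}^{\,n-k}\Phi_k^\pm\big)$, where $\mathbf{CK}$ is the Cauchy–Kovalevskaya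 extension operator $$\mathbf{CK}={}_0F_1\!\left(-;\kappa_0+\tfrac12;-\tfrac{(x_3\widehat{\underline D})^2}4\right)-\frac{e_3x_3\widehat{\underline D}}{2\kappa_0+1}\;{}_0F_1\!\left(-;\kappa_0+\tfrac32;-\tfrac{(x_3\widehat{\underline D})^2}4\right),\qquad {}_0F_1(-;c;y)=\sum_{j\ge0}\frac{y^j}{j!\,(c)_j}.$$ -/

import Mathlib

open MvPolynomial

namespace DunklDirac

noncomputable section

/-! ### Dunkl operators on polynomials -/

/-- The linear form `x ↦ ⟨x, r⟩` as a complex polynomial in `N` variables. -/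
def rootForm {N : ℕ} (r : Fin N → ℝ) : MvPolynomial (Fin N) ℂ :=
  ∑ i, C (r i : ℂ) * X i

/-- The action `(σ_r f)(x) = f(σ_r x)` on polynomials of the reflection
`σ_r x = x - 2 (⟨x, r⟩ / ⟨r, r⟩) r`. -/
def reflect {N : ℕ} (r : Fin N → ℝ) :
    MvPolynomial (Fin N) ℂ →ₐ[ℂ] MvPolynomial (Fin N) ℂ :=
  aeval fun i => X i - C ((2 * r i / ∑ l, r l * r l : ℝ) : ℂ) * rootForm r

theorem rootForm_dvd_sub_reflect {N : ℕ} (r : Fin N → ℝ) (f : MvPolynomial (Fin N) ℂ) :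
    rootForm r ∣ f - reflect r f := by
  induction f using MvPolynomial.induction_on with
  | C a =>
    have h : reflect r (C a) = C a := (reflect r).commutes a
    simp [h]
  | add p q hp hq =>
    have h : p + q - reflect r (p + q) = (p - reflect r p) + (q - reflect r q) := by
      rw [map_add]; ring
    rw [h]
    exact dvd_add hp hq
  | mul_X p i hp =>
    have hX : reflect r (X i)
        = X i - C ((2 * r i / ∑ l, r l * r l : ℝ) : ℂ) * rootForm r := by
      simp [reflect]
    have h : p * X i - reflect r (p * X i) = (p - reflect r p) * X i
        + rootForm r * (C ((2 * r i / ∑ l, r l * r l : ℝ) : ℂ) * reflect r p) := by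
      rw [map_mul, hX]; ring
    rw [h]
    exact dvd_add (hp.mul_right _) (dvd_mul_right _ _)

open Classical in
/-- The polynomial `(f - σ_r f) / ⟨x, r⟩` (for a nonzero root `r`). -/
def diffQuotFun {N : ℕ} (r : Fin N → ℝ) (f : MvPolynomial (Fin N) ℂ) :
    MvPolynomial (Fin N) ℂ :=
  if rootForm r = 0 then 0 else (rootForm_dvd_sub_reflect r f).choose

/-- The defining property of the difference quotient. -/
theorem rootForm_mul_diffQuotFun {N : ℕ} (r : Fin N → ℝ) (f : MvPolynomial (Fin N) ℂ) :
    rootForm r * diffQuotFun r f = f - reflect r f := by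
  by_cases h : rootForm r = 0
  · have hd := rootForm_dvd_sub_reflect r f
    rw [h, zero_dvd_iff] at hd
    rw [hd, h, zero_mul]
  · rw [diffQuotFun, if_neg h]
    exact (rootForm_dvd_sub_reflect r f).choose_spec.symm

/-- The linear map `f ↦ (f - σ_r f) / ⟨x, r⟩` on polynomials. -/
def diffQuot {N : ℕ} (r : Fin N → ℝ) :
    MvPolynomial (Fin N) ℂ →ₗ[ℂ] MvPolynomial (Fin N) ℂ where
  toFun := diffQuotFun r
  map_add' f g := by
    by_cases h : rootForm r = 0
    · simp [diffQuotFun, h]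
    · apply mul_left_cancel₀ h
      rw [mul_add]
      simp only [rootForm_mul_diffQuotFun, map_add]
      ring
  map_smul' c f := by
    by_cases h : rootForm r = 0
    · simp [diffQuotFun, h]
    · apply mul_left_cancel₀ h
      rw [RingHom.id_apply, mul_smul_comm]
      simp only [rootForm_mul_diffQuotFun, map_smul, smul_sub]

/-- The Dunkl operator `𝒟_j f = ∂_j f + ∑_r κ(r) ⟨ξ_j, r⟩ (f - σ_r f) / ⟨x, r⟩`, for a finite
family `root` of positive roots with multiplicities `κ`. -/
def dunkl {N : ℕ} {ι : Type} [Fintype ι] (root : ι → Fin N → ℝ) (κ : ι → ℝ) (j : Fin N) :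
    MvPolynomial (Fin N) ℂ →ₗ[ℂ] MvPolynomial (Fin N) ℂ :=
  (pderiv j).toLinearMap + ∑ a, ((κ a * root a j : ℝ) : ℂ) • diffQuot (root a)

/-! ### The reflection group `ℤ₂ × D_{2m}`

The coordinates `x₁, x₂, x₃` are indexed by `0, 1, 2 : Fin 3`. -/

/-- The positive roots `α₀ = (0, 0, 1)` and `α_j = (sin (jπ/m), -cos (jπ/m), 0)`,
`j = 1, …, m`, of `A₁ ⊕ I₂(m)`. -/
def posRoot (m : ℕ) (j : Fin (m + 1)) : Fin 3 → ℝ :=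
  if j = 0 then ![0, 0, 1]
  else ![Real.sin ((j : ℕ) * Real.pi / m), -Real.cos ((j : ℕ) * Real.pi / m), 0]

/-- The multiplicities: `κ₀` on `α₀`, `κ_m` on `α_j` with `j ≥ 2` even, `κ₁` on `α_j` with `j`
odd. For odd `m` this is used only with `κ₁ = κ_m`. -/
def mult (m : ℕ) (κ₀ κ₁ κₘ : ℝ) (j : Fin (m + 1)) : ℝ :=
  if j = 0 then κ₀ else if Even (j : ℕ) then κₘ else κ₁

/-- `γ̂ = (m/2)(κ₁ + κ_m)`. -/
def gammaHat (m : ℕ) (κ₁ κₘ : ℝ) : ℝ := (m : ℝ) / 2 * (κ₁ + κₘ)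

/-- The Clifford generators `e₁, e₂, e₃` as Pauli matrices, with the sign `δ` on `e₃`. -/
def pauli (δ : ℤ) : Fin 3 → Matrix (Fin 2) (Fin 2) ℂ :=
  ![!![0, 1; 1, 0], !![0, -Complex.I; Complex.I, 0], !![(δ : ℂ), 0; 0, -(δ : ℂ)]]

/-- Spinor-valued polynomials on `ℝ³`, i.e. `ℂ[x₁, x₂, x₃] ⊗ ℂ²`. -/
abbrev SpinorPoly : Type := Fin 2 → MvPolynomial (Fin 3) ℂ

/-- A complex `2 × 2` matrix acting on spinor-valued polynomials. -/
def matAct (A : Matrix (Fin 2) (Fin 2) ℂ) : SpinorPoly →ₗ[ℂ] SpinorPoly :=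
  LinearMap.pi fun i => ∑ j, A i j • LinearMap.proj j

/-- Multiplication of a spinor-valued polynomial by the variable `x_j`. -/
def mulX (j : Fin 3) : SpinorPoly →ₗ[ℂ] SpinorPoly :=
  (LinearMap.mulLeft ℂ (X j : MvPolynomial (Fin 3) ℂ)).compLeft (Fin 2)

/-- The Dunkl operator `𝒟_j` of `ℤ₂ × D_{2m}` acting componentwise on spinor-valued
polynomials. -/
def spinorDunkl (m : ℕ) (κ₀ κ₁ κₘ : ℝ) (j : Fin 3) : SpinorPoly →ₗ[ℂ] SpinorPoly :=
  (dunkl (posRoot m) (mult m κ₀ κ₁ κₘ) j).compLeft (Fin 2)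

/-- The Dunkl–Dirac operator `e₁ 𝒟₁ + e₂ 𝒟₂ + e₃ 𝒟₃`. -/
def diracOp (m : ℕ) (κ₀ κ₁ κₘ : ℝ) (δ : ℤ) : SpinorPoly →ₗ[ℂ] SpinorPoly :=
  ∑ j, matAct (pauli δ j) ∘ₗ spinorDunkl m κ₀ κ₁ κₘ j

/-- The planar Dunkl–Dirac operator `e₁ 𝒟₁ + e₂ 𝒟₂`. -/
def diracHat (m : ℕ) (κ₀ κ₁ κₘ : ℝ) (δ : ℤ) : SpinorPoly →ₗ[ℂ] SpinorPoly :=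
  matAct (pauli δ 0) ∘ₗ spinorDunkl m κ₀ κ₁ κₘ 0 + matAct (pauli δ 1) ∘ₗ spinorDunkl m κ₀ κ₁ κₘ 1

/-- The space `ℳ_n(ℝ³, ℂ²)` of Dunkl monogenics: the spinor-valued polynomials, homogeneous of
degree `n`, in the kernel of the Dunkl–Dirac operator. -/
def monogenics (m : ℕ) (κ₀ κ₁ κₘ : ℝ) (δ : ℤ) (n : ℕ) : Submodule ℂ SpinorPoly :=
  LinearMap.ker (diracOp m κ₀ κ₁ κₘ δ) ⊓
    Submodule.pi Set.univ fun _ => homogeneousSubmodule (Fin 3) ℂ n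

/-- The value of a spinor-valued polynomial at a point of `ℝ³`. -/
def spinorEval (p : SpinorPoly) (x : Fin 3 → ℝ) : Fin 2 → ℂ :=
  fun i => eval (fun j => (x j : ℂ)) (p i)

/-! ### Special functions -/

/-- The Pochhammer symbol `(a)_n = a (a + 1) ⋯ (a + n - 1)`. -/
def poch (a : ℝ) (n : ℕ) : ℝ := (ascPochhammer ℝ n).eval a

/-- The Jacobi polynomial `P_n^{(a, b)}`. -/
def jacobi (n : ℕ) (a b x : ℝ) : ℝ :=
  poch (a + 1) n / n.factorial *
    ordinaryHypergeometric (-(n : ℝ)) (n + a + b + 1) (a + 1) ((1 - x) / 2)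

/-- The generalized Gegenbauer polynomial `G_n^{(lam, mu)}`. -/
def gegenbauer (n : ℕ) (lam mu x : ℝ) : ℝ :=
  let t := n / 2
  if Even n then
    poch (lam + mu) t / poch (mu + 1 / 2) t *
      jacobi t (lam - 1 / 2) (mu - 1 / 2) (2 * x ^ 2 - 1)
  else
    poch (lam + mu) (t + 1) / poch (mu + 1 / 2) (t + 1) *
      (x * jacobi t (lam - 1 / 2) (mu + 1 / 2) (2 * x ^ 2 - 1))

/-! ### The planar harmonics and monogenics -/

/-- The function `f_k(w, w̄)`, `w = r e^{iθ}`, with the convention `G_{-1} = 0`. -/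
def fEven (κ₁ κₘ : ℝ) (k : ℕ) (w : ℂ) : ℂ :=
  let r := ‖w‖
  let θ := w.arg
  (r : ℂ) ^ k *
    ((((k + 2 * κₘ + (1 + (-1) ^ k) * κ₁) / (2 * (κₘ + κ₁))
        * gegenbauer k κₘ κ₁ (Real.cos θ) : ℝ) : ℂ)
      + Complex.I * ((Real.sin θ
        * (if k = 0 then 0 else gegenbauer (k - 1) (κₘ + 1) κ₁ (Real.cos θ)) : ℝ) : ℂ))

/-- The sum `∑_{j=0}^k (κ₁)_j (κ₁ + 1)_{k-j} / (j! (k-j)!) w̄^j w^{k-j}`. -/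
def fOdd (κ₁ : ℝ) (k : ℕ) (w : ℂ) : ℂ :=
  ∑ j ∈ Finset.range (k + 1),
    ((poch κ₁ j * poch (κ₁ + 1) (k - j) / (j.factorial * (k - j).factorial) : ℝ) : ℂ)
      * (starRingEnd ℂ w) ^ j * w ^ (k - j)

/-- The harmonic `φ_n^+`, as a function of `z = x₁ + i x₂`. -/
def phiPlus (m : ℕ) (κ₁ κₘ : ℝ) (n : ℕ) (z : ℂ) : ℂ :=
  if Odd m then z ^ (n % m) * fOdd κ₁ (n / m) (z ^ m)
  else z ^ (n % (m / 2)) * fEven κ₁ κₘ (n / (m / 2)) (z ^ (m / 2))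

/-- The harmonic `φ_n^-`, as a function of `z = x₁ + i x₂`. -/
def phiMinus (m : ℕ) (κ₁ κₘ : ℝ) (n : ℕ) (z : ℂ) : ℂ :=
  if Odd m then starRingEnd ℂ (phiPlus m κ₁ κₘ n z)
  else (starRingEnd ℂ z) ^ (n % (m / 2))
    * fEven κ₁ κₘ (n / (m / 2)) ((starRingEnd ℂ z) ^ (m / 2))

/-- The planar monogenics `Φ_n^+ = φ_n^+ χ^+` (sign index `0`) and `Φ_n^- = φ_n^- χ^-` (sign
index `1`), at the point `x` of `ℝ³` (independently of `x₃`). -/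
def bigPhi (m : ℕ) (κ₁ κₘ : ℝ) (n : ℕ) (s : Fin 2) (x : Fin 3 → ℝ) : Fin 2 → ℂ :=
  if s = 0 then ![phiPlus m κ₁ κₘ n ⟨x 0, x 1⟩, 0]
  else ![0, phiMinus m κ₁ κₘ n ⟨x 0, x 1⟩]

/-! ### The operator `B_{n,k}` and the Cauchy–Kovalevskaya extension -/

/-- The vector variable `e₁ x₁ + e₂ x₂ + e₃ x₃` at the point `x`. -/
def vecVar (δ : ℤ) (x : Fin 3 → ℝ) : Matrix (Fin 2) (Fin 2) ℂ :=
  ∑ j, (x j : ℂ) • pauli δ j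

/-- The planar vector variable `e₁ x₁ + e₂ x₂` at the point `x`. -/
def vecVarHat (δ : ℤ) (x : Fin 3 → ℝ) : Matrix (Fin 2) (Fin 2) ℂ :=
  (x 0 : ℂ) • pauli δ 0 + (x 1 : ℂ) • pauli δ 1

/-- `|x|² = x₁² + x₂² + x₃²`. -/
def sqNorm (x : Fin 3 → ℝ) : ℝ := x 0 ^ 2 + x 1 ^ 2 + x 2 ^ 2

/-- The square of the vector variable is the scalar `|x|²`. -/
theorem vecVar_sq (δ : ℤ) (hδ : δ = 1 ∨ δ = -1) (x : Fin 3 → ℝ) :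
    vecVar δ x ^ 2 = (sqNorm x : ℂ) • (1 : Matrix (Fin 2) (Fin 2) ℂ) := by
  rw [pow_two]
  ext i j
  rcases hδ with rfl | rfl <;> fin_cases i <;> fin_cases j <;>
    simp [vecVar, sqNorm, pauli, Fin.sum_univ_three, Matrix.mul_apply, Fin.sum_univ_two] <;>
    ring_nf <;> simp [Complex.I_sq]

/-- `Υ(x) = (x₁² + x₂² - x₃²) / |x|²`. -/
def upsilon (x : Fin 3 → ℝ) : ℝ := (x 0 ^ 2 + x 1 ^ 2 - x 2 ^ 2) / sqNorm x

/-- The Clifford-valued function `B_{n,k}`, with `t = ⌊(n - k)/2⌋` and `P_{-1} = 0`. -/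
def bigB (m : ℕ) (κ₀ κ₁ κₘ : ℝ) (δ : ℤ) (n k : ℕ) (x : Fin 3 → ℝ) :
    Matrix (Fin 2) (Fin 2) ℂ :=
  let t := (n - k) / 2
  let g := gammaHat m κ₁ κₘ
  let U := upsilon x
  ((t.factorial / poch (κ₀ + 1 / 2) t : ℝ) : ℂ) • (vecVar δ x ^ (2 * t) *
    (if Odd (n - k) then
      (jacobi t (κ₀ - 1 / 2) (k + 1 + g) U : ℂ) • vecVarHat δ x
        - ((x 2 * ((t + k + 1 + g) / (t + κ₀ + 1 / 2))
            * jacobi t (κ₀ + 1 / 2) (k + g) U : ℝ) : ℂ) • pauli δ 2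
    else
      (jacobi t (κ₀ - 1 / 2) (k + g) U : ℂ) • (1 : Matrix (Fin 2) (Fin 2) ℂ)
        - ((x 2 / sqNorm x
            * (if t = 0 then 0 else jacobi (t - 1) (κ₀ + 1 / 2) (k + 1 + g) U) : ℝ) : ℂ)
          • (pauli δ 2 * vecVarHat δ x)))

/-- `₀F₁(-; c; -(x₃ D̂)² / 4)` applied to a spinor-valued polynomial, `D̂` being the planar
Dunkl–Dirac operator. As `D̂` lowers the degree, all but finitely many terms vanish. -/
def hyp01 (m : ℕ) (κ₀ κ₁ κₘ : ℝ) (δ : ℤ) (c : ℝ) (q : SpinorPoly) : SpinorPoly :=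
  ∑ᶠ j : ℕ, (((-1) ^ j / (4 ^ j * j.factorial * poch c j) : ℝ) : ℂ) •
    ((mulX 2 ∘ₗ diracHat m κ₀ κ₁ κₘ δ) ^ (2 * j)) q

/-- The Cauchy–Kovalevskaya extension
`₀F₁(-; κ₀ + 1/2; -(x₃ D̂)²/4) - (e₃ x₃ D̂ / (2κ₀ + 1)) ₀F₁(-; κ₀ + 3/2; -(x₃ D̂)²/4)`. -/
def ckExt (m : ℕ) (κ₀ κ₁ κₘ : ℝ) (δ : ℤ) (q : SpinorPoly) : SpinorPoly :=
  hyp01 m κ₀ κ₁ κₘ δ (κ₀ + 1 / 2) q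
    - ((1 / (2 * κ₀ + 1) : ℝ) : ℂ) • matAct (pauli δ 2)
        (mulX 2 (diracHat m κ₀ κ₁ κₘ δ (hyp01 m κ₀ κ₁ κₘ δ (κ₀ + 3 / 2) q)))

end

end DunklDirac

/-!
Write `x̂ = e₁ x₁ + e₂ x₂` and `D̂ = e₁ 𝒟₁ + e₂ 𝒟₂`. The proof reduces all claims to one-variable
Dunkl operators, which act on monomials by `x^n ↦ γ_n x^{n-1}`, `γ_n = n + κ (1 - (-1)^n)`
(`stepNum`).

*Planar monogenics.* In the complex coordinates `x₁ ± i x₂` the components of `D̂` are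
`𝒟₁ ± i 𝒟₂`, so `Φ_k^±` is annihilated by `D̂` once `φ_k^±` is annihilated by one of these two
operators. A reflection interchanges the coordinates up to a root of unity, and the sum of the
difference quotients over an orbit of mirrors is a partial fraction expansion over roots of unity
(`sum_quotient_mul`). What is left is an identity in the powers `W = z^p` and `V = z̄^p`. For odd
`m` there is one orbit, and the identity telescopes (`planarDunkl_oddForm`). For even `m = 2p` the
two orbits of mirrors act on `(W + V) / 2` and `(W - V) / 2` by sign changes, the function `f_a` is
the degree `a` part of a product of two Dunkl exponentials in these variables (`fEven_eq_sum`), and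
the contributions of the two factors telescope (`planarDunkl_evenForm`).

*The extension.* On a planar monogenic `Φ` of degree `k` one has `D̂ x̂ Φ = 2 (k + 1 + γ̂) Φ`, and
`D̂ x̂² = x̂² D̂ + 2 x̂`; hence `D̂` acts on `x̂^N Φ` as the one-variable Dunkl operator of
multiplicity `k + γ̂ + 1/2` acts on `x^N` (`IsPlanarMonogenic.diracHat_xHat_pow`), while `𝒟₃` acts
on powers of `x₃` with multiplicity `κ₀`. So `CK (x̂^N Φ)` is an explicit sum of the spinors
`x₃^i x̂^{N-i} Φ` (`ckExt_xHat_pow`), and applying `D̂ + e₃ 𝒟₃` to it telescopes to zero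
(`diracOp_ckSum`).

*Jacobi polynomials.* By the Pfaff transformation, that is the Chu–Vandermonde identity,
`(u + v)^n P_n^{(a, b)}((v - u) / (u + v))` is a homogeneous polynomial in `u, v` with product
coefficients (`jacobi_eq_jacobiForm`). With `u = x₃²` and `v = x₁² + x₂²` these coefficients are
those of the extension, so that the extension of `x̂^{n-k} Φ_k^±` is `B_{n,k} Φ_k^±`
(`spinorEvalLin_ckSum`). The same expansion identifies the generalized Gegenbauer polynomials in
`f_a`.

*The basis.* The extensions restrict to `x̂^{n-k} Φ_k^±` on the plane `x₃ = 0`, and these are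
linearly independent because `D̂^{n-k}` separates them triangularly (`linearIndependent_xHat_pow`).
Conversely, a monogenic vanishing on this plane is divisible by all powers of `x₃`
(`X_two_pow_dvd_succ`) and thus zero, so the dimension of the space of monogenics is at most the
number `2 (n + 1)` of coefficients of a pair of binary forms of degree `n`.
-/

namespace DunklDirac

/-! ### Jacobi polynomials in homogeneous form -/

theorem poch_zero (a : ℝ) : poch a 0 = 1 := by simp [poch]

theorem poch_succ (a : ℝ) (n : ℕ) : poch a (n + 1) = poch a n * (a + n) := by
  simp [poch, ascPochhammer_succ_eval]

theorem poch_succ_left (a : ℝ) (n : ℕ) : poch a (n + 1) = a * poch (a + 1) n := by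
  simp [poch, ascPochhammer_succ_left, Polynomial.eval_comp]

theorem poch_add (a : ℝ) (k n : ℕ) : poch a (k + n) = poch a k * poch (a + k) n := by
  induction n with
  | zero => simp [poch_zero]
  | succ n ih => rw [← add_assoc, poch_succ, ih, poch_succ]; push_cast; ring

theorem poch_pos {a : ℝ} (ha : 0 < a) (n : ℕ) : 0 < poch a n := ascPochhammer_pos n a ha

theorem poch_mul_sub (a : ℝ) {s n : ℕ} (h : s ≤ n) :
    poch a s * poch (a + s) (n - s) = poch a n := by
  rw [← poch_add, Nat.add_sub_cancel' h]

/-- The Chu–Vandermonde identity, with `poch (c - s + 1) s` in the role of the falling factorial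
`c (c - 1) ⋯ (c - s + 1)`. -/
theorem sum_choose_mul_poch (N : ℕ) (α c : ℝ) :
    ∑ s ∈ Finset.range (N + 1), (N.choose s : ℝ) * poch (α + s) (N - s) * poch (c - s + 1) s
      = poch (α + c) N := by
  induction N generalizing α with
  | zero => simp [poch_zero]
  | succ N ih =>
    have key : ∀ s ∈ Finset.range (N + 1),
        (N.choose s : ℝ) * poch (α + s) (N + 1 - s) * poch (c - s + 1) s
          + (N.choose s : ℝ) * poch (α + (s + 1 : ℕ)) (N + 1 - (s + 1))
            * poch (c - (s + 1 : ℕ) + 1) (s + 1)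
        = (α + c) * ((N.choose s : ℝ) * poch (α + 1 + s) (N - s) * poch (c - s + 1) s) := by
      intro s hs
      have hs' : s ≤ N := Nat.lt_succ_iff.1 (Finset.mem_range.1 hs)
      have e1 : poch (α + s) (N + 1 - s) = (α + s) * poch (α + 1 + s) (N - s) := by
        rw [Nat.succ_sub hs', poch_succ_left]; congr 2; ring
      have e2 : poch (c - (s + 1 : ℕ) + 1) (s + 1) = (c - s) * poch (c - s + 1) s := by
        rw [poch_succ_left]; push_cast; ring_nf
      have e3 : poch (α + (s + 1 : ℕ)) (N + 1 - (s + 1)) = poch (α + 1 + s) (N - s) := by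
        rw [Nat.add_sub_add_right]; congr 1; push_cast; ring
      rw [e1, e2, e3]; ring
    have h1 := Finset.sum_congr rfl key
    rw [Finset.sum_add_distrib, ← Finset.mul_sum, ih] at h1
    have h2 : poch (α + c) (N + 1) = (α + c) * poch (α + 1 + c) N := by
      rw [poch_succ_left]; congr 2; ring
    rw [h2, ← h1, Finset.sum_range_succ']
    rw [Finset.sum_congr rfl (fun s _ => by
      rw [Nat.choose_succ_succ, Nat.cast_add, add_mul, add_mul])]
    rw [Finset.sum_add_distrib, Finset.sum_range_succ (fun s : ℕ => ((N.choose (s + 1) : ℕ) : ℝ) * _ * _),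
      Finset.sum_range_succ' (fun s : ℕ => (N.choose s : ℝ) * poch (α + s) (N + 1 - s) * _)]
    simp
    ring

/-- `(u + v)^n P_n^{(a, b)}((v - u) / (u + v))`, written as a homogeneous polynomial in `u, v`. -/
noncomputable def jacobiForm (n : ℕ) (a b u v : ℝ) : ℝ :=
  ∑ s ∈ Finset.range (n + 1), (n.choose s : ℝ) / n.factorial * poch (a + 1 + s) (n - s)
    * poch (b + 1 + (n - s : ℕ)) s * (-u) ^ s * v ^ (n - s)

theorem poch_neg_natCast (n N : ℕ) (h : N ≤ n) :
    poch (-(n : ℝ)) N = (-1) ^ N * (n.choose N * N.factorial) := by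
  induction N with
  | zero => simp [poch_zero]
  | succ N ih =>
    have h' : N ≤ n := by omega
    have hc : ((n.choose (N + 1) : ℕ) : ℝ) * (N + 1) = n.choose N * (n - N) := by
      have := Nat.choose_succ_right_eq n N
      rw [← Nat.cast_sub h']
      exact_mod_cast this
    rw [poch_succ, ih h', Nat.factorial_succ, pow_succ]
    push_cast
    linear_combination (-1) ^ N * (N.factorial : ℝ) * (hc)

theorem hypergeometric_neg_natCast (n : ℕ) (b c x : ℝ) :
    ordinaryHypergeometric (-(n : ℝ)) b c x = ∑ N ∈ Finset.range (n + 1),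
      (-1) ^ N * (n.choose N : ℝ) * poch b N / poch c N * x ^ N := by
  rw [ordinaryHypergeometric_eq_tsum]
  beta_reduce
  rw [tsum_eq_sum (s := Finset.range (n + 1))]
  · refine Finset.sum_congr rfl fun N hN => ?_
    have h := poch_neg_natCast n N (Nat.lt_succ_iff.1 (Finset.mem_range.1 hN))
    have hf : (N.factorial : ℝ) ≠ 0 := by positivity
    simp only [poch] at h ⊢
    rw [h, smul_eq_mul]
    field_simp
  · intro N hN
    have hN' : n < N := by simpa using hN
    rw [(ascPochhammer_eval_eq_zero_iff N (-(n : ℝ))).2 ⟨n, hN', by simp⟩]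
    simp

/-- The Pfaff transformation of the terminating hypergeometric series defining `P_n^{(a, b)}`. -/
theorem jacobi_eq_jacobiForm (n : ℕ) (a b x : ℝ) (ha : 0 < a + 1) :
    jacobi n a b x = jacobiForm n a b ((1 - x) / 2) ((1 + x) / 2) := by
  set y := (1 - x) / 2 with hy
  have hv : (1 + x) / 2 = 1 - y := by rw [hy]; ring
  rw [jacobi, hypergeometric_neg_natCast, ← hy, hv, jacobiForm, Finset.mul_sum]
  set F : ℕ → ℕ → ℝ := fun N s => (-y) ^ N / n.factorial * ((n.choose s : ℝ)
    * (n - s).choose (N - s)) * poch (a + 1 + s) (n - s) * poch (b + 1 + (n - s : ℕ)) s with hF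
  have hL : ∀ N ∈ Finset.range (n + 1), poch (a + 1) n / n.factorial *
      ((-1) ^ N * (n.choose N : ℝ) * poch (n + a + b + 1) N / poch (a + 1) N * y ^ N)
      = ∑ s ∈ Finset.range (N + 1), F N s := by
    intro N hN
    have hN' : N ≤ n := Nat.lt_succ_iff.1 (Finset.mem_range.1 hN)
    have hp : poch (a + 1) N ≠ 0 := (poch_pos ha N).ne'
    have e : (n : ℝ) + a + b + 1 = a + 1 + (n + b) := by ring
    rw [e, ← sum_choose_mul_poch N (a + 1), ← poch_mul_sub (a + 1) hN', Finset.mul_sum, Finset.sum_div,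
      Finset.sum_mul, Finset.mul_sum]
    refine Finset.sum_congr rfl fun s hs => ?_
    have hs' : s ≤ N := Nat.lt_succ_iff.1 (Finset.mem_range.1 hs)
    have hc : (n.choose N : ℝ) * N.choose s = n.choose s * (n - s).choose (N - s) := by
      exact_mod_cast Nat.choose_mul hs'
    have hq : poch (a + 1 + s) (n - s) = poch (a + 1 + s) (N - s) * poch (a + 1 + N) (n - N) := by
      have : n - s = (N - s) + (n - N) := by omega
      rw [this, poch_add, Nat.cast_sub hs']; ring_nf
    have hb : b + 1 + (n - s : ℕ) = n + b - s + 1 := by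
      rw [Nat.cast_sub (hs'.trans hN')]; ring
    simp only [hF]
    rw [← hc, hq, hb, neg_pow y]
    field_simp
  rw [Finset.sum_congr rfl hL, Finset.sum_sigma']
  have hR : ∀ s ∈ Finset.range (n + 1), (n.choose s : ℝ) / n.factorial * poch (a + 1 + s) (n - s)
      * poch (b + 1 + (n - s : ℕ)) s * (-y) ^ s * (1 - y) ^ (n - s)
      = ∑ M ∈ Finset.range (n - s + 1), F (s + M) s := by
    intro s hs
    have : (1 - y) ^ (n - s) = ∑ M ∈ Finset.range (n - s + 1), (-y) ^ M * (n - s).choose M := by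
      rw [sub_eq_neg_add, add_pow]; simp
    rw [this, Finset.mul_sum]
    refine Finset.sum_congr rfl fun M _ => ?_
    simp only [hF, Nat.add_sub_cancel_left, pow_add]
    ring
  rw [Finset.sum_congr rfl hR, Finset.sum_sigma']
  refine Finset.sum_bij' (fun q _ => ⟨q.2, q.1 - q.2⟩) (fun q _ => ⟨q.1 + q.2, q.1⟩) ?_ ?_ ?_ ?_ ?_
  · rintro ⟨N, s⟩ h; simp only [Finset.mem_sigma, Finset.mem_range] at h ⊢; omega
  · rintro ⟨N, s⟩ h; simp only [Finset.mem_sigma, Finset.mem_range] at h ⊢; omega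
  · rintro ⟨N, s⟩ h
    simp only [Finset.mem_sigma, Finset.mem_range] at h
    have : s + (N - s) = N := by omega
    simp [this]
  · rintro ⟨N, s⟩ h; simp
  · rintro ⟨N, s⟩ h
    simp only [Finset.mem_sigma, Finset.mem_range] at h
    have : s + (N - s) = N := by omega
    simp [this]

theorem jacobiForm_mul (n : ℕ) (a b c u v : ℝ) :
    jacobiForm n a b (c * u) (c * v) = c ^ n * jacobiForm n a b u v := by
  rw [jacobiForm, jacobiForm, Finset.mul_sum]
  refine Finset.sum_congr rfl fun s hs => ?_
  have hs' : s ≤ n := Nat.lt_succ_iff.1 (Finset.mem_range.1 hs)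
  have : c ^ n = c ^ s * c ^ (n - s) := by rw [← pow_add, Nat.add_sub_cancel' hs']
  rw [this, ← mul_neg, mul_pow, mul_pow]; ring

/-- Dehomogenization of `jacobiForm`. -/
theorem pow_mul_jacobi (n : ℕ) (a b R u v x : ℝ) (ha : 0 < a + 1)
    (hu : R * (1 - x) = 2 * u) (hv : R * (1 + x) = 2 * v) :
    R ^ n * jacobi n a b x = jacobiForm n a b u v := by
  rw [jacobi_eq_jacobiForm n a b x ha, ← jacobiForm_mul]
  congr 1 <;> linarith

/-! ### Commutation relations of Dunkl operators -/

section General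

variable {N : ℕ}

theorem reflect_X (r : Fin N → ℝ) (i : Fin N) :
    reflect r (X i) = X i - C ((2 * r i / ∑ l, r l * r l : ℝ) : ℂ) * rootForm r := by
  simp [reflect]

theorem diffQuot_spec (r : Fin N → ℝ) (f : MvPolynomial (Fin N) ℂ) :
    rootForm r * diffQuot r f = f - reflect r f := rootForm_mul_diffQuotFun r f

theorem diffQuot_mul {r : Fin N → ℝ} (hr : rootForm r ≠ 0) (f g : MvPolynomial (Fin N) ℂ) :
    diffQuot r (g * f) = g * diffQuot r f + diffQuot r g * reflect r f := by
  apply mul_left_cancel₀ hr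
  rw [diffQuot_spec, map_mul, mul_add, mul_left_comm, diffQuot_spec, ← mul_assoc, diffQuot_spec]
  ring

theorem diffQuot_eq_zero {r : Fin N → ℝ} (hr : rootForm r ≠ 0) {f : MvPolynomial (Fin N) ℂ}
    (hf : reflect r f = f) : diffQuot r f = 0 := by
  apply mul_left_cancel₀ hr
  rw [diffQuot_spec, hf, sub_self, mul_zero]

theorem diffQuot_X {r : Fin N → ℝ} (hr : rootForm r ≠ 0) (i : Fin N) :
    diffQuot r (X i) = C ((2 * r i / ∑ l, r l * r l : ℝ) : ℂ) := by
  apply mul_left_cancel₀ hr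
  rw [diffQuot_spec, reflect_X]
  ring

/-- `∑_i x_i r_i (f - σ_r f) / ⟨x, r⟩ = f - σ_r f`. -/
theorem sum_X_mul_diffQuot (r : Fin N → ℝ) (f : MvPolynomial (Fin N) ℂ) :
    ∑ i, X i * (C (r i : ℂ) * diffQuot r f) = f - reflect r f := by
  rw [← diffQuot_spec, rootForm, Finset.sum_mul]
  exact Finset.sum_congr rfl fun i _ => by ring

variable {ι : Type} [Fintype ι] (root : ι → Fin N → ℝ) (κ : ι → ℝ)

theorem dunkl_apply (j : Fin N) (f : MvPolynomial (Fin N) ℂ) :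
    dunkl root κ j f
      = pderiv j f + ∑ a, C ((κ a * root a j : ℝ) : ℂ) * diffQuot (root a) f := by
  simp [dunkl, LinearMap.sum_apply, smul_eq_C_mul]

/-- A Dunkl operator is a derivation over the polynomials that are invariant under the
reflections it involves. -/
theorem dunkl_invariant_mul (hr : ∀ a, rootForm (root a) ≠ 0) (j : Fin N)
    (f g : MvPolynomial (Fin N) ℂ) (hg : ∀ a, root a j ≠ 0 → reflect (root a) g = g) :
    dunkl root κ j (g * f) = pderiv j g * f + g * dunkl root κ j f := by
  rw [dunkl_apply, dunkl_apply, Derivation.leibniz, smul_eq_mul, smul_eq_mul, mul_add,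
    Finset.mul_sum]
  have h : ∀ a, C ((κ a * root a j : ℝ) : ℂ) * diffQuot (root a) (g * f)
      = g * (C ((κ a * root a j : ℝ) : ℂ) * diffQuot (root a) f) := by
    intro a
    by_cases h0 : root a j = 0
    · simp [h0]
    · rw [diffQuot_mul (hr a), diffQuot_eq_zero (hr a) (hg a h0)]
      ring
  rw [Finset.sum_congr rfl fun a _ => h a]
  ring

/-- The commutator of a Dunkl operator with a variable. -/
theorem dunkl_X_mul (hr : ∀ a, rootForm (root a) ≠ 0) (i j : Fin N)
    (f : MvPolynomial (Fin N) ℂ) :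
    dunkl root κ j (X i * f) = pderiv j (X i) * f + X i * dunkl root κ j f
      + ∑ a, C ((κ a * root a j * (2 * root a i / ∑ l, root a l * root a l) : ℝ) : ℂ)
        * reflect (root a) f := by
  rw [dunkl_apply, dunkl_apply, Derivation.leibniz, smul_eq_mul, smul_eq_mul, mul_add,
    Finset.mul_sum]
  have h : ∀ a, C ((κ a * root a j : ℝ) : ℂ) * diffQuot (root a) (X i * f)
      = X i * (C ((κ a * root a j : ℝ) : ℂ) * diffQuot (root a) f)
        + C ((κ a * root a j * (2 * root a i / ∑ l, root a l * root a l) : ℝ) : ℂ)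
        * reflect (root a) f := by
    intro a
    rw [diffQuot_mul (hr a), diffQuot_X (hr a), Complex.ofReal_mul (κ a * root a j), C_mul]
    ring
  rw [Finset.sum_congr rfl fun a _ => h a, Finset.sum_add_distrib]
  ring

end General

/-! ### The dihedral reflections in complex coordinates -/

/-- The cosine of the angle of the `j`-th mirror. -/
noncomputable def mirrorCos (m j : ℕ) : ℂ := (Real.cos (j * Real.pi / m) : ℝ)

/-- The sine of the angle of the `j`-th mirror. -/
noncomputable def mirrorSin (m j : ℕ) : ℂ := (Real.sin (j * Real.pi / m) : ℝ)

theorem C_two : (C 2 : MvPolynomial (Fin 3) ℂ) = 2 := rfl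

theorem mirrorCos_sq_add (m j : ℕ) : mirrorCos m j ^ 2 + mirrorSin m j ^ 2 = 1 := by
  rw [mirrorCos, mirrorSin, ← Complex.ofReal_pow, ← Complex.ofReal_pow, ← Complex.ofReal_add,
    Real.cos_sq_add_sin_sq, Complex.ofReal_one]

/-- The root `(sin (jπ/m), -cos (jπ/m), 0)` orthogonal to the `j`-th mirror. -/
noncomputable def mirrorRoot (m j : ℕ) : Fin 3 → ℝ :=
  ![Real.sin (j * Real.pi / m), -Real.cos (j * Real.pi / m), 0]

theorem posRoot_succ (m : ℕ) (j : Fin m) : posRoot m j.succ = mirrorRoot m (j + 1) := by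
  simp [posRoot, mirrorRoot]

theorem posRoot_zero (m : ℕ) : posRoot m 0 = ![0, 0, 1] := by
  simp [posRoot]

theorem posRoot_inner_self (m : ℕ) (a : Fin (m + 1)) :
    ∑ l, posRoot m a l * posRoot m a l = 1 := by
  refine Fin.cases ?_ (fun j => ?_) a
  · simp [posRoot_zero, Fin.sum_univ_three]
  · rw [posRoot_succ]
    simp only [Fin.sum_univ_three, mirrorRoot, Matrix.cons_val_zero, Matrix.cons_val_one,
      Matrix.cons_val]
    nlinarith [Real.cos_sq_add_sin_sq ((j + 1 : ℕ) * Real.pi / m)]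

theorem mirrorRoot_inner_self (m j : ℕ) : ∑ l, mirrorRoot m j l * mirrorRoot m j l = 1 := by
  simp only [Fin.sum_univ_three, mirrorRoot, Matrix.cons_val_zero, Matrix.cons_val_one,
    Matrix.cons_val]
  nlinarith [Real.cos_sq_add_sin_sq (j * Real.pi / m)]

theorem rootForm_ne_zero {N : ℕ} {r : Fin N → ℝ} (hr : ∑ l, r l * r l = 1) : rootForm r ≠ 0 := by
  intro h
  have h1 : eval (fun i => (r i : ℂ)) (rootForm r) = 1 := by
    simp only [rootForm, map_sum, map_mul, eval_C, eval_X, ← Complex.ofReal_mul,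
      ← Complex.ofReal_sum, hr, Complex.ofReal_one]
  rw [h, map_zero] at h1
  exact zero_ne_one h1

theorem rootForm_posRoot_zero (m : ℕ) : rootForm (posRoot m 0) = X 2 := by
  simp [rootForm, posRoot_zero, Fin.sum_univ_three]

theorem rootForm_mirrorRoot (m j : ℕ) : rootForm (mirrorRoot m j)
    = C (mirrorSin m j) * X 0 - C (mirrorCos m j) * X 1 := by
  simp only [rootForm, mirrorRoot, Fin.sum_univ_three, Matrix.cons_val_zero, Matrix.cons_val_one,
    Matrix.cons_val, mirrorSin, mirrorCos, Complex.ofReal_neg, Complex.ofReal_zero, map_neg,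
    map_zero]
  ring

theorem rootForm_posRoot_ne_zero (m : ℕ) (a : Fin (m + 1)) : rootForm (posRoot m a) ≠ 0 :=
  rootForm_ne_zero (posRoot_inner_self m a)

theorem reflect_posRoot_X (m : ℕ) (a : Fin (m + 1)) (i : Fin 3) : reflect (posRoot m a) (X i)
    = X i - C ((2 * posRoot m a i : ℝ) : ℂ) * rootForm (posRoot m a) := by
  rw [reflect_X, posRoot_inner_self, div_one]

theorem reflect_mirrorRoot_X (m j : ℕ) (i : Fin 3) : reflect (mirrorRoot m j) (X i)
    = X i - C ((2 * mirrorRoot m j i : ℝ) : ℂ) * rootForm (mirrorRoot m j) := by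
  rw [reflect_X, mirrorRoot_inner_self, div_one]

theorem reflect_mirrorRoot_X_two (m j : ℕ) : reflect (mirrorRoot m j) (X 2) = X 2 := by
  rw [reflect_mirrorRoot_X]
  simp [mirrorRoot]

theorem reflect_posRoot_zero_X_two (m : ℕ) : reflect (posRoot m 0) (X 2) = -X 2 := by
  rw [reflect_posRoot_X, rootForm_posRoot_zero, posRoot_zero]
  simp only [Matrix.cons_val, mul_one, Complex.ofReal_ofNat]
  rw [C_two]
  ring

theorem reflect_posRoot_zero_X (m : ℕ) {i : Fin 3} (hi : i ≠ 2) :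
    reflect (posRoot m 0) (X i) = X i := by
  have h : (posRoot m 0) i = 0 := by
    rw [posRoot_zero]; fin_cases i <;> simp at hi ⊢
  rw [reflect_posRoot_X, h]
  simp

/-- The linear form `x₁ + ε x₂`: for `ε = ±i`, the complex coordinate `z` or `z̄` of the plane. -/
noncomputable def coord (ε : ℂ) : MvPolynomial (Fin 3) ℂ := X 0 + C ε * X 1

/-- `η_j`, such that the `j`-th planar reflection maps `x₁ - ε x₂` to `η_j (x₁ + ε x₂)`. -/
noncomputable def mirrorUnit (m : ℕ) (ε : ℂ) (j : ℕ) : ℂ := (mirrorCos m j - ε * mirrorSin m j) ^ 2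

theorem C_sq_eq {ε : ℂ} (hε : ε ^ 2 = -1) : (C ε : MvPolynomial (Fin 3) ℂ) ^ 2 = -1 := by
  rw [← C_pow, hε, C_neg, C_1]

theorem C_mirror_sq (m j : ℕ) : (C (mirrorCos m j) : MvPolynomial (Fin 3) ℂ) ^ 2
    + C (mirrorSin m j) ^ 2 = 1 := by
  rw [← C_pow, ← C_pow, ← C_add, mirrorCos_sq_add, C_1]

theorem reflect_coord_neg (m j : ℕ) {ε : ℂ} (hε : ε ^ 2 = -1) :
    reflect (mirrorRoot m j) (coord (-ε)) = C (mirrorUnit m ε j) * coord ε := by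
  have h0 : reflect (mirrorRoot m j) (X 0)
      = X 0 - 2 * C (mirrorSin m j) * rootForm (mirrorRoot m j) := by
    rw [reflect_mirrorRoot_X]
    simp [mirrorRoot, mirrorSin, C_two]
  have h1 : reflect (mirrorRoot m j) (X 1)
      = X 1 + 2 * C (mirrorCos m j) * rootForm (mirrorRoot m j) := by
    rw [reflect_mirrorRoot_X]
    simp [mirrorRoot, mirrorCos, C_two]
  have hC : reflect (mirrorRoot m j) (C (-ε)) = C (-ε) := AlgHom.commutes _ _
  rw [coord, map_add, map_mul, h0, h1, hC, rootForm_mirrorRoot, mirrorUnit, coord]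
  simp only [C_neg, C_pow, C_sub, C_mul]
  have e := C_sq_eq hε
  have s := C_mirror_sq m j
  generalize (C ε : MvPolynomial (Fin 3) ℂ) = e' at *
  generalize (C (mirrorCos m j) : MvPolynomial (Fin 3) ℂ) = cs at *
  generalize (C (mirrorSin m j) : MvPolynomial (Fin 3) ℂ) = sn at *
  linear_combination (-(X 0 - e' * X 1)) * s + (2 * cs * sn * X 1 - sn ^ 2 * X 0
    - e' * sn ^ 2 * X 1) * e

theorem mirrorUnit_neg_mul (m j : ℕ) {ε : ℂ} (hε : ε ^ 2 = -1) :
    mirrorUnit m (-ε) j * mirrorUnit m ε j = 1 := by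
  have h : (mirrorCos m j - -ε * mirrorSin m j) * (mirrorCos m j - ε * mirrorSin m j) = 1 := by
    linear_combination mirrorCos_sq_add m j - mirrorSin m j ^ 2 * hε
  rw [mirrorUnit, mirrorUnit, ← mul_pow, h, one_pow]

/-- The units `η_j` are the powers of a primitive `m`-th root of unity. -/
theorem exists_mirrorUnit_eq_pow (m : ℕ) (hm : m ≠ 0) {ε : ℂ} (hε : ε ^ 2 = -1) :
    ∃ ξ : ℂ, IsPrimitiveRoot ξ m ∧ ∀ j, mirrorUnit m ε j = ξ ^ j := by
  have hζ := Complex.isPrimitiveRoot_exp m hm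
  have hm' : (m : ℂ) ≠ 0 := by exact_mod_cast hm
  have key : ∀ j, mirrorUnit m (-Complex.I) j = Complex.exp (2 * Real.pi * Complex.I / m) ^ j := by
    intro j
    have h : mirrorCos m j - -Complex.I * mirrorSin m j
        = Complex.exp ((j * Real.pi / m : ℝ) * Complex.I) := by
      rw [Complex.exp_mul_I, mirrorCos, mirrorSin, Complex.ofReal_cos, Complex.ofReal_sin]
      ring
    rw [mirrorUnit, h, ← Complex.exp_nat_mul, ← Complex.exp_nat_mul]
    congr 1
    push_cast
    field_simp
  rcases sq_eq_sq_iff_eq_or_eq_neg.1 (hε.trans Complex.I_sq.symm) with rfl | rfl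
  · refine ⟨_, hζ.inv, fun j => ?_⟩
    rw [inv_pow, ← key]
    exact eq_inv_of_mul_eq_one_right (mirrorUnit_neg_mul m j Complex.I_sq)
  · exact ⟨_, hζ, key⟩

/-! ### Sums of difference quotients over the mirrors -/

/-- Orthogonality of the powers `η^a`, `η^b` on the coset `{η₀ ξ^i}` of the `p`-th roots of unity. -/
theorem sum_pow_mul_inv_pow {p : ℕ} {ξ : ℂ} (hξ : IsPrimitiveRoot ξ p) {η₀ : ℂ} (h0 : η₀ ≠ 0)
    {a b : ℕ} (ha : a < p) (hb : b < p) :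
    ∑ i ∈ Finset.range p, (η₀ * ξ ^ i) ^ a * ((η₀ * ξ ^ i)⁻¹) ^ b
      = if a = b then (p : ℂ) else 0 := by
  have hp : p ≠ 0 := by omega
  have hξ0 : ξ ≠ 0 := hξ.ne_zero hp
  split_ifs with h
  · subst h
    rw [Finset.sum_congr rfl (g := fun _ => (1 : ℂ)) fun i _ => ?_]
    · simp
    · rw [← mul_pow, mul_inv_cancel₀ (mul_ne_zero h0 (pow_ne_zero _ hξ0)), one_pow]
  · have hr : ∀ i ∈ Finset.range p, (η₀ * ξ ^ i) ^ a * ((η₀ * ξ ^ i)⁻¹) ^ b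
        = (η₀ ^ a / η₀ ^ b) * (ξ ^ a / ξ ^ b) ^ i := by
      intro i _
      rw [inv_pow, mul_pow, mul_pow, div_pow, ← pow_mul, ← pow_mul, ← pow_mul, ← pow_mul,
        mul_comm i a, mul_comm i b]
      field_simp
    rw [Finset.sum_congr rfl hr, ← Finset.mul_sum]
    have h1 : ξ ^ a / ξ ^ b - 1 ≠ 0 := by
      rw [sub_ne_zero, Ne, div_eq_one_iff_eq (pow_ne_zero _ hξ0)]
      exact fun h' => h (hξ.pow_inj ha hb h')
    have h2 : (∑ i ∈ Finset.range p, (ξ ^ a / ξ ^ b) ^ i) * (ξ ^ a / ξ ^ b - 1) = 0 := by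
      rw [geom_sum_mul, div_pow, ← pow_mul, ← pow_mul, mul_comm a, mul_comm b, pow_mul, pow_mul,
        hξ.pow_eq_one]
      simp
    rw [(mul_eq_zero.1 h2).resolve_right h1, mul_zero]

/-- Partial fractions: if `η_i` runs through the solutions of `η^p = e`, then
`∑_i (B^ℓ h - (A / η_i)^ℓ h') / (A - η_i B) = p A^{p-1} B^ℓ (h - h') / (A^p - e B^p)`. -/
theorem sum_quotient_mul {p : ℕ} {ξ : ℂ} (hξ : IsPrimitiveRoot ξ p) {η₀ e : ℂ} (h0 : η₀ ≠ 0)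
    (he : η₀ ^ p = e) {l : ℕ} (hl : l < p) (A B h h' : MvPolynomial (Fin 3) ℂ)
    (Q : ℕ → MvPolynomial (Fin 3) ℂ)
    (hQ : ∀ i < p, (A - C (η₀ * ξ ^ i) * B) * Q i
      = 2 * (B ^ l * h - C (((η₀ * ξ ^ i)⁻¹) ^ l) * A ^ l * h')) :
    (A ^ p - C e * B ^ p) * ∑ i ∈ Finset.range p, Q i
      = 2 * (p : MvPolynomial (Fin 3) ℂ) * A ^ (p - 1) * B ^ l * (h - h') := by
  have step : ∀ i ∈ Finset.range p, (A ^ p - C e * B ^ p) * Q i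
      = ∑ a ∈ Finset.range p, (2 * (A ^ (p - 1 - a) * B ^ a * B ^ l * h)
          * C ((η₀ * ξ ^ i) ^ a * ((η₀ * ξ ^ i)⁻¹) ^ 0)
        - 2 * (A ^ (p - 1 - a) * B ^ a * A ^ l * h')
          * C ((η₀ * ξ ^ i) ^ a * ((η₀ * ξ ^ i)⁻¹) ^ l)) := by
    intro i hi
    have h1 : C e * B ^ p = (C (η₀ * ξ ^ i) * B) ^ p := by
      rw [mul_pow, ← C_pow, mul_pow, he, ← pow_mul, mul_comm i, pow_mul, hξ.pow_eq_one, one_pow,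
        mul_one]
    have h2 := geom_sum₂_mul (C (η₀ * ξ ^ i) * B) A p
    have h3 : (A ^ p - (C (η₀ * ξ ^ i) * B) ^ p) * Q i
        = (∑ a ∈ Finset.range p, (C (η₀ * ξ ^ i) * B) ^ a * A ^ (p - 1 - a))
          * ((A - C (η₀ * ξ ^ i) * B) * Q i) := by
      linear_combination Q i * h2
    rw [h1, h3, hQ i (Finset.mem_range.1 hi), Finset.sum_mul]
    refine Finset.sum_congr rfl fun a _ => ?_
    rw [mul_pow, ← C_pow]
    simp only [C_mul, pow_zero, C_1]
    ring
  rw [Finset.mul_sum, Finset.sum_congr rfl step, Finset.sum_comm]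
  have hp : 0 < p := by omega
  have step2 : ∀ a ∈ Finset.range p,
      ∑ i ∈ Finset.range p, (2 * (A ^ (p - 1 - a) * B ^ a * B ^ l * h)
          * C ((η₀ * ξ ^ i) ^ a * ((η₀ * ξ ^ i)⁻¹) ^ 0)
        - 2 * (A ^ (p - 1 - a) * B ^ a * A ^ l * h')
          * C ((η₀ * ξ ^ i) ^ a * ((η₀ * ξ ^ i)⁻¹) ^ l))
      = (if a = 0 then 2 * (A ^ (p - 1 - a) * B ^ a * B ^ l * h) * p else 0)
        - (if a = l then 2 * (A ^ (p - 1 - a) * B ^ a * A ^ l * h') * p else 0) := by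
    intro a ha
    have ha' := Finset.mem_range.1 ha
    rw [Finset.sum_sub_distrib, ← Finset.mul_sum, ← Finset.mul_sum, ← map_sum, ← map_sum,
      sum_pow_mul_inv_pow hξ h0 ha' hp, sum_pow_mul_inv_pow hξ h0 ha' hl]
    congr 1 <;> split_ifs <;> simp
  rw [Finset.sum_congr rfl step2, Finset.sum_sub_distrib, Finset.sum_ite_eq', Finset.sum_ite_eq',
    if_pos (Finset.mem_range.2 hp), if_pos (Finset.mem_range.2 hl)]
  have h3 : A ^ (p - 1 - l) * B ^ l * A ^ l * h' = A ^ (p - 1) * B ^ l * h' := by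
    have : A ^ (p - 1) = A ^ (p - 1 - l) * A ^ l := by rw [← pow_add]; congr 1; omega
    rw [this]; ring
  rw [h3, pow_zero, Nat.sub_zero]
  ring

/-! ### The planar Dunkl operators `𝒟₁ + ε 𝒟₂`, `ε = ±i` -/

theorem reflect_coord (m j : ℕ) {ε : ℂ} (hε : ε ^ 2 = -1) :
    reflect (mirrorRoot m j) (coord ε) = C ((mirrorUnit m ε j)⁻¹) * coord (-ε) := by
  have h := reflect_coord_neg m j (ε := -ε) (by rw [neg_sq, hε])
  rw [neg_neg] at h
  rw [h, eq_inv_of_mul_eq_one_left (mirrorUnit_neg_mul m j hε)]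

theorem coord_ne_zero (ε : ℂ) : coord ε ≠ 0 := by
  intro h
  have h1 : eval (![1, 0, 0] : Fin 3 → ℂ) (coord ε) = 1 := by simp [coord]
  rw [h, map_zero] at h1
  exact zero_ne_one h1

/-- The part of `𝒟₁ + ε 𝒟₂` contributed by the `j`-th mirror, for multiplicity one. -/
noncomputable def mirrorQuot (m : ℕ) (ε : ℂ) (j : ℕ) (f : MvPolynomial (Fin 3) ℂ) :
    MvPolynomial (Fin 3) ℂ :=
  C (mirrorSin m j - ε * mirrorCos m j) * diffQuot (mirrorRoot m j) f

theorem mirrorQuot_spec (m j : ℕ) {ε : ℂ} (hε : ε ^ 2 = -1) (f : MvPolynomial (Fin 3) ℂ) :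
    (coord (-ε) - C (mirrorUnit m ε j) * coord ε) * mirrorQuot m ε j f
      = 2 * (f - reflect (mirrorRoot m j) f) := by
  rw [← diffQuot_spec, mirrorQuot, rootForm_mirrorRoot, mirrorUnit, coord, coord]
  simp only [C_neg, C_pow, C_sub, C_mul]
  have e := C_sq_eq hε
  have s := C_mirror_sq m j
  generalize (C ε : MvPolynomial (Fin 3) ℂ) = e' at *
  generalize (C (mirrorCos m j) : MvPolynomial (Fin 3) ℂ) = cs at *
  generalize (C (mirrorSin m j) : MvPolynomial (Fin 3) ℂ) = sn at *
  -- the left-hand factor is `2 ε (cs - ε sn) ⟨x, α_j⟩`, since `cs² + sn² = 1`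
  have h1 : X 0 + -e' * X 1 - (cs - e' * sn) ^ 2 * (X 0 + e' * X 1)
      = 2 * e' * (cs - e' * sn) * (sn * X 0 - cs * X 1) := by
    linear_combination (-(X 0 - e' * X 1)) * s + (sn ^ 2 * X 0 - e' * sn ^ 2 * X 1) * e
  have h2 : e' * (cs - e' * sn) * (sn - e' * cs) = 1 := by
    linear_combination s + (-cs ^ 2 - sn ^ 2 + e' * cs * sn) * e
  rw [h1]
  linear_combination 2 * (sn * X 0 - cs * X 1) * diffQuot (mirrorRoot m j) f * h2

/-- The operator `𝒟₁ + ε 𝒟₂`. For `ε = i` and `ε = -i` it is twice the Dunkl analogue of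
`∂/∂z̄` and `∂/∂z`. -/
noncomputable def planarDunkl (m : ℕ) (κ₀ κ₁ κₘ : ℝ) (ε : ℂ) :
    MvPolynomial (Fin 3) ℂ →ₗ[ℂ] MvPolynomial (Fin 3) ℂ :=
  dunkl (posRoot m) (mult m κ₀ κ₁ κₘ) 0 + ε • dunkl (posRoot m) (mult m κ₀ κ₁ κₘ) 1

/-- The derivation `∂₁ + ε ∂₂`. -/
noncomputable def planarDeriv (ε : ℂ) :
    Derivation ℂ (MvPolynomial (Fin 3) ℂ) (MvPolynomial (Fin 3) ℂ) :=
  pderiv 0 + ε • pderiv 1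

theorem planarDeriv_coord_neg {ε : ℂ} (hε : ε ^ 2 = -1) : planarDeriv ε (coord (-ε)) = 2 := by
  have e := C_sq_eq hε
  simp [planarDeriv, coord, smul_eq_C_mul, pderiv_X]
  linear_combination -e

theorem planarDeriv_coord {ε : ℂ} (hε : ε ^ 2 = -1) : planarDeriv ε (coord ε) = 0 := by
  have e := C_sq_eq hε
  simp [planarDeriv, coord, smul_eq_C_mul, pderiv_X]
  linear_combination e

theorem planarDunkl_apply (m : ℕ) (κ₀ κ₁ κₘ : ℝ) (ε : ℂ) (f : MvPolynomial (Fin 3) ℂ) :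
    planarDunkl m κ₀ κ₁ κₘ ε f = planarDeriv ε f + ∑ j ∈ Finset.range m,
      C ((if Even (j + 1) then κₘ else κ₁ : ℝ) : ℂ) * mirrorQuot m ε (j + 1) f := by
  rw [planarDunkl, LinearMap.add_apply, LinearMap.smul_apply, dunkl_apply, dunkl_apply,
    Fin.sum_univ_succ, Fin.sum_univ_succ, posRoot_zero, Finset.sum_range]
  have h : ∀ j : Fin m, C ((if Even ((j : ℕ) + 1) then κₘ else κ₁ : ℝ) : ℂ)
        * mirrorQuot m ε (j + 1) f
      = C ((mult m κ₀ κ₁ κₘ j.succ * posRoot m j.succ 0 : ℝ) : ℂ) * diffQuot (posRoot m j.succ) f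
        + C ε * (C ((mult m κ₀ κ₁ κₘ j.succ * posRoot m j.succ 1 : ℝ) : ℂ)
          * diffQuot (posRoot m j.succ) f) := by
    intro j
    have hm : mult m κ₀ κ₁ κₘ j.succ = if Even ((j : ℕ) + 1) then κₘ else κ₁ := by simp [mult]
    have r0 : mirrorSin m (j + 1) = (mirrorRoot m (j + 1) 0 : ℝ) := by simp [mirrorSin, mirrorRoot]
    have r1 : mirrorCos m (j + 1) = (-mirrorRoot m (j + 1) 1 : ℝ) := by
      simp [mirrorCos, mirrorRoot]
    rw [hm, posRoot_succ, mirrorQuot, r0, r1, Complex.ofReal_mul, Complex.ofReal_mul]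
    simp only [C_mul, C_sub, Complex.ofReal_neg, C_neg]
    ring
  rw [Finset.sum_congr rfl fun j _ => h j, Finset.sum_add_distrib, ← Finset.mul_sum]
  simp [planarDeriv, smul_eq_C_mul, mult]
  ring

/-! ### Polynomials annihilated by `𝒟₁ + ε 𝒟₂` -/

/-- The telescoping sum behind the monogenicity of `φ_k^±` for odd `m`. -/
theorem sum_eq_zero_of_odd_recurrence {R : Type*} [CommRing R] (a : ℕ) (c : ℕ → R) (κ V W : R)
    (h : ∀ j < a, j * c j - (j + 1) * c (j + 1) + κ * (c j - c (a - j)) = 0)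
    (ha : a * c a + κ * (c a - c 0) = 0) :
    (V - W) * ∑ j ∈ Finset.range (a + 1), j * c j * V ^ j * W ^ (a - j)
      + κ * V * (∑ j ∈ Finset.range (a + 1), c j * V ^ j * W ^ (a - j)
        - ∑ j ∈ Finset.range (a + 1), c j * W ^ j * V ^ (a - j)) = 0 := by
  have hrefl : ∑ j ∈ Finset.range (a + 1), c j * W ^ j * V ^ (a - j)
      = ∑ j ∈ Finset.range (a + 1), c (a - j) * V ^ j * W ^ (a - j) := by
    rw [← Finset.sum_range_reflect]
    refine Finset.sum_congr rfl fun j hj => ?_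
    have hj' : j ≤ a := Nat.lt_succ_iff.1 (Finset.mem_range.1 hj)
    have e1 : a + 1 - 1 - j = a - j := by omega
    have e2 : a - (a - j) = j := by omega
    rw [e1, e2]; ring
  have hW : W * ∑ j ∈ Finset.range (a + 1), j * c j * V ^ j * W ^ (a - j)
      = ∑ j ∈ Finset.range a, (j + 1) * c (j + 1) * V ^ (j + 1) * W ^ (a - j) := by
    rw [Finset.sum_range_succ', mul_add, Finset.mul_sum]
    simp only [Nat.cast_zero, zero_mul, mul_zero, add_zero]
    refine Finset.sum_congr rfl fun j hj => ?_
    have hj' := Finset.mem_range.1 hj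
    have e1 : a - j = a - (j + 1) + 1 := by omega
    rw [e1, pow_succ W]; push_cast; ring
  have hs : V * (∑ j ∈ Finset.range (a + 1), j * c j * V ^ j * W ^ (a - j))
      + κ * V * (∑ j ∈ Finset.range (a + 1), c j * V ^ j * W ^ (a - j)
        - ∑ j ∈ Finset.range (a + 1), c (a - j) * V ^ j * W ^ (a - j))
      = ∑ j ∈ Finset.range a, (j + 1) * c (j + 1) * V ^ (j + 1) * W ^ (a - j) := by
    rw [← Finset.sum_sub_distrib, Finset.mul_sum, Finset.mul_sum, ← Finset.sum_add_distrib,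
      Finset.sum_range_succ]
    have h0 : V * (a * c a * V ^ a * W ^ (a - a))
        + κ * V * (c a * V ^ a * W ^ (a - a) - c (a - a) * V ^ a * W ^ (a - a)) = 0 := by
      rw [Nat.sub_self]
      linear_combination V * V ^ a * W ^ 0 * ha
    rw [h0, add_zero]
    refine Finset.sum_congr rfl fun j hj => ?_
    linear_combination V ^ (j + 1) * W ^ (a - j) * h j (Finset.mem_range.1 hj)
  rw [hrefl, sub_mul, hW]
  linear_combination hs

/-- The telescoping sum behind the monogenicity of `φ_k^±` for even `m`. -/
theorem sum_eq_zero_of_even_recurrence {R : Type*} [CommRing R] (a : ℕ) (e g g' : ℕ → R)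
    (hg : g 0 = 0) (hg' : g' 0 = 0) (h : ∀ j < a, e j * g (a - j) = e (j + 1) * g' (j + 1))
    (x q : R) :
    ∑ j ∈ Finset.range (a + 1), (e j * g (a - j) * x ^ (a - j) * q ^ (j + 1)
      - e j * g' j * x ^ (a - j + 1) * q ^ j) = 0 := by
  rw [Finset.sum_sub_distrib, Finset.sum_range_succ, Finset.sum_range_succ', Nat.sub_self, hg, hg']
  simp only [mul_zero, zero_mul, add_zero]
  rw [← Finset.sum_sub_distrib]
  refine Finset.sum_eq_zero fun j hj => ?_
  have hj' := Finset.mem_range.1 hj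
  have e1 : a - j = a - (j + 1) + 1 := by omega
  have h' := h j hj'
  rw [← e1]
  linear_combination x ^ (a - j) * q ^ (j + 1) * h'

/-- The coefficients of `φ_k^±` for odd `m`. -/
noncomputable def oddCoeff (κ : ℝ) (a j : ℕ) : ℝ :=
  poch κ j * poch (κ + 1) (a - j) / (j.factorial * (a - j).factorial)

/-- The factor `γ_n` in the action `x^n ↦ γ_n x^{n-1}` of the one-variable Dunkl operator. -/
noncomputable def stepNum (κ : ℝ) (n : ℕ) : ℝ := n + κ * (1 - (-1) ^ n)

/-- The Dunkl factorial `γ_1 γ_2 ⋯ γ_n`. -/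
noncomputable def stepFactorial (κ : ℝ) (n : ℕ) : ℝ := ∏ i ∈ Finset.range n, stepNum κ (i + 1)

/-- The coefficients of `φ_k^±` for even `m`, up to a common factor. -/
noncomputable def evenCoeff (κ₁ κₘ : ℝ) (a j : ℕ) : ℝ :=
  1 / (stepFactorial κ₁ (a - j) * stepFactorial κₘ j)

/-- `∑_j (κ)_j (κ + 1)_{a-j} / (j! (a-j)!) V^j W^{a-j}`. -/
noncomputable def oddForm (κ : ℝ) (a : ℕ) (W V : MvPolynomial (Fin 3) ℂ) : MvPolynomial (Fin 3) ℂ :=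
  ∑ j ∈ Finset.range (a + 1), C (oddCoeff κ a j : ℂ) * V ^ j * W ^ (a - j)

/-- The part of degree `a` of the product of the Dunkl exponentials `∑ x^i / γ_i!` and
`∑ q^j / γ_j!`, with multiplicity `κ₁` for `x` and `κ_m` for `q`. It occurs at `x = (W + V) / 2`,
`q = (W - V) / 2`, where `W` and `V` are the `p`-th powers of the complex coordinates: the two
orbits of mirrors act by `x ↦ -x` and by `q ↦ -q`. -/
noncomputable def evenForm (κ₁ κₘ : ℝ) (a : ℕ) (x q : MvPolynomial (Fin 3) ℂ) :
    MvPolynomial (Fin 3) ℂ :=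
  ∑ j ∈ Finset.range (a + 1), C (evenCoeff κ₁ κₘ a j : ℂ) * x ^ (a - j) * q ^ j

theorem stepNum_zero (κ : ℝ) : stepNum κ 0 = 0 := by simp [stepNum]

theorem stepNum_pos {κ : ℝ} (hκ : 0 < κ) (n : ℕ) : 0 < stepNum κ (n + 1) := by
  rw [stepNum]
  rcases neg_one_pow_eq_or ℝ (n + 1) with h | h <;> rw [h] <;> push_cast <;> norm_num <;> positivity

theorem stepFactorial_pos {κ : ℝ} (hκ : 0 < κ) (n : ℕ) : 0 < stepFactorial κ n :=
  Finset.prod_pos fun i _ => stepNum_pos hκ i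

theorem stepFactorial_succ (κ : ℝ) (n : ℕ) :
    stepFactorial κ (n + 1) = stepFactorial κ n * stepNum κ (n + 1) := Finset.prod_range_succ _ _

theorem evenCoeff_recurrence {κ₁ κₘ : ℝ} (h₁ : 0 < κ₁) (hₘ : 0 < κₘ) {a j : ℕ} (hj : j < a) :
    evenCoeff κ₁ κₘ a j * stepNum κ₁ (a - j)
      = evenCoeff κ₁ κₘ a (j + 1) * stepNum κₘ (j + 1) := by
  obtain ⟨b, rfl⟩ : ∃ b, a = j + 1 + b := ⟨a - (j + 1), by omega⟩
  have e1 : j + 1 + b - j = b + 1 := by omega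
  have e2 : j + 1 + b - (j + 1) = b := by omega
  rw [evenCoeff, evenCoeff, e1, e2, stepFactorial_succ, stepFactorial_succ]
  have := (stepFactorial_pos h₁ b).ne'
  have := (stepFactorial_pos hₘ j).ne'
  have := (stepNum_pos h₁ b).ne'
  have := (stepNum_pos hₘ j).ne'
  field_simp

theorem oddCoeff_recurrence (κ : ℝ) {a j : ℕ} (hj : j < a) :
    j * oddCoeff κ a j - (j + 1) * oddCoeff κ a (j + 1)
      + κ * (oddCoeff κ a j - oddCoeff κ a (a - j)) = 0 := by
  obtain ⟨b, rfl⟩ : ∃ b, a = j + 1 + b := ⟨a - (j + 1), by omega⟩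
  have e1 : j + 1 + b - j = b + 1 := by omega
  have e2 : j + 1 + b - (j + 1) = b := by omega
  have e3 : j + 1 + b - (b + 1) = j := by omega
  rw [oddCoeff, oddCoeff, oddCoeff, e1, e2, e3, poch_succ_left κ b, poch_succ (κ + 1) b,
    poch_succ_left κ j, Nat.factorial_succ, Nat.factorial_succ]
  have hx : poch κ j * (κ + j) = κ * poch (κ + 1) j := by rw [← poch_succ, poch_succ_left]
  push_cast
  field_simp
  linear_combination (poch (κ + 1) b * (κ + 1 + b)) * hx

theorem oddCoeff_self (κ : ℝ) (a : ℕ) :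
    a * oddCoeff κ a a + κ * (oddCoeff κ a a - oddCoeff κ a 0) = 0 := by
  have hx : poch κ a * (κ + a) = κ * poch (κ + 1) a := by rw [← poch_succ, poch_succ_left]
  simp only [oddCoeff, Nat.sub_self, Nat.sub_zero, poch_zero, Nat.factorial_zero]
  field_simp
  linear_combination hx

section

variable {ε : ℂ}

theorem reflect_pow_coord (m j p : ℕ) (hε : ε ^ 2 = -1) {e : ℂ} (he : mirrorUnit m ε j ^ p = e) :
    reflect (mirrorRoot m j) (coord ε ^ p) = C e⁻¹ * coord (-ε) ^ p := by
  rw [map_pow, reflect_coord m j hε, mul_pow, ← C_pow, inv_pow, he]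

theorem reflect_pow_coord_neg (m j p : ℕ) (hε : ε ^ 2 = -1) {e : ℂ}
    (he : mirrorUnit m ε j ^ p = e) :
    reflect (mirrorRoot m j) (coord (-ε) ^ p) = C e * coord ε ^ p := by
  rw [map_pow, reflect_coord_neg m j hε, mul_pow, ← C_pow, he]

theorem planarDeriv_pow_coord_neg (hε : ε ^ 2 = -1) (p : ℕ) :
    planarDeriv ε (coord (-ε) ^ p) = 2 * (p : MvPolynomial (Fin 3) ℂ) * coord (-ε) ^ (p - 1) := by
  rw [Derivation.leibniz_pow, planarDeriv_coord_neg hε, nsmul_eq_mul, smul_eq_mul]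
  ring

theorem planarDeriv_pow_coord (hε : ε ^ 2 = -1) (p : ℕ) : planarDeriv ε (coord ε ^ p) = 0 := by
  rw [Derivation.leibniz_pow, planarDeriv_coord hε, smul_zero, smul_zero]

theorem pow_coord_neg_add_ne_zero (hε : ε ^ 2 = -1) {p : ℕ} (hp : p ≠ 0) (c : ℂ) :
    coord (-ε) ^ p + C c * coord ε ^ p ≠ 0 := by
  intro h
  have h1 := congrArg (planarDeriv ε) h
  rw [map_add, Derivation.leibniz, planarDeriv_pow_coord hε, planarDeriv_pow_coord_neg hε,
    show planarDeriv ε (C c) = 0 from Derivation.map_algebraMap _ c, smul_zero, smul_zero,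
    add_zero, add_zero, map_zero] at h1
  have hp' : (p : MvPolynomial (Fin 3) ℂ) ≠ 0 := by exact_mod_cast hp
  exact mul_ne_zero (mul_ne_zero two_ne_zero hp') (pow_ne_zero _ (coord_ne_zero _)) h1

/-- If the mirrors with `η_j^p = e` all send `(x₁ + ε x₂)^ℓ h` to a multiple of
`(x₁ - ε x₂)^ℓ h'`, the sum of the corresponding difference quotients is given by partial
fractions. -/
theorem sum_mirrorQuot (m p : ℕ) (hε : ε ^ 2 = -1) {ξ η₀ e : ℂ} (hξ : IsPrimitiveRoot ξ p)
    (h0 : η₀ ≠ 0) (he : η₀ ^ p = e) (idx : ℕ → ℕ)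
    (hidx : ∀ i, mirrorUnit m ε (idx i) = η₀ * ξ ^ i) {l : ℕ} (hl : l < p)
    (h h' : MvPolynomial (Fin 3) ℂ) (hh : ∀ i, reflect (mirrorRoot m (idx i)) h = h') :
    (coord (-ε) ^ p - C e * coord ε ^ p)
        * ∑ i ∈ Finset.range p, mirrorQuot m ε (idx i) (coord ε ^ l * h)
      = 2 * (p : MvPolynomial (Fin 3) ℂ) * coord (-ε) ^ (p - 1) * coord ε ^ l * (h - h') := by
  refine sum_quotient_mul hξ h0 he hl _ _ _ _ _ fun i _ => ?_
  rw [← hidx i, mirrorQuot_spec m (idx i) hε, map_mul, reflect_pow_coord m (idx i) l hε rfl, hh,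
    inv_pow]

theorem pow_pow_eq_one_of_isPrimitiveRoot (m j : ℕ) {ξ : ℂ} (hξ : IsPrimitiveRoot ξ m) :
    (ξ ^ j) ^ m = 1 := by
  rw [← pow_mul, mul_comm, pow_mul, hξ.pow_eq_one, one_pow]

/-- Monogenicity of `φ_k^±` for a single orbit of mirrors. -/
theorem planarDunkl_oddForm (m : ℕ) (hm : m ≠ 0) (κ₀ κ : ℝ) (hε : ε ^ 2 = -1) (a l : ℕ)
    (hl : l < m) :
    planarDunkl m κ₀ κ κ ε (coord ε ^ l * oddForm κ a (coord ε ^ m) (coord (-ε) ^ m)) = 0 := by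
  obtain ⟨ξ, hξ, hη⟩ := exists_mirrorUnit_eq_pow m hm hε
  set B := coord ε with hB
  set A := coord (-ε) with hA
  set W := B ^ m with hW
  set V := A ^ m with hV
  have hrefl : ∀ i, reflect (mirrorRoot m (i + 1)) (oddForm κ a W V) = oddForm κ a V W := by
    intro i
    have hu : mirrorUnit m ε (i + 1) ^ m = 1 := by rw [hη, pow_pow_eq_one_of_isPrimitiveRoot m _ hξ]
    have h1 : reflect (mirrorRoot m (i + 1)) W = V := by
      rw [hW, hB, reflect_pow_coord m _ m hε hu, inv_one, C_1, one_mul]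
    have h2 : reflect (mirrorRoot m (i + 1)) V = W := by
      rw [hV, hA, reflect_pow_coord_neg m _ m hε hu, C_1, one_mul]
    rw [oddForm, map_sum, oddForm]
    refine Finset.sum_congr rfl fun j _ => ?_
    rw [map_mul, map_mul, map_pow _ V, map_pow _ W, h1, h2,
      show reflect (mirrorRoot m (i + 1)) (C _) = C _ from AlgHom.commutes _ _]
  have hS := sum_mirrorQuot m m hε hξ (η₀ := ξ) (e := 1) (hξ.ne_zero hm) hξ.pow_eq_one
    (fun i => i + 1) (fun i => by rw [hη, pow_succ']) hl _ _ hrefl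
  rw [C_1, one_mul] at hS
  have hD : V * planarDeriv ε (B ^ l * oddForm κ a W V)
      = 2 * (m : MvPolynomial (Fin 3) ℂ) * A ^ (m - 1) * B ^ l * ∑ j ∈ Finset.range (a + 1),
        (j : MvPolynomial (Fin 3) ℂ) * C (oddCoeff κ a j : ℂ) * V ^ j * W ^ (a - j) := by
    rw [Derivation.leibniz, hB, planarDeriv_pow_coord hε, smul_zero, add_zero, smul_eq_mul,
      oddForm, map_sum, Finset.mul_sum, Finset.mul_sum, Finset.mul_sum]
    refine Finset.sum_congr rfl fun j _ => ?_
    rw [mul_assoc (C _), Derivation.leibniz, Derivation.leibniz, Derivation.leibniz_pow _ _ (a - j),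
      hW, hB, planarDeriv_pow_coord hε, Derivation.leibniz_pow _ _ j, hV, hA,
      planarDeriv_pow_coord_neg hε,
      show planarDeriv ε (C (oddCoeff κ a j : ℂ)) = 0 from Derivation.map_algebraMap _ _]
    simp only [smul_zero, smul_eq_mul, nsmul_eq_mul, mul_zero, add_zero, zero_add]
    rcases j with _ | j
    · simp
    · rw [Nat.add_sub_cancel, pow_succ (coord (-ε) ^ m) j]
      ring
  have hR := sum_eq_zero_of_odd_recurrence a (fun j => C (oddCoeff κ a j : ℂ)) (C (κ : ℂ)) V W
    (fun j hj => by
      have := oddCoeff_recurrence κ hj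
      have h' := congrArg (fun r : ℝ => (C (r : ℂ) : MvPolynomial (Fin 3) ℂ)) this
      simpa using h')
    (by
      have h' := congrArg (fun r : ℝ => (C (r : ℂ) : MvPolynomial (Fin 3) ℂ)) (oddCoeff_self κ a)
      simpa using h')
  have hV0 : V ≠ 0 := pow_ne_zero _ (coord_ne_zero _)
  have hVW : V - W ≠ 0 := by
    have := pow_coord_neg_add_ne_zero hε hm (-1)
    rwa [C_neg, C_1, neg_one_mul, ← sub_eq_add_neg] at this
  apply mul_left_cancel₀ (mul_ne_zero hV0 hVW)
  rw [mul_zero, planarDunkl_apply]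
  simp only [ite_self]
  rw [← Finset.mul_sum]
  simp only [oddForm] at hS hD hR ⊢
  linear_combination (V - W) * hD + V * C (κ : ℂ) * hS
    + 2 * (m : MvPolynomial (Fin 3) ℂ) * A ^ (m - 1) * B ^ l * hR

theorem sum_range_two_mul {M : Type*} [AddCommMonoid M] (p : ℕ) (F : ℕ → M) :
    ∑ j ∈ Finset.range (2 * p), F j
      = ∑ i ∈ Finset.range p, F (2 * i) + ∑ i ∈ Finset.range p, F (2 * i + 1) := by
  induction p with
  | zero => simp
  | succ p ih =>
    rw [Nat.mul_succ, Finset.sum_range_succ, Finset.sum_range_succ, ih, Finset.sum_range_succ,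
      Finset.sum_range_succ]
    abel

/-- Monogenicity of `φ_k^±` for two orbits of mirrors. -/
theorem planarDunkl_evenForm (p : ℕ) (hp : p ≠ 0) (κ₀ : ℝ) {κ₁ κₘ : ℝ} (h₁ : 0 < κ₁) (hₘ : 0 < κₘ)
    (hε : ε ^ 2 = -1) (a l : ℕ) (hl : l < p) :
    planarDunkl (2 * p) κ₀ κ₁ κₘ ε (coord ε ^ l * evenForm κ₁ κₘ a
      (C (1 / 2) * (coord ε ^ p + coord (-ε) ^ p))
      (C (1 / 2) * (coord ε ^ p - coord (-ε) ^ p))) = 0 := by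
  have hm : 2 * p ≠ 0 := by omega
  obtain ⟨ξ, hξ, hη⟩ := exists_mirrorUnit_eq_pow (2 * p) hm hε
  have hξp : ξ ^ p = -1 := by
    have h1 : (ξ ^ p) ^ 2 = 1 ^ 2 := by
      rw [← pow_mul, mul_comm, hξ.pow_eq_one, one_pow]
    rcases sq_eq_sq_iff_eq_or_eq_neg.1 h1 with h | h
    · exact absurd (hξ.pow_eq_one_iff_dvd p |>.1 h) (fun hd => by
        have := Nat.le_of_dvd (by omega) hd; omega)
    · exact h
  have hξ2 : IsPrimitiveRoot (ξ ^ 2) p := hξ.pow (by omega) rfl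
  have hξ0 : ξ ≠ 0 := hξ.ne_zero hm
  set B := coord ε with hB
  set A := coord (-ε) with hA
  set x := C (1 / 2) * (B ^ p + A ^ p) with hx
  set q := C (1 / 2) * (B ^ p - A ^ p) with hq
  have hc : (2 : MvPolynomial (Fin 3) ℂ) * C (1 / 2) = 1 := by
    rw [← C_two, ← C_mul]; norm_num
  have hform : ∀ r (x' q' : MvPolynomial (Fin 3) ℂ), reflect r x = x' → reflect r q = q' →
      reflect r (evenForm κ₁ κₘ a x q) = evenForm κ₁ κₘ a x' q' := by
    intro r x' q' h1 h2
    rw [evenForm, map_sum, evenForm]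
    refine Finset.sum_congr rfl fun j _ => ?_
    rw [map_mul, map_mul, map_pow, map_pow, h1, h2,
      show reflect r (C _) = C _ from AlgHom.commutes _ _]
  have hpm : ∀ j (e : ℂ), mirrorUnit (2 * p) ε j ^ p = e →
      reflect (mirrorRoot (2 * p) j) x = C (1 / 2) * (C e⁻¹ * A ^ p + C e * B ^ p) ∧
      reflect (mirrorRoot (2 * p) j) q = C (1 / 2) * (C e⁻¹ * A ^ p - C e * B ^ p) := by
    intro j e he
    have h1 := reflect_pow_coord (2 * p) j p hε he
    have h2 := reflect_pow_coord_neg (2 * p) j p hε he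
    have h3 : reflect (mirrorRoot (2 * p) j) (C (1 / 2)) = C (1 / 2) := AlgHom.commutes _ _
    rw [hx, hq, map_mul, map_mul, map_add, map_sub, h1, h2, h3]
    exact ⟨rfl, rfl⟩
  have hodd : ∀ i, reflect (mirrorRoot (2 * p) (2 * i + 1)) (evenForm κ₁ κₘ a x q)
      = evenForm κ₁ κₘ a (-x) q := by
    intro i
    obtain ⟨e1, e2⟩ := hpm (2 * i + 1) (-1) (by
      rw [hη, ← pow_mul, mul_comm, pow_mul, hξp, pow_succ, pow_mul]; norm_num)
    refine hform _ _ _ (e1.trans ?_) (e2.trans ?_) <;>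
      simp only [inv_neg, inv_one, C_neg, C_1, hx, hq] <;> ring
  have heven : ∀ i, reflect (mirrorRoot (2 * p) (2 * i + 1 + 1)) (evenForm κ₁ κₘ a x q)
      = evenForm κ₁ κₘ a x (-q) := by
    intro i
    obtain ⟨e1, e2⟩ := hpm (2 * i + 1 + 1) 1 (by
      rw [hη, ← pow_mul, mul_comm, pow_mul, hξp, pow_succ, pow_succ, pow_mul]; norm_num)
    refine hform _ _ _ (e1.trans ?_) (e2.trans ?_) <;>
      simp only [inv_one, C_1, hx, hq] <;> ring
  have hS1 := sum_mirrorQuot (2 * p) p hε hξ2 (η₀ := ξ) (e := -1) hξ0 hξp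
    (fun i => 2 * i + 1) (fun i => by rw [hη, pow_succ', pow_mul]) hl _ _ hodd
  have hS2 := sum_mirrorQuot (2 * p) p hε hξ2 (η₀ := ξ ^ 2) (e := 1) (pow_ne_zero _ hξ0)
    hξ2.pow_eq_one
    (fun i => 2 * i + 1 + 1) (fun i => by rw [hη, ← pow_mul, ← pow_add]; ring_nf) hl _ _ heven
  rw [C_neg, C_1, neg_one_mul, sub_neg_eq_add] at hS1
  rw [C_1, one_mul] at hS2
  have hdc : ∀ c : ℂ, planarDeriv ε (C c) = 0 := fun c => Derivation.map_algebraMap _ _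
  have hdx : planarDeriv ε x = (p : MvPolynomial (Fin 3) ℂ) * A ^ (p - 1) := by
    rw [hx, Derivation.leibniz, map_add, hB, hA, planarDeriv_pow_coord hε,
      planarDeriv_pow_coord_neg hε, hdc]
    simp only [smul_eq_mul]
    linear_combination (p : MvPolynomial (Fin 3) ℂ) * coord (-ε) ^ (p - 1) * hc
  have hdq : planarDeriv ε q = -((p : MvPolynomial (Fin 3) ℂ) * A ^ (p - 1)) := by
    rw [hq, Derivation.leibniz, map_sub, hB, hA, planarDeriv_pow_coord hε,
      planarDeriv_pow_coord_neg hε, hdc]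
    simp only [smul_eq_mul]
    linear_combination -(p : MvPolynomial (Fin 3) ℂ) * coord (-ε) ^ (p - 1) * hc
  have hnat : ∀ (y : MvPolynomial (Fin 3) ℂ) (i : ℕ),
      y * ((i : MvPolynomial (Fin 3) ℂ) * y ^ (i - 1)) = i * y ^ i := by
    intro y i
    rcases i with _ | i
    · simp
    · rw [Nat.add_sub_cancel, pow_succ]; ring
  have hD : x * q * planarDeriv ε (B ^ l * evenForm κ₁ κₘ a x q)
      = (p : MvPolynomial (Fin 3) ℂ) * A ^ (p - 1) * B ^ l * ∑ j ∈ Finset.range (a + 1),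
        C (evenCoeff κ₁ κₘ a j : ℂ) * (((a - j : ℕ) : MvPolynomial (Fin 3) ℂ) * x ^ (a - j)
          * q ^ (j + 1) - (j : MvPolynomial (Fin 3) ℂ) * x ^ (a - j + 1) * q ^ j) := by
    rw [Derivation.leibniz, hB, planarDeriv_pow_coord hε, smul_zero, add_zero, smul_eq_mul,
      evenForm, map_sum, Finset.mul_sum, Finset.mul_sum, Finset.mul_sum]
    refine Finset.sum_congr rfl fun j _ => ?_
    rw [mul_assoc (C _), Derivation.leibniz, Derivation.leibniz, Derivation.leibniz_pow _ _ (a - j),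
      Derivation.leibniz_pow _ _ j, hdx, hdq, hdc]
    simp only [smul_eq_mul, nsmul_eq_mul]
    linear_combination coord ε ^ l * C (evenCoeff κ₁ κₘ a j : ℂ)
      * ((p : MvPolynomial (Fin 3) ℂ) * A ^ (p - 1)) * (q ^ (j + 1) * hnat x (a - j)
        - x ^ (a - j + 1) * hnat q j)
  have hR := sum_eq_zero_of_even_recurrence a (fun j => C (evenCoeff κ₁ κₘ a j : ℂ))
    (fun j => C (stepNum κ₁ j : ℂ)) (fun j => C (stepNum κₘ j : ℂ)) (by simp [stepNum_zero])
    (by simp [stepNum_zero]) (fun j hj => by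
      have h' := congrArg (fun r : ℝ => (C (r : ℂ) : MvPolynomial (Fin 3) ℂ))
        (evenCoeff_recurrence h₁ hₘ hj)
      simpa using h') x q
  -- the reflections act on `x^α q^j` by signs, which turns the exponents into `γ`-numbers
  have hsum : ∑ j ∈ Finset.range (a + 1),
        C (evenCoeff κ₁ κₘ a j : ℂ) * (((a - j : ℕ) : MvPolynomial (Fin 3) ℂ) * x ^ (a - j)
          * q ^ (j + 1) - (j : MvPolynomial (Fin 3) ℂ) * x ^ (a - j + 1) * q ^ j)
      + C (κ₁ : ℂ) * q * (evenForm κ₁ κₘ a x q - evenForm κ₁ κₘ a (-x) q)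
      - C (κₘ : ℂ) * x * (evenForm κ₁ κₘ a x q - evenForm κ₁ κₘ a x (-q)) = 0 := by
    rw [← hR]
    simp only [evenForm]
    rw [← Finset.sum_sub_distrib, ← Finset.sum_sub_distrib, Finset.mul_sum, Finset.mul_sum,
      ← Finset.sum_add_distrib, ← Finset.sum_sub_distrib]
    refine Finset.sum_congr rfl fun j _ => ?_
    simp only [stepNum, neg_pow x, neg_pow q]
    push_cast
    simp only [C_add, C_mul, C_sub, C_pow, C_neg, C_1, map_natCast]
    ring
  have hA2 : A ^ p + B ^ p = 2 * x := by rw [hx]; linear_combination -(A ^ p + B ^ p) * hc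
  have hA3 : A ^ p - B ^ p = -2 * q := by rw [hq]; linear_combination -(A ^ p - B ^ p) * hc
  have hx0 : x ≠ 0 := by
    intro h
    have := pow_coord_neg_add_ne_zero hε hp 1
    rw [C_1, one_mul, ← hB, ← hA, hA2, h, mul_zero] at this
    exact this rfl
  have hq0 : q ≠ 0 := by
    intro h
    have := pow_coord_neg_add_ne_zero hε hp (-1)
    rw [C_neg, C_1, neg_one_mul, ← sub_eq_add_neg, ← hB, ← hA, hA3, h, mul_zero] at this
    exact this rfl
  rw [hA2] at hS1
  rw [hA3] at hS2
  apply mul_left_cancel₀ (mul_ne_zero two_ne_zero (mul_ne_zero hx0 hq0))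
  rw [mul_zero, planarDunkl_apply, sum_range_two_mul]
  have hev : ∀ i, ¬ Even (2 * i + 1) := fun i => by simp
  have hev' : ∀ i, Even (2 * i + 1 + 1) := fun i => by simp [Nat.even_add_one]
  simp only [hev, hev', if_true, if_false]
  rw [← Finset.mul_sum, ← Finset.mul_sum]
  linear_combination 2 * hD + q * C (κ₁ : ℂ) * hS1 - x * C (κₘ : ℂ) * hS2
    + 2 * (p : MvPolynomial (Fin 3) ℂ) * A ^ (p - 1) * B ^ l * hsum

end

/-! ### The functions `φ_k^±` as polynomials -/

/-- The coefficients of the Jacobi form are, up to a common factor, reciprocals of products of two Dunkl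
factorials; compare `stepFactorial_two_mul`. -/
theorem jacobiForm_eq_sum (t : ℕ) {a b : ℝ} (ha : 0 < a + 1) (hb : 0 < b + 1) (u v : ℝ) :
    jacobiForm t a b u v = ∑ s ∈ Finset.range (t + 1), poch (a + 1) t * poch (b + 1) t
      / (poch (a + 1) s * s.factorial * (poch (b + 1) (t - s) * (t - s).factorial))
      * (-u) ^ s * v ^ (t - s) := by
  rw [jacobiForm]
  refine Finset.sum_congr rfl fun s hs => ?_
  have hs' : s ≤ t := Nat.lt_succ_iff.1 (Finset.mem_range.1 hs)
  have h1 := poch_mul_sub (a + 1) hs'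
  have h2 := poch_mul_sub (b + 1) (Nat.sub_le t s)
  rw [Nat.sub_sub_self hs'] at h2
  have := (poch_pos ha s).ne'
  have := (poch_pos hb (t - s)).ne'
  rw [← h1, ← h2, Nat.cast_choose ℝ hs']
  field_simp

theorem gegenbauer_two_mul (t : ℕ) {lam mu : ℝ} (hl : 0 < lam + 1 / 2) {c s : ℝ}
    (hcs : s ^ 2 + c ^ 2 = 1) (r : ℝ) :
    r ^ (2 * t) * gegenbauer (2 * t) lam mu c = poch (lam + mu) t / poch (mu + 1 / 2) t
      * jacobiForm t (lam - 1 / 2) (mu - 1 / 2) ((r * s) ^ 2) ((r * c) ^ 2) := by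
  have h1 : 2 * t / 2 = t := by omega
  rw [gegenbauer]
  simp only [h1, even_two_mul, if_true]
  rw [← pow_mul_jacobi t (lam - 1 / 2) (mu - 1 / 2) (r ^ 2) _ _ (2 * c ^ 2 - 1) (by linarith)
    (by linear_combination (-2 * r ^ 2) * hcs) (by ring), pow_mul]
  ring

theorem gegenbauer_two_mul_add_one (t : ℕ) {lam mu : ℝ} (hl : 0 < lam + 1 / 2) {c s : ℝ}
    (hcs : s ^ 2 + c ^ 2 = 1) (r : ℝ) :
    r ^ (2 * t + 1) * gegenbauer (2 * t + 1) lam mu c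
      = poch (lam + mu) (t + 1) / poch (mu + 1 / 2) (t + 1)
      * (r * c * jacobiForm t (lam - 1 / 2) (mu + 1 / 2) ((r * s) ^ 2) ((r * c) ^ 2)) := by
  have h1 : (2 * t + 1) / 2 = t := by omega
  have h2 : ¬ Even (2 * t + 1) := by simp
  rw [gegenbauer]
  simp only [h1, h2, if_false]
  rw [← pow_mul_jacobi t (lam - 1 / 2) (mu + 1 / 2) (r ^ 2) _ _ (2 * c ^ 2 - 1) (by linarith)
    (by linear_combination (-2 * r ^ 2) * hcs) (by ring), pow_succ, pow_mul]
  ring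

/-- The Dunkl factorials in terms of Pochhammer symbols, which match the expansion of `jacobiForm`. -/
theorem stepFactorial_two_mul (κ : ℝ) (s : ℕ) :
    stepFactorial κ (2 * s) = 4 ^ s * s.factorial * poch (κ + 1 / 2) s ∧
    stepFactorial κ (2 * s + 1) = 2 * 4 ^ s * s.factorial * poch (κ + 1 / 2) (s + 1) := by
  have hodd : ∀ s, stepNum κ (2 * s + 1) = 2 * (κ + 1 / 2 + s) := fun s => by
    rw [stepNum, pow_succ, pow_mul]; norm_num; ring
  have hev : ∀ s, stepNum κ (2 * s + 1 + 1) = 2 * (s + 1) := fun s => by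
    rw [stepNum, pow_succ, pow_succ, pow_mul]; norm_num; ring
  have h : ∀ s, stepFactorial κ (2 * s) = 4 ^ s * s.factorial * poch (κ + 1 / 2) s := by
    intro s
    induction s with
    | zero => simp [stepFactorial, poch_zero]
    | succ s ih =>
      rw [Nat.mul_succ, stepFactorial_succ, stepFactorial_succ, ih, hodd, hev, poch_succ,
        Nat.factorial_succ]
      push_cast
      ring
  refine ⟨h s, ?_⟩
  rw [stepFactorial_succ, h, hodd, poch_succ]
  ring

/-- The factor by which `f_a` differs from the product expansion `evenForm`. -/
noncomputable def evenNorm (κ₁ κₘ : ℝ) (a : ℕ) : ℝ :=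
  poch (κₘ + κ₁ + 1) (a / 2) * poch (κₘ + 1 / 2) ((a + 1) / 2) * 2 ^ a

theorem evenNorm_pos {κ₁ κₘ : ℝ} (h₁ : 0 < κ₁) (hₘ : 0 < κₘ) (a : ℕ) : 0 < evenNorm κ₁ κₘ a := by
  have := poch_pos (show 0 < κₘ + κ₁ + 1 by positivity) (a / 2)
  have := poch_pos (show 0 < κₘ + 1 / 2 by positivity) ((a + 1) / 2)
  rw [evenNorm]; positivity

theorem evenCoeff_pos {κ₁ κₘ : ℝ} (h₁ : 0 < κ₁) (hₘ : 0 < κₘ) (a j : ℕ) :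
    0 < evenCoeff κ₁ κₘ a j := by
  have := stepFactorial_pos h₁ (a - j)
  have := stepFactorial_pos hₘ j
  rw [evenCoeff]; positivity

section

variable {κ₁ κₘ : ℝ} (h₁ : 0 < κ₁) (hₘ : 0 < κₘ) {c s : ℝ} (hcs : s ^ 2 + c ^ 2 = 1) (r : ℝ) (t : ℕ)

include h₁ hₘ hcs

/-- This and the following three lemmas compute the real and the imaginary part of `f_a(r e^{iθ})`, with
`c = cos θ` and `s = sin θ`, for `a = 2t` and `a = 2t + 1`. -/
theorem re_fEven_two_mul :
    r ^ (2 * t) * (((2 * t : ℕ) + 2 * κₘ + 2 * κ₁) / (2 * (κₘ + κ₁))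
        * gegenbauer (2 * t) κₘ κ₁ c)
      = evenNorm κ₁ κₘ (2 * t) * ∑ i ∈ Finset.range (t + 1), evenCoeff κ₁ κₘ (2 * t) (2 * i)
        * (r * c) ^ (2 * t - 2 * i) * ((-1) ^ i * (r * s) ^ (2 * i)) := by
  rw [mul_left_comm, gegenbauer_two_mul t (by linarith) hcs, jacobiForm_eq_sum t (by linarith)
    (by linarith), Finset.mul_sum, Finset.mul_sum, Finset.mul_sum]
  refine Finset.sum_congr rfl fun i hi => ?_
  have hi' : i ≤ t := Nat.lt_succ_iff.1 (Finset.mem_range.1 hi)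
  have e1 : 2 * t - 2 * i = 2 * (t - i) := by omega
  have e2 : (2 * t + 1) / 2 = t := by omega
  have e3 : 2 * t / 2 = t := by omega
  have e4 : κₘ - 1 / 2 + 1 = κₘ + 1 / 2 := by ring
  have e5 : κ₁ - 1 / 2 + 1 = κ₁ + 1 / 2 := by ring
  have e6 : (4 : ℝ) ^ t = 4 ^ i * 4 ^ (t - i) := by rw [← pow_add, Nat.add_sub_cancel' hi']
  have e7 : (2 : ℝ) ^ (2 * t) = 4 ^ t := by rw [pow_mul]; norm_num
  have hS := poch_succ_left (κₘ + κ₁) t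
  rw [poch_succ] at hS
  have := (poch_pos (show 0 < κₘ + 1 / 2 by linarith) i).ne'
  have := (poch_pos (show 0 < κ₁ + 1 / 2 by linarith) (t - i)).ne'
  have := (poch_pos (show 0 < κ₁ + 1 / 2 by linarith) t).ne'
  have : κₘ + κ₁ ≠ 0 := by linarith
  rw [evenCoeff, e1, (stepFactorial_two_mul _ _).1, (stepFactorial_two_mul _ _).1, evenNorm, e2, e3,
    e4, e5, e7, e6, pow_mul (r * c), pow_mul (r * s), neg_pow ((r * s) ^ 2)]
  push_cast
  generalize poch (κₘ + 1 / 2) i = p1 at *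
  generalize poch (κ₁ + 1 / 2) (t - i) = p2 at *
  generalize poch (κ₁ + 1 / 2) t = p3 at *
  generalize poch (κₘ + 1 / 2) t = p4 at *
  generalize poch (κₘ + κ₁) t = p5 at *
  generalize ((r * c) ^ 2) ^ (t - i) = y1
  generalize ((r * s) ^ 2) ^ i = y2
  field_simp
  linear_combination p4 * y1 * y2 * hS

theorem im_fEven_two_mul :
    r ^ (2 * t) * (s * (if 2 * t = 0 then 0 else gegenbauer (2 * t - 1) (κₘ + 1) κ₁ c))
      = evenNorm κ₁ κₘ (2 * t) * ∑ i ∈ Finset.range t, evenCoeff κ₁ κₘ (2 * t) (2 * i + 1)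
        * (r * c) ^ (2 * t - (2 * i + 1)) * ((-1) ^ i * (r * s) ^ (2 * i + 1)) := by
  rcases t with _ | t
  · simp
  rw [if_neg (by omega), show 2 * (t + 1) - 1 = 2 * t + 1 by omega,
    show r ^ (2 * (t + 1)) * (s * gegenbauer (2 * t + 1) (κₘ + 1) κ₁ c)
      = r * s * (r ^ (2 * t + 1) * gegenbauer (2 * t + 1) (κₘ + 1) κ₁ c) by ring,
    gegenbauer_two_mul_add_one t (by linarith) hcs, jacobiForm_eq_sum t (by linarith)
    (by linarith), Finset.mul_sum, Finset.mul_sum, Finset.mul_sum, Finset.mul_sum]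
  refine Finset.sum_congr rfl fun i hi => ?_
  have hi' : i ≤ t := Nat.lt_succ_iff.1 (Finset.mem_range.1 hi)
  have e1 : 2 * (t + 1) - (2 * i + 1) = 2 * (t - i) + 1 := by omega
  have e2 : (2 * (t + 1) + 1) / 2 = t + 1 := by omega
  have e3 : 2 * (t + 1) / 2 = t + 1 := by omega
  have e4 : κₘ + 1 - 1 / 2 + 1 = κₘ + 1 / 2 + 1 := by ring
  have e5 : κₘ + 1 + κ₁ = κₘ + κ₁ + 1 := by ring
  have e6 : (4 : ℝ) ^ t = 4 ^ i * 4 ^ (t - i) := by rw [← pow_add, Nat.add_sub_cancel' hi']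
  have e7 : (2 : ℝ) ^ (2 * (t + 1)) = 4 * 4 ^ t := by rw [pow_mul, pow_succ]; norm_num; ring
  have := (poch_pos (show 0 < κₘ + 1 / 2 + 1 by linarith) i).ne'
  have := (poch_pos (show 0 < κ₁ + 1 / 2 + 1 by linarith) (t - i)).ne'
  have := (poch_pos (show 0 < κ₁ + 1 / 2 + 1 by linarith) t).ne'
  have : κₘ + 1 / 2 ≠ 0 := by linarith
  have : κ₁ + 1 / 2 ≠ 0 := by linarith
  rw [evenCoeff, e1, (stepFactorial_two_mul _ _).2, (stepFactorial_two_mul _ _).2, evenNorm, e2, e3,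
    e4, e5, e7, e6, pow_succ (r * c) (2 * (t - i)), pow_mul (r * c), pow_succ (r * s) (2 * i),
    pow_mul (r * s), neg_pow ((r * s) ^ 2),
    poch_succ_left (κₘ + 1 / 2), poch_succ_left (κ₁ + 1 / 2), poch_succ_left (κₘ + 1 / 2),
    poch_succ_left (κ₁ + 1 / 2)]
  generalize poch (κₘ + 1 / 2 + 1) i = p1 at *
  generalize poch (κ₁ + 1 / 2 + 1) (t - i) = p2 at *
  generalize poch (κ₁ + 1 / 2 + 1) t = p3 at *
  generalize poch (κₘ + 1 / 2 + 1) t = p4 at *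
  generalize ((r * c) ^ 2) ^ (t - i) = y1
  generalize ((r * s) ^ 2) ^ i = y2
  generalize κₘ + 1 / 2 = q1 at *
  generalize κ₁ + 1 / 2 = q2 at *
  field_simp
  norm_num

theorem re_fEven_two_mul_add_one :
    r ^ (2 * t + 1) * (((2 * t + 1 : ℕ) + 2 * κₘ) / (2 * (κₘ + κ₁))
        * gegenbauer (2 * t + 1) κₘ κ₁ c)
      = evenNorm κ₁ κₘ (2 * t + 1) * ∑ i ∈ Finset.range (t + 1),
        evenCoeff κ₁ κₘ (2 * t + 1) (2 * i)
        * (r * c) ^ (2 * t + 1 - 2 * i) * ((-1) ^ i * (r * s) ^ (2 * i)) := by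
  rw [mul_left_comm, gegenbauer_two_mul_add_one t (by linarith) hcs, jacobiForm_eq_sum t
    (by linarith) (by linarith), Finset.mul_sum, Finset.mul_sum, Finset.mul_sum, Finset.mul_sum]
  refine Finset.sum_congr rfl fun i hi => ?_
  have hi' : i ≤ t := Nat.lt_succ_iff.1 (Finset.mem_range.1 hi)
  have e1 : 2 * t + 1 - 2 * i = 2 * (t - i) + 1 := by omega
  have e2 : (2 * t + 1 + 1) / 2 = t + 1 := by omega
  have e3 : (2 * t + 1) / 2 = t := by omega
  have e4 : κₘ - 1 / 2 + 1 = κₘ + 1 / 2 := by ring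
  have e6 : (4 : ℝ) ^ t = 4 ^ i * 4 ^ (t - i) := by rw [← pow_add, Nat.add_sub_cancel' hi']
  have e7 : (2 : ℝ) ^ (2 * t + 1) = 2 * 4 ^ t := by rw [pow_succ, pow_mul]; norm_num; ring
  have := (poch_pos (show 0 < κₘ + 1 / 2 by linarith) i).ne'
  have := (poch_pos (show 0 < κ₁ + 1 / 2 + 1 by linarith) (t - i)).ne'
  have := (poch_pos (show 0 < κ₁ + 1 / 2 + 1 by linarith) t).ne'
  have : κₘ + κ₁ ≠ 0 := by linarith
  have : κ₁ + 1 / 2 ≠ 0 := by linarith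
  rw [evenCoeff, e1, (stepFactorial_two_mul _ _).2, (stepFactorial_two_mul _ _).1, evenNorm, e2, e3,
    e4, e7, e6, pow_succ (r * c) (2 * (t - i)), pow_mul (r * c), pow_mul (r * s),
    neg_pow ((r * s) ^ 2),
    poch_succ_left (κₘ + κ₁), poch_succ (κₘ + 1 / 2) t, poch_succ_left (κ₁ + 1 / 2),
    poch_succ_left (κ₁ + 1 / 2)]
  push_cast
  generalize poch (κₘ + 1 / 2) i = p1 at *
  generalize poch (κ₁ + 1 / 2 + 1) (t - i) = p2 at *
  generalize poch (κ₁ + 1 / 2 + 1) t = p3 at *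
  generalize poch (κₘ + 1 / 2) t = p4 at *
  generalize ((r * c) ^ 2) ^ (t - i) = y1
  generalize ((r * s) ^ 2) ^ i = y2
  generalize κ₁ + 1 / 2 = q2 at *
  field_simp
  ring

theorem im_fEven_two_mul_add_one :
    r ^ (2 * t + 1) * (s * gegenbauer (2 * t) (κₘ + 1) κ₁ c)
      = evenNorm κ₁ κₘ (2 * t + 1) * ∑ i ∈ Finset.range (t + 1),
        evenCoeff κ₁ κₘ (2 * t + 1) (2 * i + 1)
        * (r * c) ^ (2 * t + 1 - (2 * i + 1)) * ((-1) ^ i * (r * s) ^ (2 * i + 1)) := by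
  rw [show r ^ (2 * t + 1) * (s * gegenbauer (2 * t) (κₘ + 1) κ₁ c)
      = r * s * (r ^ (2 * t) * gegenbauer (2 * t) (κₘ + 1) κ₁ c) by ring,
    gegenbauer_two_mul t (by linarith) hcs, jacobiForm_eq_sum t
    (by linarith) (by linarith), Finset.mul_sum, Finset.mul_sum, Finset.mul_sum]
  refine Finset.sum_congr rfl fun i hi => ?_
  have hi' : i ≤ t := Nat.lt_succ_iff.1 (Finset.mem_range.1 hi)
  have e1 : 2 * t + 1 - (2 * i + 1) = 2 * (t - i) := by omega
  have e2 : (2 * t + 1 + 1) / 2 = t + 1 := by omega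
  have e3 : (2 * t + 1) / 2 = t := by omega
  have e4 : κₘ + 1 - 1 / 2 + 1 = κₘ + 1 / 2 + 1 := by ring
  have e5 : κ₁ - 1 / 2 + 1 = κ₁ + 1 / 2 := by ring
  have e8 : κₘ + 1 + κ₁ = κₘ + κ₁ + 1 := by ring
  have e6 : (4 : ℝ) ^ t = 4 ^ i * 4 ^ (t - i) := by rw [← pow_add, Nat.add_sub_cancel' hi']
  have e7 : (2 : ℝ) ^ (2 * t + 1) = 2 * 4 ^ t := by rw [pow_succ, pow_mul]; norm_num; ring
  have := (poch_pos (show 0 < κₘ + 1 / 2 + 1 by linarith) i).ne'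
  have := (poch_pos (show 0 < κ₁ + 1 / 2 by linarith) (t - i)).ne'
  have := (poch_pos (show 0 < κ₁ + 1 / 2 by linarith) t).ne'
  have : κₘ + 1 / 2 ≠ 0 := by linarith
  rw [evenCoeff, e1, (stepFactorial_two_mul _ _).1, (stepFactorial_two_mul _ _).2, evenNorm, e2, e3,
    e4, e5, e8, e7, e6, pow_mul (r * c), pow_succ (r * s) (2 * i), pow_mul (r * s),
    neg_pow ((r * s) ^ 2), poch_succ_left (κₘ + 1 / 2), poch_succ_left (κₘ + 1 / 2)]
  generalize poch (κₘ + 1 / 2 + 1) i = p1 at *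
  generalize poch (κ₁ + 1 / 2) (t - i) = p2 at *
  generalize poch (κ₁ + 1 / 2) t = p3 at *
  generalize poch (κₘ + 1 / 2 + 1) t = p4 at *
  generalize ((r * c) ^ 2) ^ (t - i) = y1
  generalize ((r * s) ^ 2) ^ i = y2
  generalize κₘ + 1 / 2 = q1 at *
  field_simp

end

/-- `f_a` in powers of `Re w` and `i Im w`; in particular it is a polynomial in `w` and `w̄`. Even powers
of `i Im w` give the real part and odd ones the imaginary part. -/
theorem fEven_eq_sum {κ₁ κₘ : ℝ} (h₁ : 0 < κ₁) (hₘ : 0 < κₘ) (a : ℕ) (w : ℂ) :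
    fEven κ₁ κₘ a w = (evenNorm κ₁ κₘ a : ℂ) * ∑ j ∈ Finset.range (a + 1),
      (evenCoeff κ₁ κₘ a j : ℂ) * (w.re : ℂ) ^ (a - j) * (Complex.I * (w.im : ℂ)) ^ j := by
  have hx : w.re = ‖w‖ * Real.cos w.arg := (Complex.norm_mul_cos_arg w).symm
  have hy : w.im = ‖w‖ * Real.sin w.arg := (Complex.norm_mul_sin_arg w).symm
  have hcs := Real.sin_sq_add_cos_sq w.arg
  have hIe : ∀ (y : ℝ) (i : ℕ), (Complex.I * (y : ℂ)) ^ (2 * i) = (((-1) ^ i * y ^ (2 * i) : ℝ) : ℂ) := by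
    intro y i
    rw [mul_pow, pow_mul, Complex.I_sq]; push_cast; ring
  have hIo : ∀ (y : ℝ) (i : ℕ), (Complex.I * (y : ℂ)) ^ (2 * i + 1)
      = Complex.I * (((-1) ^ i * y ^ (2 * i + 1) : ℝ) : ℂ) := by
    intro y i
    rw [pow_succ, hIe]; push_cast; ring
  simp only [fEven]
  rw [show (w.re : ℂ) = ((‖w‖ * Real.cos w.arg : ℝ) : ℂ) by rw [← hx],
    show (w.im : ℂ) = ((‖w‖ * Real.sin w.arg : ℝ) : ℂ) by rw [← hy]]
  clear hx hy
  generalize ‖w‖ = r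
  generalize Real.sin w.arg = s at *
  generalize Real.cos w.arg = c at *
  obtain ⟨t, rfl | rfl⟩ := Nat.even_or_odd' a
  · have hR := re_fEven_two_mul h₁ hₘ hcs r t
    have hI := im_fEven_two_mul h₁ hₘ hcs r t
    have hsplit := sum_range_two_mul t fun j => (evenCoeff κ₁ κₘ (2 * t) j : ℂ)
      * ((r * c : ℝ) : ℂ) ^ (2 * t - j) * (Complex.I * ((r * s : ℝ) : ℂ)) ^ j
    have hre := Finset.sum_range_succ (fun i => (evenCoeff κ₁ κₘ (2 * t) (2 * i) : ℂ)
      * ((r * c : ℝ) : ℂ) ^ (2 * t - 2 * i) * (Complex.I * ((r * s : ℝ) : ℂ)) ^ (2 * i)) t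
    have h2 : (1 + (-1 : ℝ) ^ (2 * t)) = 2 := by rw [pow_mul]; norm_num
    have hk : ((2 * t : ℕ) : ℝ) + 2 * κₘ + 2 * κ₁ = (2 * t : ℕ) + 2 * κₘ
      + (1 + (-1 : ℝ) ^ (2 * t)) * κ₁ := by rw [h2]
    rw [hk] at hR
    rw [Finset.sum_range_succ, hsplit, add_right_comm (Finset.sum _ _), ← hre]
    simp only [hIe, hIo]
    generalize (if 2 * t = 0 then 0 else gegenbauer (2 * t - 1) (κₘ + 1) κ₁ c) = G at *
    generalize ((2 * t : ℕ) + 2 * κₘ + (1 + (-1 : ℝ) ^ (2 * t)) * κ₁) / (2 * (κₘ + κ₁))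
      * gegenbauer (2 * t) κₘ κ₁ c = H at *
    rw [mul_add, mul_left_comm _ Complex.I, ← Complex.ofReal_pow, ← Complex.ofReal_mul,
      ← Complex.ofReal_mul, hR, hI, mul_add]
    simp only [Complex.ofReal_mul, Complex.ofReal_sum, Finset.mul_sum, Complex.ofReal_pow]
    congr 1
    exact Finset.sum_congr rfl fun i _ => by ring
  · have hR := re_fEven_two_mul_add_one h₁ hₘ hcs r t
    have hI := im_fEven_two_mul_add_one h₁ hₘ hcs r t
    have hsplit := sum_range_two_mul (t + 1) fun j => (evenCoeff κ₁ κₘ (2 * t + 1) j : ℂ)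
      * ((r * c : ℝ) : ℂ) ^ (2 * t + 1 - j) * (Complex.I * ((r * s : ℝ) : ℂ)) ^ j
    have h2 : (1 + (-1 : ℝ) ^ (2 * t + 1)) * κ₁ = 0 := by rw [pow_succ, pow_mul]; norm_num
    rw [show 2 * t + 1 + 1 = 2 * (t + 1) by ring, hsplit, h2, add_zero, if_neg (by omega),
      Nat.add_sub_cancel]
    simp only [hIe, hIo]
    generalize ((2 * t + 1 : ℕ) + 2 * κₘ) / (2 * (κₘ + κ₁))
      * gegenbauer (2 * t + 1) κₘ κ₁ c = H at *
    rw [mul_add, mul_left_comm _ Complex.I, ← Complex.ofReal_pow, ← Complex.ofReal_mul,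
      ← Complex.ofReal_mul, hR, hI, mul_add]
    simp only [Complex.ofReal_mul, Complex.ofReal_sum, Finset.mul_sum, Complex.ofReal_pow]
    congr 1
    exact Finset.sum_congr rfl fun i _ => by ring

/-- The polynomial whose values are `φ_n^+` for `ε = i` and `φ_n^-` for `ε = -i`. -/
noncomputable def phiPoly (m : ℕ) (κ₁ κₘ : ℝ) (n : ℕ) (ε : ℂ) : MvPolynomial (Fin 3) ℂ :=
  if Odd m then coord ε ^ (n % m) * oddForm κ₁ (n / m) (coord ε ^ m) (coord (-ε) ^ m)
  else C (evenNorm κ₁ κₘ (n / (m / 2)) : ℂ) * (coord ε ^ (n % (m / 2))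
    * evenForm κ₁ κₘ (n / (m / 2))
      (C (1 / 2) * (coord ε ^ (m / 2) + coord (-ε) ^ (m / 2)))
      (C (1 / 2) * (coord ε ^ (m / 2) - coord (-ε) ^ (m / 2))))

section

variable {m : ℕ} (hm : 2 ≤ m) {κ₁ κₘ : ℝ} (h₁ : 0 < κ₁) (hₘ : 0 < κₘ)

include h₁ hₘ

theorem eval_phiPoly (n : ℕ) (ε : ℂ) (v : Fin 3 → ℂ) (ζ : ℂ) (h : eval v (coord ε) = ζ)
    (h' : eval v (coord (-ε)) = starRingEnd ℂ ζ) :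
    eval v (phiPoly m κ₁ κₘ n ε) = phiPlus m κ₁ κₘ n ζ := by
  rw [phiPoly, phiPlus]
  split_ifs with ho
  · simp only [map_mul, map_pow, h, oddForm, h', map_sum, eval_C, fOdd, oddCoeff]
  · have hre : ∀ w : ℂ, (1 / 2) * (w + starRingEnd ℂ w) = w.re := fun w => by
      rw [Complex.add_conj]; push_cast; ring
    have him : ∀ w : ℂ, (1 / 2) * (w - starRingEnd ℂ w) = Complex.I * w.im := fun w => by
      rw [Complex.sub_conj]; push_cast; ring
    simp only [map_mul, map_pow, h, evenForm, h', map_sum, eval_C, map_add, map_sub,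
      fEven_eq_sum h₁ hₘ]
    rw [← map_pow, hre, him]
    ring

theorem phiPlus_one_ne_zero (n : ℕ) : phiPlus m κ₁ κₘ n 1 ≠ 0 := by
  rw [phiPlus]
  split_ifs with ho
  · have h : fOdd κ₁ (n / m) 1
        = ((∑ j ∈ Finset.range (n / m + 1), oddCoeff κ₁ (n / m) j : ℝ) : ℂ) := by
      simp [fOdd, oddCoeff]
    rw [one_pow, one_pow, one_mul, h, Complex.ofReal_ne_zero]
    refine (Finset.sum_pos (fun j _ => ?_) (by simp)).ne'
    have := poch_pos h₁ j
    have := poch_pos (show 0 < κ₁ + 1 by linarith) (n / m - j)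
    rw [oddCoeff]
    positivity
  · rw [one_pow, one_pow, one_mul, fEven_eq_sum h₁ hₘ, Finset.sum_range_succ']
    simp only [Complex.one_im, Complex.ofReal_zero, mul_zero, pow_succ, Finset.sum_const_zero,
      zero_add, Complex.one_re, Complex.ofReal_one, one_pow, mul_one, pow_zero]
    rw [← Complex.ofReal_mul, Complex.ofReal_ne_zero]
    exact (mul_pos (evenNorm_pos h₁ hₘ _) (evenCoeff_pos h₁ hₘ _ _)).ne'

theorem phiPoly_ne_zero (n : ℕ) (ε : ℂ) : phiPoly m κ₁ κₘ n ε ≠ 0 := by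
  intro h
  have h1 := eval_phiPoly (m := m) h₁ hₘ n ε ![1, 0, 0] 1 (by simp [coord]) (by simp [coord])
  rw [h, map_zero] at h1
  exact phiPlus_one_ne_zero h₁ hₘ n h1.symm

include hm

theorem planarDunkl_phiPoly (hodd : Odd m → κ₁ = κₘ) (κ₀ : ℝ) (n : ℕ) {ε : ℂ} (hε : ε ^ 2 = -1) :
    planarDunkl m κ₀ κ₁ κₘ ε (phiPoly m κ₁ κₘ n ε) = 0 := by
  rw [phiPoly]
  split_ifs with ho
  · rw [← hodd ho]
    exact planarDunkl_oddForm m (by omega) κ₀ κ₁ hε _ _ (Nat.mod_lt _ (by omega))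
  · obtain ⟨p, rfl⟩ := (Nat.not_odd_iff_even.1 ho).two_dvd
    rw [Nat.mul_div_cancel_left p two_pos, ← smul_eq_C_mul, map_smul,
      planarDunkl_evenForm p (by omega) κ₀ h₁ hₘ hε _ _ (Nat.mod_lt _ (by omega)), smul_zero]

end

theorem phiMinus_eq (m : ℕ) (κ₁ κₘ : ℝ) (n : ℕ) (z : ℂ) :
    phiMinus m κ₁ κₘ n z = phiPlus m κ₁ κₘ n (starRingEnd ℂ z) := by
  rw [phiMinus, phiPlus, phiPlus]
  split_ifs with ho
  · simp only [fOdd, map_mul, map_pow, map_sum, Complex.conj_ofReal]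
  · rfl

theorem isHomogeneous_coord (ε : ℂ) : (coord ε).IsHomogeneous 1 :=
  (isHomogeneous_X _ _).add ((isHomogeneous_X _ _).C_mul ε)

theorem isHomogeneous_phiPoly (m : ℕ) (κ₁ κₘ : ℝ) (n : ℕ) (ε : ℂ) :
    (phiPoly m κ₁ κₘ n ε).IsHomogeneous n := by
  have hc : ∀ (e : ℂ) (p : ℕ), (coord e ^ p).IsHomogeneous p := fun e p => by
    simpa using (isHomogeneous_coord e).pow p
  have hdiv : ∀ p j, j ∈ Finset.range (n / p + 1) → n % p + (p * (n / p - j) + p * j) = n := by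
    intro p j hj
    have hj' : j ≤ n / p := Nat.lt_succ_iff.1 (Finset.mem_range.1 hj)
    rw [← mul_add, Nat.sub_add_cancel hj', Nat.mod_add_div]
  rw [phiPoly]
  split_ifs with ho
  · rw [oddForm, Finset.mul_sum]
    refine IsHomogeneous.sum _ _ _ fun j hj => ?_
    have h := (hc ε (n % m)).mul (((hc ε m).pow (n / m - j)).mul ((hc (-ε) m).pow j) |>.C_mul
      (oddCoeff κ₁ (n / m) j : ℂ))
    rw [hdiv m j hj] at h
    convert h using 1
    ring
  · refine IsHomogeneous.C_mul ?_ _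
    rw [evenForm, Finset.mul_sum]
    refine IsHomogeneous.sum _ _ _ fun j hj => ?_
    have h := (hc ε (n % (m / 2))).mul (((((hc ε (m / 2)).add (hc (-ε) (m / 2))).C_mul (1 / 2)).pow
      (n / (m / 2) - j)).mul ((((hc ε (m / 2)).sub (hc (-ε) (m / 2))).C_mul (1 / 2)).pow j) |>.C_mul
      (evenCoeff κ₁ κₘ (n / (m / 2)) j : ℂ))
    rw [hdiv (m / 2) j hj] at h
    convert h using 1
    ring

/-- The polynomials in `x₁, x₂` only. -/
noncomputable def planarPoly : Subalgebra ℂ (MvPolynomial (Fin 3) ℂ) := supported ℂ {0, 1}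

theorem C_mem_planarPoly (c : ℂ) : C c ∈ planarPoly := planarPoly.algebraMap_mem c

theorem coord_mem_planarPoly (ε : ℂ) : coord ε ∈ planarPoly :=
  add_mem (X_mem_supported.2 (by simp)) (mul_mem (C_mem_planarPoly ε) (X_mem_supported.2 (by simp)))

theorem phiPoly_mem_planarPoly (m : ℕ) (κ₁ κₘ : ℝ) (n : ℕ) (ε : ℂ) :
    phiPoly m κ₁ κₘ n ε ∈ planarPoly := by
  have hc := coord_mem_planarPoly
  have hC := C_mem_planarPoly
  rw [phiPoly]
  split_ifs
  · exact mul_mem (pow_mem (hc _) _) (sum_mem fun j _ =>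
      mul_mem (mul_mem (hC _) (pow_mem (pow_mem (hc _) _) _)) (pow_mem (pow_mem (hc _) _) _))
  · exact mul_mem (hC _) (mul_mem (pow_mem (hc _) _) (sum_mem fun j _ => mul_mem
      (mul_mem (hC _) (pow_mem (mul_mem (hC _) (add_mem (pow_mem (hc _) _) (pow_mem (hc _) _))) _))
      (pow_mem (mul_mem (hC _) (sub_mem (pow_mem (hc _) _) (pow_mem (hc _) _))) _)))

/-- An algebra endomorphism fixing `x₁` and `x₂` fixes all planar polynomials. -/
theorem algHom_planarPoly {F : MvPolynomial (Fin 3) ℂ →ₐ[ℂ] MvPolynomial (Fin 3) ℂ}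
    (h0 : F (X 0) = X 0) (h1 : F (X 1) = X 1) {f : MvPolynomial (Fin 3) ℂ} (hf : f ∈ planarPoly) :
    F f = f := by
  have h : planarPoly ≤ AlgHom.equalizer F (AlgHom.id ℂ _) := by
    rw [planarPoly, supported_eq_adjoin_X, Algebra.adjoin_le_iff]
    rintro _ ⟨i, hi, rfl⟩
    rcases hi with rfl | rfl
    · exact h0
    · exact h1
  exact h hf

theorem pderiv_two_planarPoly {f : MvPolynomial (Fin 3) ℂ} (hf : f ∈ planarPoly) :
    pderiv 2 f = 0 := by
  refine pderiv_eq_zero_of_notMem_vars fun h => ?_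
  have := mem_supported.1 hf h
  simp at this

theorem reflect_posRoot_zero_planarPoly (m : ℕ) {f : MvPolynomial (Fin 3) ℂ}
    (hf : f ∈ planarPoly) : reflect (posRoot m 0) f = f :=
  algHom_planarPoly (reflect_posRoot_zero_X m (by decide)) (reflect_posRoot_zero_X m (by decide)) hf

/-! ### The Dunkl operators in the variables `x₁, x₂` and `x₃` -/

section

variable (m : ℕ) (κ₀ κ₁ κₘ : ℝ)

theorem planarDunkl_eq (ε : ℂ) (f : MvPolynomial (Fin 3) ℂ) :
    planarDunkl m κ₀ κ₁ κₘ ε f = dunkl (posRoot m) (mult m κ₀ κ₁ κₘ) 0 f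
      + C ε * dunkl (posRoot m) (mult m κ₀ κ₁ κₘ) 1 f := by
  rw [planarDunkl, LinearMap.add_apply, LinearMap.smul_apply, smul_eq_C_mul]

theorem posRoot_zero_apply (j : Fin 3) (hj : j ≠ 2) : posRoot m 0 j = 0 := by
  rw [posRoot_zero]; fin_cases j <;> simp at hj ⊢

/-- The planar Dunkl operators commute with multiplication by `x₃`. -/
theorem planarDunkl_X_two_mul (ε : ℂ) (f : MvPolynomial (Fin 3) ℂ) :
    planarDunkl m κ₀ κ₁ κₘ ε (X 2 * f) = X 2 * planarDunkl m κ₀ κ₁ κₘ ε f := by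
  have h : ∀ j : Fin 3, j ≠ 2 → ∀ a, posRoot m a j ≠ 0 → reflect (posRoot m a) (X 2) = X 2 := by
    intro j hj a
    refine Fin.cases (fun h => absurd (posRoot_zero_apply m j hj) h) (fun i _ => ?_) a
    rw [posRoot_succ, reflect_mirrorRoot_X_two]
  rw [planarDunkl_eq, planarDunkl_eq,
    dunkl_invariant_mul _ _ (rootForm_posRoot_ne_zero m) 0 f (X 2) (h 0 (by decide)),
    dunkl_invariant_mul _ _ (rootForm_posRoot_ne_zero m) 1 f (X 2) (h 1 (by decide)),
    pderiv_X_of_ne (by decide), pderiv_X_of_ne (by decide)]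
  ring

/-- The polynomial `x₁² + x₂²`. -/
noncomputable def planarSq : MvPolynomial (Fin 3) ℂ := X 0 ^ 2 + X 1 ^ 2

theorem coord_mul_coord_neg {ε : ℂ} (hε : ε ^ 2 = -1) : coord ε * coord (-ε) = planarSq := by
  rw [coord, coord, planarSq, C_neg]
  linear_combination (-(X 1) ^ 2) * C_sq_eq hε

theorem planarDunkl_planarSq_mul {ε : ℂ} (f : MvPolynomial (Fin 3) ℂ) :
    planarDunkl m κ₀ κ₁ κₘ ε (planarSq * f)
      = 2 * coord ε * f + planarSq * planarDunkl m κ₀ κ₁ κₘ ε f := by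
  have h : ∀ a, reflect (posRoot m a) planarSq = planarSq := by
    intro a
    refine Fin.cases ?_ (fun i => ?_) a
    · refine reflect_posRoot_zero_planarPoly m ?_
      rw [← coord_mul_coord_neg Complex.I_sq]
      exact mul_mem (coord_mem_planarPoly _) (coord_mem_planarPoly _)
    · have hu := mirrorUnit_neg_mul m (i + 1) Complex.I_sq
      have hu' : mirrorUnit m Complex.I (i + 1) ≠ 0 := right_ne_zero_of_mul_eq_one hu
      rw [posRoot_succ, ← coord_mul_coord_neg Complex.I_sq, map_mul,
        reflect_coord m _ Complex.I_sq, reflect_coord_neg m _ Complex.I_sq, mul_mul_mul_comm,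
        ← C_mul, inv_mul_cancel₀ hu', C_1, one_mul, mul_comm]
  rw [planarDunkl_eq, planarDunkl_eq,
    dunkl_invariant_mul _ _ (rootForm_posRoot_ne_zero m) 0 f _ (fun a _ => h a),
    dunkl_invariant_mul _ _ (rootForm_posRoot_ne_zero m) 1 f _ (fun a _ => h a)]
  simp [planarSq, pderiv_X, coord]
  ring

theorem sum_mult (hodd : Odd m → κ₁ = κₘ) :
    ∑ j : Fin m, mult m κ₀ κ₁ κₘ j.succ = gammaHat m κ₁ κₘ := by
  have h : ∀ j : Fin m, mult m κ₀ κ₁ κₘ j.succ = if Even ((j : ℕ) + 1) then κₘ else κ₁ :=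
    fun j => by simp [mult]
  rw [Finset.sum_congr rfl fun j _ => h j,
    ← Finset.sum_range (fun j : ℕ => if Even (j + 1) then κₘ else κ₁), gammaHat]
  rcases Nat.even_or_odd m with he | ho
  · obtain ⟨p, rfl⟩ := he.two_dvd
    rw [sum_range_two_mul]
    simp [Nat.even_add_one]
    ring
  · simp [hodd ho]
    ring

/-- The relation `{D̂, x̂} = 2 (E + 1 + γ̂)`, evaluated on a planar monogenic. -/
theorem planarDunkl_coord_mul (hodd : Odd m → κ₁ = κₘ) {ε : ℂ} (hε : ε ^ 2 = -1) {k : ℕ}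
    {f : MvPolynomial (Fin 3) ℂ} (hk : f.IsHomogeneous k) (hf : f ∈ planarPoly)
    (h0 : planarDunkl m κ₀ κ₁ κₘ (-ε) f = 0) :
    planarDunkl m κ₀ κ₁ κₘ ε (coord (-ε) * f)
      = C ((2 * (k + 1 + gammaHat m κ₁ κₘ) : ℝ) : ℂ) * f := by
  have e := C_sq_eq hε
  have hEuler := hk.sum_X_mul_pderiv
  rw [Fin.sum_univ_three, pderiv_two_planarPoly hf, mul_zero, add_zero, nsmul_eq_mul] at hEuler
  have hC := fun i j => dunkl_X_mul (posRoot m) (mult m κ₀ κ₁ κₘ) (rootForm_posRoot_ne_zero m) i j f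
  simp only [posRoot_inner_self, div_one] at hC
  have hsym : ∑ a, C ((mult m κ₀ κ₁ κₘ a * posRoot m a 0 * (2 * posRoot m a 1) : ℝ) : ℂ)
        * reflect (posRoot m a) f
      = ∑ a, C ((mult m κ₀ κ₁ κₘ a * posRoot m a 1 * (2 * posRoot m a 0) : ℝ) : ℂ)
        * reflect (posRoot m a) f :=
    Finset.sum_congr rfl fun a _ => by congr 3; ring
  have hdiag : ∑ a, C ((mult m κ₀ κ₁ κₘ a * posRoot m a 0 * (2 * posRoot m a 0) : ℝ) : ℂ)
        * reflect (posRoot m a) f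
      + ∑ a, C ((mult m κ₀ κ₁ κₘ a * posRoot m a 1 * (2 * posRoot m a 1) : ℝ) : ℂ)
        * reflect (posRoot m a) f
      + 2 * (X 0 * ∑ a, C ((mult m κ₀ κ₁ κₘ a * posRoot m a 0 : ℝ) : ℂ) * diffQuot (posRoot m a) f
        + X 1 * ∑ a, C ((mult m κ₀ κ₁ κₘ a * posRoot m a 1 : ℝ) : ℂ) * diffQuot (posRoot m a) f)
      = C ((2 * gammaHat m κ₁ κₘ : ℝ) : ℂ) * f := by
    rw [Finset.mul_sum, Finset.mul_sum, ← Finset.sum_add_distrib, ← Finset.sum_add_distrib,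
      Finset.mul_sum, ← Finset.sum_add_distrib, Fin.sum_univ_succ, posRoot_zero_apply m 0 (by decide),
      posRoot_zero_apply m 1 (by decide), ← sum_mult m κ₀ κ₁ κₘ hodd, Finset.mul_sum,
      Complex.ofReal_sum, map_sum, Finset.sum_mul]
    simp only [mul_zero, zero_mul, Complex.ofReal_zero, C_0, add_zero, zero_add]
    refine Finset.sum_congr rfl fun j _ => ?_
    have hn := mirrorRoot_inner_self m (j + 1)
    have hq := sum_X_mul_diffQuot (mirrorRoot m (j + 1)) f
    have h2 : mirrorRoot m (j + 1) 2 = 0 := by simp [mirrorRoot]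
    rw [Fin.sum_univ_three, h2] at hn hq
    have hn' := congrArg (fun r : ℝ => (C (r : ℂ) : MvPolynomial (Fin 3) ℂ)) hn
    rw [posRoot_succ]
    simp only [Complex.ofReal_mul, Complex.ofReal_add, Complex.ofReal_zero, Complex.ofReal_one,
      Complex.ofReal_ofNat, C_mul, C_add, C_0, C_1, C_two] at hn' hq ⊢
    linear_combination 2 * C (mult m κ₀ κ₁ κₘ j.succ : ℂ) * (reflect (mirrorRoot m (j + 1)) f * hn'
      + hq)
  rw [planarDunkl_eq] at h0 ⊢
  have hsplit : coord (-ε) * f = X 0 * f - ε • (X 1 * f) := by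
    rw [coord, smul_eq_C_mul, C_neg]; ring
  rw [hsplit, map_sub, map_sub, map_smul, map_smul, hC 0 0, hC 1 0, hC 0 1, hC 1 1, smul_eq_C_mul,
    smul_eq_C_mul, pderiv_X_self, pderiv_X_self, pderiv_X_of_ne (by decide),
    pderiv_X_of_ne (by decide)]
  have hd0 := dunkl_apply (posRoot m) (mult m κ₀ κ₁ κₘ) 0 f
  have hd1 := dunkl_apply (posRoot m) (mult m κ₀ κ₁ κₘ) 1 f
  have hk' : C ((2 * (k + 1 + gammaHat m κ₁ κₘ) : ℝ) : ℂ)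
      = 2 * (k : MvPolynomial (Fin 3) ℂ) + 2 + C ((2 * gammaHat m κ₁ κₘ : ℝ) : ℂ) := by
    push_cast
    simp only [C_mul, C_add, C_1, C_two, map_natCast]
    ring
  rw [hk']
  simp only [C_neg] at h0
  generalize dunkl (posRoot m) (mult m κ₀ κ₁ κₘ) 0 f = d0 at *
  generalize dunkl (posRoot m) (mult m κ₀ κ₁ κₘ) 1 f = d1 at *
  linear_combination -(X 0 + C ε * X 1) * h0 + hdiag + 2 * hEuler + 2 * X 0 * hd0 + 2 * X 1 * hd1
    - C ε * hsym - (X 1 * d1 + f + ∑ a, C ((mult m κ₀ κ₁ κₘ a * posRoot m a 1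
      * (2 * posRoot m a 1) : ℝ) : ℂ) * reflect (posRoot m a) f) * e - X 1 * d1 * e

theorem dunkl_two_apply (f : MvPolynomial (Fin 3) ℂ) :
    dunkl (posRoot m) (mult m κ₀ κ₁ κₘ) 2 f
      = pderiv 2 f + C (κ₀ : ℂ) * diffQuot (posRoot m 0) f := by
  have h : ∀ j : Fin m, posRoot m j.succ 2 = 0 := fun j => by simp [posRoot_succ, mirrorRoot]
  have h0 : posRoot m 0 2 = 1 := by simp [posRoot_zero]
  rw [dunkl_apply, Fin.sum_univ_succ]
  simp [h, h0, mult]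

theorem dunkl_two_planarPoly {f : MvPolynomial (Fin 3) ℂ} (hf : f ∈ planarPoly) :
    dunkl (posRoot m) (mult m κ₀ κ₁ κₘ) 2 f = 0 := by
  rw [dunkl_two_apply, pderiv_two_planarPoly hf, diffQuot_eq_zero (rootForm_posRoot_ne_zero m 0)
    (reflect_posRoot_zero_planarPoly m hf), mul_zero, add_zero]

/-- `𝒟₃` lowers the power of `x₃` by one, up to a term of unchanged power. -/
theorem dunkl_two_X_pow_mul (n : ℕ) (f : MvPolynomial (Fin 3) ℂ) :
    dunkl (posRoot m) (mult m κ₀ κ₁ κₘ) 2 (X 2 ^ (n + 1) * f)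
      = C (stepNum κ₀ (n + 1) : ℂ) * (X 2 ^ n * f) + X 2 ^ (n + 1) * (pderiv 2 f
        + C ((κ₀ * (-1) ^ (n + 1) : ℝ) : ℂ) * diffQuot (posRoot m 0) f) := by
  have hX : (X 2 : MvPolynomial (Fin 3) ℂ) ≠ 0 := X_ne_zero 2
  have h1 := diffQuot_spec (posRoot m 0) (X 2 ^ (n + 1) * f)
  have h2 := diffQuot_spec (posRoot m 0) f
  rw [rootForm_posRoot_zero, map_mul (reflect _), map_pow (reflect _), reflect_posRoot_zero_X_two,
    neg_pow] at h1
  rw [rootForm_posRoot_zero] at h2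
  apply mul_left_cancel₀ hX
  rw [dunkl_two_apply, Derivation.leibniz, Derivation.leibniz_pow, pderiv_X_self, stepNum]
  simp only [smul_eq_mul, nsmul_eq_mul, Nat.add_sub_cancel]
  push_cast
  simp only [C_mul, C_add, C_1, C_sub, C_pow, C_neg, map_natCast]
  linear_combination C (κ₀ : ℂ) * h1 - C (κ₀ : ℂ) * (-1) ^ (n + 1) * X 2 ^ (n + 1) * h2

end

/-! ### Powers of the planar vector variable -/

/-- Multiplication of a spinor by the planar vector variable `e₁ x₁ + e₂ x₂`. -/
noncomputable def xHat : SpinorPoly →ₗ[ℂ] SpinorPoly where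
  toFun f := ![coord (-Complex.I) * f 1, coord Complex.I * f 0]
  map_add' f g := by ext1 i; fin_cases i <;> simp [mul_add]
  map_smul' c f := by ext1 i; fin_cases i <;> simp

theorem xHat_apply (f : SpinorPoly) :
    xHat f = ![coord (-Complex.I) * f 1, coord Complex.I * f 0] := rfl

theorem mulX_apply (j : Fin 3) (f : SpinorPoly) :
    mulX j f = (X j : MvPolynomial (Fin 3) ℂ) • f := rfl

theorem matAct_apply (A : Matrix (Fin 2) (Fin 2) ℂ) (f : SpinorPoly) (i : Fin 2) :
    matAct A f i = C (A i 0) * f 0 + C (A i 1) * f 1 := by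
  simp [matAct, LinearMap.pi_apply, Fin.sum_univ_two, smul_eq_C_mul]

section

variable (m : ℕ) (κ₀ κ₁ κₘ : ℝ) (δ : ℤ)

theorem spinorDunkl_apply (j : Fin 3) (f : SpinorPoly) (i : Fin 2) :
    spinorDunkl m κ₀ κ₁ κₘ j f i = dunkl (posRoot m) (mult m κ₀ κ₁ κₘ) j (f i) := rfl

theorem diracHat_apply (f : SpinorPoly) : diracHat m κ₀ κ₁ κₘ δ f
    = ![planarDunkl m κ₀ κ₁ κₘ (-Complex.I) (f 1), planarDunkl m κ₀ κ₁ κₘ Complex.I (f 0)] := by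
  ext1 i
  fin_cases i <;>
    simp [diracHat, matAct_apply, spinorDunkl_apply, planarDunkl_eq, pauli]

theorem diracOp_apply (f : SpinorPoly) : diracOp m κ₀ κ₁ κₘ δ f
    = diracHat m κ₀ κ₁ κₘ δ f + matAct (pauli δ 2) (spinorDunkl m κ₀ κ₁ κₘ 2 f) := by
  rw [diracOp, Fin.sum_univ_three, diracHat]
  rfl

theorem matAct_three_apply (f : SpinorPoly) :
    matAct (pauli δ 2) f = ![C (δ : ℂ) * f 0, -(C (δ : ℂ) * f 1)] := by
  ext1 i
  fin_cases i <;> simp [matAct_apply, pauli]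

theorem matAct_three_sq (hδ : δ = 1 ∨ δ = -1) (f : SpinorPoly) :
    matAct (pauli δ 2) (matAct (pauli δ 2) f) = f := by
  have h : (δ : MvPolynomial (Fin 3) ℂ) * δ = 1 := by rcases hδ with rfl | rfl <;> simp
  ext1 i
  fin_cases i
  · simp only [matAct_three_apply]
    simp [← mul_assoc, h]
  · simp only [matAct_three_apply]
    simp [← mul_assoc, h]

theorem matAct_smul (A : Matrix (Fin 2) (Fin 2) ℂ) (g : MvPolynomial (Fin 3) ℂ) (f : SpinorPoly) :
    matAct A (g • f) = g • matAct A f := by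
  ext1 i
  simp only [matAct_apply, Pi.smul_apply, smul_eq_mul]
  ring

theorem diracHat_matAct_three (f : SpinorPoly) :
    diracHat m κ₀ κ₁ κₘ δ (matAct (pauli δ 2) f)
      = -matAct (pauli δ 2) (diracHat m κ₀ κ₁ κₘ δ f) := by
  simp only [diracHat_apply, matAct_three_apply, ← smul_eq_C_mul]
  ext1 i
  fin_cases i <;> simp

theorem diracHat_X_two_smul (f : SpinorPoly) :
    diracHat m κ₀ κ₁ κₘ δ ((X 2 : MvPolynomial (Fin 3) ℂ) • f)
      = (X 2 : MvPolynomial (Fin 3) ℂ) • diracHat m κ₀ κ₁ κₘ δ f := by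
  simp only [diracHat_apply, Pi.smul_apply, smul_eq_mul, planarDunkl_X_two_mul]
  ext1 i
  fin_cases i <;> simp

theorem diracHat_X_two_pow_smul (n : ℕ) (f : SpinorPoly) :
    diracHat m κ₀ κ₁ κₘ δ ((X 2 ^ n : MvPolynomial (Fin 3) ℂ) • f)
      = (X 2 ^ n : MvPolynomial (Fin 3) ℂ) • diracHat m κ₀ κ₁ κₘ δ f := by
  induction n with
  | zero => simp
  | succ n ih => rw [pow_succ', mul_smul, diracHat_X_two_smul, ih, mul_smul]

theorem xHat_xHat (f : SpinorPoly) : xHat (xHat f) = planarSq • f := by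
  have h := coord_mul_coord_neg Complex.I_sq
  ext1 i
  fin_cases i
  · simp [xHat_apply, ← h]; ring
  · simp [xHat_apply, ← h]; ring

theorem diracHat_planarSq_smul (f : SpinorPoly) : diracHat m κ₀ κ₁ κₘ δ (planarSq • f)
    = (2 : ℂ) • xHat f + planarSq • diracHat m κ₀ κ₁ κₘ δ f := by
  simp only [diracHat_apply, Pi.smul_apply, smul_eq_mul, planarDunkl_planarSq_mul, xHat_apply]
  ext1 i
  fin_cases i <;> simp [smul_eq_C_mul, C_two, mul_assoc]

/-- A planar spherical monogenic of degree `k`: a spinor-valued homogeneous polynomial in `x₁, x₂`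
annihilated by the planar Dunkl–Dirac operator. -/
structure IsPlanarMonogenic (k : ℕ) (Φ : SpinorPoly) : Prop where
  homogeneous : ∀ i, (Φ i).IsHomogeneous k
  planar : ∀ i, Φ i ∈ planarPoly
  diracHat_eq_zero : diracHat m κ₀ κ₁ κₘ δ Φ = 0

variable {m κ₀ κ₁ κₘ δ} {k : ℕ} {Φ : SpinorPoly}

theorem IsPlanarMonogenic.diracHat_xHat (hΦ : IsPlanarMonogenic m κ₀ κ₁ κₘ δ k Φ)
    (hodd : Odd m → κ₁ = κₘ) : diracHat m κ₀ κ₁ κₘ δ (xHat Φ)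
      = ((2 * (k + 1 + gammaHat m κ₁ κₘ) : ℝ) : ℂ) • Φ := by
  have h := hΦ.diracHat_eq_zero
  rw [diracHat_apply] at h
  have h0 : planarDunkl m κ₀ κ₁ κₘ (-Complex.I) (Φ 1) = 0 := congrFun h 0
  have h1 : planarDunkl m κ₀ κ₁ κₘ Complex.I (Φ 0) = 0 := congrFun h 1
  have e0 := planarDunkl_coord_mul m κ₀ κ₁ κₘ hodd (ε := -Complex.I) (by simp) (hΦ.homogeneous 0)
    (hΦ.planar 0) (by rw [neg_neg]; exact h1)
  have e1 := planarDunkl_coord_mul m κ₀ κ₁ κₘ hodd (ε := Complex.I) (by simp) (hΦ.homogeneous 1)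
    (hΦ.planar 1) h0
  rw [neg_neg] at e0
  ext1 i
  fin_cases i
  · simpa [diracHat_apply, xHat_apply, smul_eq_C_mul] using e0
  · simpa [diracHat_apply, xHat_apply, smul_eq_C_mul] using e1

/-- On `x̂^N Φ` the operator `D̂` acts like a one-variable Dunkl operator on `x^N`, with
multiplicity `k + γ̂ + 1/2`. At `N = 0` the number `stepNum` vanishes and `N - 1 = 0` is
immaterial. -/
theorem IsPlanarMonogenic.diracHat_xHat_pow (hΦ : IsPlanarMonogenic m κ₀ κ₁ κₘ δ k Φ)
    (hodd : Odd m → κ₁ = κₘ) (N : ℕ) : diracHat m κ₀ κ₁ κₘ δ ((xHat ^ N) Φ)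
      = (stepNum (k + gammaHat m κ₁ κₘ + 1 / 2) N : ℂ) • (xHat ^ (N - 1)) Φ := by
  have hsq : ∀ n, (xHat ^ (n + 2)) Φ = planarSq • (xHat ^ n) Φ := fun n => by
    rw [pow_succ', pow_succ', Module.End.mul_apply, Module.End.mul_apply, xHat_xHat]
  induction N using Nat.strong_induction_on with
  | _ N ih =>
    match N with
    | 0 => simp [stepNum_zero, hΦ.diracHat_eq_zero]
    | 1 =>
      rw [pow_one, hΦ.diracHat_xHat hodd]
      congr 2
      rw [stepNum]; push_cast; ring
    | n + 2 =>
      rw [hsq, diracHat_planarSq_smul, ih n (by omega), smul_comm planarSq]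
      have h1 : n + 2 - 1 = n + 1 := by omega
      have hs : stepNum (k + gammaHat m κ₁ κₘ + 1 / 2) (n + 2)
          = 2 + stepNum (k + gammaHat m κ₁ κₘ + 1 / 2) n := by
        rw [stepNum, stepNum, pow_add]; push_cast; ring
      rw [h1, hs, Complex.ofReal_add, add_smul, pow_succ' _ n, Module.End.mul_apply,
        Complex.ofReal_ofNat]
      congr 1
      rcases n with _ | n
      · simp [stepNum_zero]
      · rw [Nat.add_sub_cancel, ← hsq, pow_succ', Module.End.mul_apply]

/-- The product `γ_N γ_{N-1} ⋯ γ_{N-i+1}`, which vanishes for `i > N`. -/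
noncomputable def stepFalling (κ : ℝ) (N i : ℕ) : ℝ := ∏ l ∈ Finset.range i, stepNum κ (N - l)

theorem stepFalling_succ (κ : ℝ) (N i : ℕ) :
    stepFalling κ N (i + 1) = stepFalling κ N i * stepNum κ (N - i) := Finset.prod_range_succ _ _

theorem stepFalling_eq_zero (κ : ℝ) {N i : ℕ} (h : N < i) : stepFalling κ N i = 0 :=
  Finset.prod_eq_zero (Finset.mem_range.2 h) (by rw [Nat.sub_self, stepNum_zero])

theorem stepFalling_mul_stepFactorial (κ : ℝ) {N i : ℕ} (h : i ≤ N) :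
    stepFalling κ N i * stepFactorial κ (N - i) = stepFactorial κ N := by
  induction i with
  | zero => simp [stepFalling]
  | succ i ih =>
    rw [← ih (by omega), stepFalling_succ, show N - i = N - (i + 1) + 1 by omega,
      stepFactorial_succ]
    ring

theorem IsPlanarMonogenic.diracHat_pow_xHat_pow (hΦ : IsPlanarMonogenic m κ₀ κ₁ κₘ δ k Φ)
    (hodd : Odd m → κ₁ = κₘ) (N i : ℕ) : ((diracHat m κ₀ κ₁ κₘ δ) ^ i) ((xHat ^ N) Φ)
      = (stepFalling (k + gammaHat m κ₁ κₘ + 1 / 2) N i : ℂ) • (xHat ^ (N - i)) Φ := by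
  induction i with
  | zero => simp [stepFalling]
  | succ i ih =>
    rw [pow_succ', Module.End.mul_apply, ih, map_smul, hΦ.diracHat_xHat_pow hodd, smul_smul,
      stepFalling_succ, Complex.ofReal_mul, Nat.sub_sub]

theorem IsPlanarMonogenic.mulX_diracHat_pow (hΦ : IsPlanarMonogenic m κ₀ κ₁ κₘ δ k Φ)
    (hodd : Odd m → κ₁ = κₘ) (N i : ℕ) :
    ((mulX 2 ∘ₗ diracHat m κ₀ κ₁ κₘ δ) ^ i) ((xHat ^ N) Φ)
      = (stepFalling (k + gammaHat m κ₁ κₘ + 1 / 2) N i : ℂ)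
        • (X 2 ^ i : MvPolynomial (Fin 3) ℂ) • (xHat ^ (N - i)) Φ := by
  induction i with
  | zero => simp [stepFalling]
  | succ i ih =>
    rw [pow_succ', Module.End.mul_apply, ih, LinearMap.comp_apply, map_smul, map_smul,
      diracHat_X_two_pow_smul, hΦ.diracHat_xHat_pow hodd, mulX_apply, smul_smul, ← pow_succ',
      smul_comm _ ((stepNum _ _ : ℝ) : ℂ), smul_smul, stepFalling_succ, Complex.ofReal_mul,
      Nat.sub_sub]

end

/-! ### The Cauchy–Kovalevskaya extension -/

section

variable (m : ℕ) (κ₀ κ₁ κₘ : ℝ) (δ : ℤ)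

/-- The coefficient of `x₃^i x̂^{N-i} Φ` in the extension of `x̂^N Φ`, up to sign. -/
noncomputable def ckCoeff (κ₀ κ : ℝ) (N i : ℕ) : ℝ := stepFalling κ N i / stepFactorial κ₀ i

/-- The Cauchy–Kovalevskaya extension of `x̂^N Φ` as an explicit sum; `κ` is the multiplicity of
the one-variable Dunkl operator by which `D̂` acts on the powers of `x̂`. -/
noncomputable def ckSum (κ₀ κ : ℝ) (δ : ℤ) (N : ℕ) (Φ : SpinorPoly) : SpinorPoly :=
  ∑ j ∈ Finset.range (N / 2 + 1), (((-1) ^ j : ℝ) : ℂ) •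
    ((ckCoeff κ₀ κ N (2 * j) : ℂ) • (X 2 ^ (2 * j) : MvPolynomial (Fin 3) ℂ)
        • (xHat ^ (N - 2 * j)) Φ
      - (ckCoeff κ₀ κ N (2 * j + 1) : ℂ) • matAct (pauli δ 2)
        ((X 2 ^ (2 * j + 1) : MvPolynomial (Fin 3) ℂ) • (xHat ^ (N - (2 * j + 1))) Φ))

theorem ckCoeff_eq_zero (κ₀ κ : ℝ) {N i : ℕ} (h : N < i) : ckCoeff κ₀ κ N i = 0 := by
  rw [ckCoeff, stepFalling_eq_zero κ h, zero_div]

theorem ckCoeff_zero (κ₀ κ : ℝ) (N : ℕ) : ckCoeff κ₀ κ N 0 = 1 := by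
  simp [ckCoeff, stepFalling, stepFactorial]

theorem ckCoeff_succ {κ₀ : ℝ} (h₀ : 0 < κ₀) (κ : ℝ) (N i : ℕ) :
    ckCoeff κ₀ κ N (i + 1) * stepNum κ₀ (i + 1) = ckCoeff κ₀ κ N i * stepNum κ (N - i) := by
  have := (stepNum_pos h₀ i).ne'
  have := (stepFactorial_pos h₀ i).ne'
  rw [ckCoeff, ckCoeff, stepFalling_succ, stepFactorial_succ]
  field_simp

variable {m κ₀ κ₁ κₘ δ} {k : ℕ} {Φ : SpinorPoly}

theorem hyp01_xHat_pow (hΦ : IsPlanarMonogenic m κ₀ κ₁ κₘ δ k Φ) (hodd : Odd m → κ₁ = κₘ)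
    (c : ℝ) (N : ℕ) : hyp01 m κ₀ κ₁ κₘ δ c ((xHat ^ N) Φ)
      = ∑ j ∈ Finset.range (N / 2 + 1),
        (((-1) ^ j / (4 ^ j * j.factorial * poch c j) : ℝ) : ℂ) •
        (stepFalling (k + gammaHat m κ₁ κₘ + 1 / 2) N (2 * j) : ℂ)
        • (X 2 ^ (2 * j) : MvPolynomial (Fin 3) ℂ) • (xHat ^ (N - 2 * j)) Φ := by
  rw [hyp01]
  simp only [hΦ.mulX_diracHat_pow hodd]
  refine finsum_eq_sum_of_support_subset _ fun j hj => ?_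
  rw [Finset.coe_range, Set.mem_Iio]
  by_contra hlt
  refine hj ?_
  beta_reduce
  rw [stepFalling_eq_zero _ (by omega), Complex.ofReal_zero, zero_smul, smul_zero]

/-- As `x₃ D̂` acts on the `x₃^i x̂^{N-i} Φ` by the numbers `stepNum`, the two series `₀F₁` give the terms
without and with `e₃` of the explicit sum. -/
theorem ckExt_xHat_pow (hκ₀ : 0 < κ₀) (hΦ : IsPlanarMonogenic m κ₀ κ₁ κₘ δ k Φ)
    (hodd : Odd m → κ₁ = κₘ) (N : ℕ) : ckExt m κ₀ κ₁ κₘ δ ((xHat ^ N) Φ)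
      = ckSum κ₀ (k + gammaHat m κ₁ κₘ + 1 / 2) δ N Φ := by
  rw [ckExt, hyp01_xHat_pow hΦ hodd, hyp01_xHat_pow hΦ hodd, map_sum, map_sum, map_sum,
    Finset.smul_sum, ← Finset.sum_sub_distrib, ckSum]
  refine Finset.sum_congr rfl fun j _ => ?_
  have hD : mulX 2 (diracHat m κ₀ κ₁ κₘ δ ((X 2 ^ (2 * j) : MvPolynomial (Fin 3) ℂ)
      • (xHat ^ (N - 2 * j)) Φ)) = (stepNum (k + gammaHat m κ₁ κₘ + 1 / 2) (N - 2 * j) : ℂ)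
        • (X 2 ^ (2 * j + 1) : MvPolynomial (Fin 3) ℂ) • (xHat ^ (N - (2 * j + 1))) Φ := by
    rw [diracHat_X_two_pow_smul, hΦ.diracHat_xHat_pow hodd, mulX_apply, smul_smul, ← pow_succ',
      smul_comm, Nat.sub_sub]
  simp only [map_smul]
  rw [hD, map_smul, smul_sub]
  simp only [smul_smul, ← Complex.ofReal_mul]
  have h2 := (stepFactorial_two_mul κ₀ j).1
  have h3 := (stepFactorial_two_mul κ₀ j).2
  have hp := poch_pos (show 0 < κ₀ + 1 / 2 by linarith) j
  have hp' := poch_pos (show 0 < κ₀ + 3 / 2 by linarith) j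
  rw [poch_succ_left, show κ₀ + 1 / 2 + 1 = κ₀ + 3 / 2 by ring] at h3
  congr 3
  · rw [ckCoeff, h2]
    field_simp
  · rw [ckCoeff, h3, stepFalling_succ]
    generalize poch (κ₀ + 3 / 2) j = p at *
    have : 2 * κ₀ + 1 ≠ 0 := by positivity
    have : κ₀ + 1 / 2 ≠ 0 := by positivity
    field_simp

theorem xHat_pow_planar (hΦ : ∀ i, Φ i ∈ planarPoly) (N : ℕ) (i : Fin 2) :
    (xHat ^ N) Φ i ∈ planarPoly := by
  induction N generalizing i with
  | zero => exact hΦ i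
  | succ N ih =>
    rw [pow_succ', Module.End.mul_apply, xHat_apply]
    fin_cases i
    · exact mul_mem (coord_mem_planarPoly _) (ih 1)
    · exact mul_mem (coord_mem_planarPoly _) (ih 0)

theorem xHat_pow_homogeneous (hΦ : ∀ i, (Φ i).IsHomogeneous k) (N : ℕ) (i : Fin 2) :
    ((xHat ^ N) Φ i).IsHomogeneous (N + k) := by
  induction N generalizing i with
  | zero => simpa using hΦ i
  | succ N ih =>
    rw [pow_succ', Module.End.mul_apply, xHat_apply, show N + 1 + k = 1 + (N + k) by ring]
    fin_cases i
    · exact (isHomogeneous_coord _).mul (ih 1)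
    · exact (isHomogeneous_coord _).mul (ih 0)

/-- `𝒟₃` on `x₃^n f` for a spinor `f` in the variables `x₁, x₂`. At `n = 0` the number `stepNum`
vanishes. -/
theorem spinorDunkl_two_X_pow_smul {f : SpinorPoly} (hf : ∀ i, f i ∈ planarPoly) (n : ℕ) :
    spinorDunkl m κ₀ κ₁ κₘ 2 ((X 2 ^ n : MvPolynomial (Fin 3) ℂ) • f)
      = (stepNum κ₀ n : ℂ) • (X 2 ^ (n - 1) : MvPolynomial (Fin 3) ℂ) • f := by
  ext1 i
  rw [spinorDunkl_apply, Pi.smul_apply, Pi.smul_apply, Pi.smul_apply, smul_eq_C_mul, smul_eq_mul,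
    smul_eq_mul]
  rcases n with _ | n
  · rw [pow_zero, one_mul, dunkl_two_planarPoly _ _ _ _ (hf i), stepNum_zero]
    simp
  · rw [dunkl_two_X_pow_mul, pderiv_two_planarPoly (hf i), diffQuot_eq_zero
      (rootForm_posRoot_ne_zero m 0) (reflect_posRoot_zero_planarPoly m (hf i)), Nat.add_sub_cancel]
    simp

theorem spinorDunkl_matAct (j : Fin 3) (A : Matrix (Fin 2) (Fin 2) ℂ) (f : SpinorPoly) :
    spinorDunkl m κ₀ κ₁ κₘ j (matAct A f) = matAct A (spinorDunkl m κ₀ κ₁ κₘ j f) := by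
  ext1 i
  simp only [spinorDunkl_apply, matAct_apply, map_add, ← smul_eq_C_mul, map_smul]

theorem IsPlanarMonogenic.diracOp_X_pow_smul (hΦ : IsPlanarMonogenic m κ₀ κ₁ κₘ δ k Φ)
    (hodd : Odd m → κ₁ = κₘ) (i N : ℕ) :
    diracOp m κ₀ κ₁ κₘ δ ((X 2 ^ i : MvPolynomial (Fin 3) ℂ) • (xHat ^ N) Φ)
      = (stepNum (k + gammaHat m κ₁ κₘ + 1 / 2) N : ℂ)
          • (X 2 ^ i : MvPolynomial (Fin 3) ℂ) • (xHat ^ (N - 1)) Φ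
        + (stepNum κ₀ i : ℂ) • matAct (pauli δ 2)
          ((X 2 ^ (i - 1) : MvPolynomial (Fin 3) ℂ) • (xHat ^ N) Φ) := by
  rw [diracOp_apply, diracHat_X_two_pow_smul, hΦ.diracHat_xHat_pow hodd,
    spinorDunkl_two_X_pow_smul (xHat_pow_planar hΦ.planar N),
    smul_comm _ ((stepNum _ _ : ℝ) : ℂ), map_smul]

theorem IsPlanarMonogenic.diracOp_matAct_X_pow_smul (hΦ : IsPlanarMonogenic m κ₀ κ₁ κₘ δ k Φ)
    (hδ : δ = 1 ∨ δ = -1) (hodd : Odd m → κ₁ = κₘ) (i N : ℕ) :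
    diracOp m κ₀ κ₁ κₘ δ
        (matAct (pauli δ 2) ((X 2 ^ i : MvPolynomial (Fin 3) ℂ) • (xHat ^ N) Φ))
      = (stepNum κ₀ i : ℂ) • (X 2 ^ (i - 1) : MvPolynomial (Fin 3) ℂ) • (xHat ^ N) Φ
        - (stepNum (k + gammaHat m κ₁ κₘ + 1 / 2) N : ℂ) • matAct (pauli δ 2)
          ((X 2 ^ i : MvPolynomial (Fin 3) ℂ) • (xHat ^ (N - 1)) Φ) := by
  rw [diracOp_apply, spinorDunkl_matAct, matAct_three_sq δ hδ, diracHat_matAct_three,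
    diracHat_X_two_pow_smul, hΦ.diracHat_xHat_pow hodd,
    spinorDunkl_two_X_pow_smul (xHat_pow_planar hΦ.planar N),
    smul_comm _ ((stepNum _ _ : ℝ) : ℂ), map_smul]
  abel

/-- The extension is annihilated by the Dunkl–Dirac operator: the terms without `e₃` cancel in
pairs, those with `e₃` telescope. -/
theorem diracOp_ckSum (hκ₀ : 0 < κ₀) (hδ : δ = 1 ∨ δ = -1)
    (hΦ : IsPlanarMonogenic m κ₀ κ₁ κₘ δ k Φ) (hodd : Odd m → κ₁ = κₘ) (N : ℕ) :
    diracOp m κ₀ κ₁ κₘ δ (ckSum κ₀ (k + gammaHat m κ₁ κₘ + 1 / 2) δ N Φ) = 0 := by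
  set κ := k + gammaHat m κ₁ κₘ + 1 / 2 with hκ
  set T : ℕ → SpinorPoly := fun j => (((-1) ^ j * (ckCoeff κ₀ κ N (2 * j) * stepNum κ₀ (2 * j)) : ℝ) : ℂ)
    • matAct (pauli δ 2) ((X 2 ^ (2 * j - 1) : MvPolynomial (Fin 3) ℂ) • (xHat ^ (N - 2 * j)) Φ)
    with hT
  rw [ckSum, map_sum]
  have hterm : ∀ j ∈ Finset.range (N / 2 + 1), diracOp m κ₀ κ₁ κₘ δ ((((-1) ^ j : ℝ) : ℂ) •
    ((ckCoeff κ₀ κ N (2 * j) : ℂ) • (X 2 ^ (2 * j) : MvPolynomial (Fin 3) ℂ)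
        • (xHat ^ (N - 2 * j)) Φ
      - (ckCoeff κ₀ κ N (2 * j + 1) : ℂ) • matAct (pauli δ 2)
        ((X 2 ^ (2 * j + 1) : MvPolynomial (Fin 3) ℂ) • (xHat ^ (N - (2 * j + 1))) Φ)))
      = T j - T (j + 1) := by
    intro j _
    have r1 := ckCoeff_succ hκ₀ κ N (2 * j)
    have r2 := ckCoeff_succ hκ₀ κ N (2 * j + 1)
    rw [map_smul, map_sub, map_smul (diracOp _ _ _ _ _) ((ckCoeff _ _ _ _ : ℝ) : ℂ),
      map_smul (diracOp _ _ _ _ _) ((ckCoeff _ _ _ _ : ℝ) : ℂ), hΦ.diracOp_X_pow_smul hodd,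
      hΦ.diracOp_matAct_X_pow_smul hδ hodd, ← hκ]
    simp only [hT]
    rw [show 2 * (j + 1) = 2 * j + 1 + 1 by ring, Nat.add_sub_cancel, Nat.add_sub_cancel, r2,
      pow_succ, Nat.sub_sub, Nat.sub_sub]
    generalize (X 2 ^ (2 * j) : MvPolynomial (Fin 3) ℂ) • (xHat ^ (N - (2 * j + 1))) Φ = U
    generalize matAct (pauli δ 2) ((X 2 ^ (2 * j - 1) : MvPolynomial (Fin 3) ℂ)
      • (xHat ^ (N - 2 * j)) Φ) = V
    generalize matAct (pauli δ 2) ((X 2 ^ (2 * j + 1) : MvPolynomial (Fin 3) ℂ)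
      • (xHat ^ (N - (2 * j + 1 + 1))) Φ) = V'
    have r1' : (ckCoeff κ₀ κ N (2 * j + 1) : ℂ) * (stepNum κ₀ (2 * j + 1) : ℂ)
        = (ckCoeff κ₀ κ N (2 * j) : ℂ) * (stepNum κ (N - 2 * j) : ℂ) := by exact_mod_cast r1
    rw [smul_sub ((ckCoeff κ₀ κ N (2 * j + 1) : ℝ) : ℂ), smul_smul _ _ U, r1']
    push_cast
    module
  rw [Finset.sum_congr rfl hterm, Finset.sum_range_sub']
  simp only [hT]
  rw [ckCoeff_eq_zero κ₀ κ (show N < 2 * (N / 2 + 1) by omega), mul_zero, stepNum_zero]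
  simp

theorem ckSum_homogeneous (hΦ : IsPlanarMonogenic m κ₀ κ₁ κₘ δ k Φ) (κ : ℝ) (N : ℕ) (i : Fin 2) :
    (ckSum κ₀ κ δ N Φ i).IsHomogeneous (N + k) := by
  have hX : ∀ n i, n ≤ N → ((X 2 ^ n * (xHat ^ (N - n)) Φ i : MvPolynomial (Fin 3) ℂ)).IsHomogeneous
      (N + k) := by
    intro n i hn
    have h := ((isHomogeneous_X ℂ (2 : Fin 3)).pow n).mul (xHat_pow_homogeneous hΦ.homogeneous
      (N - n) i)
    convert h using 1
    omega
  rw [ckSum, Finset.sum_apply]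
  refine IsHomogeneous.sum _ _ _ fun j hj => ?_
  have hj' := Finset.mem_range.1 hj
  simp only [Pi.smul_apply, Pi.sub_apply, smul_eq_C_mul, smul_eq_mul]
  refine (IsHomogeneous.sub ((hX _ _ (by omega)).C_mul _) ?_).C_mul _
  by_cases h : 2 * j + 1 ≤ N
  · refine IsHomogeneous.C_mul ?_ _
    rw [matAct_apply]
    exact ((hX _ _ h).C_mul _).add ((hX _ _ h).C_mul _)
  · rw [ckCoeff_eq_zero _ _ (by omega), Complex.ofReal_zero, C_0, zero_mul]
    exact isHomogeneous_zero _ _ _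

/-! ### Restriction to the plane `x₃ = 0` -/

/-- The substitution `x₃ = 0`. -/
noncomputable def planeRestrict : MvPolynomial (Fin 3) ℂ →ₐ[ℂ] MvPolynomial (Fin 3) ℂ :=
  aeval ![X 0, X 1, 0]

theorem planeRestrict_X_two : planeRestrict (X 2) = 0 := by simp [planeRestrict]

theorem planeRestrict_planarPoly {f : MvPolynomial (Fin 3) ℂ} (hf : f ∈ planarPoly) :
    planeRestrict f = f :=
  algHom_planarPoly (by simp [planeRestrict]) (by simp [planeRestrict]) hf

/-- `CK` extends: the restriction of the extension to `x₃ = 0` is `x̂^N Φ`. -/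
theorem planeRestrict_ckSum (hΦ : ∀ i, Φ i ∈ planarPoly) (κ : ℝ) (N : ℕ) :
    planeRestrict.toLinearMap.compLeft (Fin 2) (ckSum κ₀ κ δ N Φ) = (xHat ^ N) Φ := by
  ext1 i
  rw [LinearMap.compLeft_apply, Function.comp_apply, AlgHom.toLinearMap_apply, ckSum,
    Finset.sum_apply, map_sum, Finset.sum_eq_single 0]
  · simp only [Pi.smul_apply, Pi.sub_apply, smul_eq_C_mul, smul_eq_mul, matAct_apply, map_mul,
      map_sub, map_add, planeRestrict_X_two, mul_zero, zero_add, pow_zero, pow_one,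
      ckCoeff_zero, Nat.sub_zero, planeRestrict_planarPoly (xHat_pow_planar hΦ N i)]
    simp
  · intro j _ hj
    have h2 : 2 * j ≠ 0 := by omega
    simp only [Pi.smul_apply, Pi.sub_apply, smul_eq_C_mul, smul_eq_mul, matAct_apply, map_mul,
      map_sub, map_add, map_pow, planeRestrict_X_two, zero_pow h2, zero_pow (Nat.succ_ne_zero _)]
    simp
  · simp

end

/-! ### The extension in terms of Jacobi polynomials -/

section

variable {κ₀ b R y ρ U : ℝ} (h₀ : 0 < κ₀) (hb : 0 ≤ b) (hu : R * (1 - U) = 2 * y ^ 2)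
  (hv : R * (1 + U) = 2 * ρ) (t : ℕ)

theorem ckCoeff_eq_div {κ : ℝ} (hκ : 0 < κ) (κ₀ : ℝ) {N i : ℕ} (h : i ≤ N) : ckCoeff κ₀ κ N i
    = stepFactorial κ N / (stepFactorial κ (N - i) * stepFactorial κ₀ i) := by
  have := (stepFactorial_pos hκ (N - i)).ne'
  rw [ckCoeff, ← stepFalling_mul_stepFactorial κ h]
  field_simp

include h₀ hb hu hv

/-- This and the following three lemmas expand the Jacobi polynomials occurring in `B_{n,k}`. Here `R`,
`y` and `ρ` stand for `|x|²`, `x₃` and `x₁² + x₂²`, while `b = k + γ̂`; the names refer to the parity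
of `n - k` and to the terms without (`scalar`) or with (`vector`) a factor `x̂`. -/
theorem ckSum_even_scalar :
    t.factorial / poch (κ₀ + 1 / 2) t * (R ^ t * jacobi t (κ₀ - 1 / 2) b U)
      = ∑ i ∈ Finset.range (t + 1), (-1) ^ i * (ckCoeff κ₀ (b + 1 / 2) (2 * t) (2 * i)
        * (y ^ (2 * i) * ρ ^ (t - i))) := by
  rw [pow_mul_jacobi t _ _ R _ _ U (by linarith) hu hv, jacobiForm_eq_sum t (by linarith)
    (by linarith), Finset.mul_sum]
  refine Finset.sum_congr rfl fun i hi => ?_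
  have hi' : i ≤ t := Nat.lt_succ_iff.1 (Finset.mem_range.1 hi)
  rw [ckCoeff_eq_div (by linarith) κ₀ (by omega), show 2 * t - 2 * i = 2 * (t - i) by omega,
    (stepFactorial_two_mul _ _).1, (stepFactorial_two_mul _ _).1, (stepFactorial_two_mul _ _).1,
    show κ₀ - 1 / 2 + 1 = κ₀ + 1 / 2 by ring, show b + 1 / 2 + 1 / 2 = b + 1 by ring,
    show (4 : ℝ) ^ t = 4 ^ i * 4 ^ (t - i) by rw [← pow_add, Nat.add_sub_cancel' hi'],
    neg_pow, pow_mul y]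
  have h1 := (poch_pos (show 0 < κ₀ + 1 / 2 by linarith) t).ne'
  have h2 := (poch_pos (show 0 < κ₀ + 1 / 2 by linarith) i).ne'
  have h3 := (poch_pos (show 0 < b + 1 by linarith) (t - i)).ne'
  generalize poch (κ₀ + 1 / 2) t = p1 at *
  generalize poch (κ₀ + 1 / 2) i = p2 at *
  generalize (y ^ 2) ^ i = y2
  field_simp

theorem ckSum_even_vector (hR : R ≠ 0) :
    t.factorial / poch (κ₀ + 1 / 2) t * (R ^ t
        * (y / R * (if t = 0 then 0 else jacobi (t - 1) (κ₀ + 1 / 2) (b + 1) U)))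
      = ∑ i ∈ Finset.range t, (-1) ^ i * (ckCoeff κ₀ (b + 1 / 2) (2 * t) (2 * i + 1)
        * (y ^ (2 * i + 1) * ρ ^ (t - 1 - i))) := by
  rcases t with _ | t
  · simp
  rw [if_neg (by omega), Nat.add_sub_cancel, show R ^ (t + 1) * (y / R
      * jacobi t (κ₀ + 1 / 2) (b + 1) U) = y * (R ^ t * jacobi t (κ₀ + 1 / 2) (b + 1) U) by
    rw [pow_succ]; field_simp,
    pow_mul_jacobi t _ _ R _ _ U (by linarith) hu hv, jacobiForm_eq_sum t (by linarith)
    (by linarith), Finset.mul_sum, Finset.mul_sum]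
  refine Finset.sum_congr rfl fun i hi => ?_
  have hi' : i ≤ t := Nat.lt_succ_iff.1 (Finset.mem_range.1 hi)
  rw [ckCoeff_eq_div (by linarith) κ₀ (by omega),
    show 2 * (t + 1) - (2 * i + 1) = 2 * (t - i) + 1 by omega,
    (stepFactorial_two_mul _ _).1, (stepFactorial_two_mul _ _).2, (stepFactorial_two_mul _ _).2,
    show b + 1 / 2 + 1 / 2 = b + 1 by ring, pow_succ 4 t,
    show (4 : ℝ) ^ t = 4 ^ i * 4 ^ (t - i) by rw [← pow_add, Nat.add_sub_cancel' hi'],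
    neg_pow, pow_succ y (2 * i), pow_mul y, poch_succ_left (κ₀ + 1 / 2), poch_succ_left (κ₀ + 1 / 2),
    poch_succ_left (b + 1), poch_succ_left (b + 1)]
  have h1 := (poch_pos (show 0 < κ₀ + 1 / 2 + 1 by linarith) t).ne'
  have h2 := (poch_pos (show 0 < κ₀ + 1 / 2 + 1 by linarith) i).ne'
  have h3 := (poch_pos (show 0 < b + 1 + 1 by linarith) (t - i)).ne'
  have h4 : κ₀ + 1 / 2 ≠ 0 := by linarith
  have h5 : b + 1 ≠ 0 := by linarith
  generalize κ₀ + 1 / 2 = q at *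
  generalize b + 1 = q' at *
  generalize (y ^ 2) ^ i = y2
  field_simp
  norm_num

theorem ckSum_odd_vector :
    t.factorial / poch (κ₀ + 1 / 2) t * (R ^ t * jacobi t (κ₀ - 1 / 2) (b + 1) U)
      = ∑ i ∈ Finset.range (t + 1), (-1) ^ i * (ckCoeff κ₀ (b + 1 / 2) (2 * t + 1) (2 * i)
        * (y ^ (2 * i) * ρ ^ (t - i))) := by
  rw [pow_mul_jacobi t _ _ R _ _ U (by linarith) hu hv, jacobiForm_eq_sum t (by linarith)
    (by linarith), Finset.mul_sum]
  refine Finset.sum_congr rfl fun i hi => ?_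
  have hi' : i ≤ t := Nat.lt_succ_iff.1 (Finset.mem_range.1 hi)
  rw [ckCoeff_eq_div (by linarith) κ₀ (by omega), show 2 * t + 1 - 2 * i = 2 * (t - i) + 1 by omega,
    (stepFactorial_two_mul _ _).2, (stepFactorial_two_mul _ _).2, (stepFactorial_two_mul _ _).1,
    show κ₀ - 1 / 2 + 1 = κ₀ + 1 / 2 by ring, show b + 1 / 2 + 1 / 2 = b + 1 by ring,
    show (4 : ℝ) ^ t = 4 ^ i * 4 ^ (t - i) by rw [← pow_add, Nat.add_sub_cancel' hi'],
    neg_pow, pow_mul y, poch_succ_left (b + 1), poch_succ_left (b + 1)]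
  have h1 := (poch_pos (show 0 < κ₀ + 1 / 2 by linarith) t).ne'
  have h2 := (poch_pos (show 0 < κ₀ + 1 / 2 by linarith) i).ne'
  have h3 := (poch_pos (show 0 < b + 1 + 1 by linarith) (t - i)).ne'
  have h5 : b + 1 ≠ 0 := by linarith
  generalize poch (κ₀ + 1 / 2) t = p1 at *
  generalize poch (κ₀ + 1 / 2) i = p2 at *
  generalize b + 1 = q' at *
  generalize (y ^ 2) ^ i = y2
  field_simp

theorem ckSum_odd_scalar :
    t.factorial / poch (κ₀ + 1 / 2) t * (R ^ t * (y * ((t + (b + 1)) / (t + κ₀ + 1 / 2))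
        * jacobi t (κ₀ + 1 / 2) b U))
      = ∑ i ∈ Finset.range (t + 1), (-1) ^ i * (ckCoeff κ₀ (b + 1 / 2) (2 * t + 1) (2 * i + 1)
        * (y ^ (2 * i + 1) * ρ ^ (t - i))) := by
  rw [mul_left_comm (R ^ t), pow_mul_jacobi t _ _ R _ _ U (by linarith) hu hv,
    jacobiForm_eq_sum t (by linarith) (by linarith), Finset.mul_sum, Finset.mul_sum]
  refine Finset.sum_congr rfl fun i hi => ?_
  have hi' : i ≤ t := Nat.lt_succ_iff.1 (Finset.mem_range.1 hi)
  rw [ckCoeff_eq_div (by linarith) κ₀ (by omega),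
    show 2 * t + 1 - (2 * i + 1) = 2 * (t - i) by omega,
    (stepFactorial_two_mul _ _).2, (stepFactorial_two_mul _ _).1, (stepFactorial_two_mul _ _).2,
    show b + 1 / 2 + 1 / 2 = b + 1 by ring,
    show (4 : ℝ) ^ t = 4 ^ i * 4 ^ (t - i) by rw [← pow_add, Nat.add_sub_cancel' hi'],
    neg_pow, pow_succ y (2 * i), pow_mul y, poch_succ_left (κ₀ + 1 / 2), poch_succ (b + 1)]
  have hp := poch_succ (κ₀ + 1 / 2) t
  rw [poch_succ_left] at hp
  have h1 := (poch_pos (show 0 < κ₀ + 1 / 2 by linarith) t).ne'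
  have h2 := (poch_pos (show 0 < κ₀ + 1 / 2 + 1 by linarith) i).ne'
  have h3 := (poch_pos (show 0 < b + 1 by linarith) (t - i)).ne'
  have h4 : κ₀ + 1 / 2 ≠ 0 := by linarith
  have h6 : κ₀ + 1 / 2 + t ≠ 0 := by positivity
  have h5 : b + 1 ≠ 0 := by linarith
  rw [show (t : ℝ) + κ₀ + 1 / 2 = κ₀ + 1 / 2 + t by ring]
  generalize κ₀ + 1 / 2 = q at *
  generalize b + 1 = q' at *
  generalize (y ^ 2) ^ i = y2
  field_simp
  linear_combination (t + q') * y * y2 * ρ ^ (t - i) * poch q' t * hp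

end

/-! ### Values of the extension -/

/-- Evaluation of spinor-valued polynomials at a point, as a linear map. -/
noncomputable def spinorEvalLin (x : Fin 3 → ℝ) : SpinorPoly →ₗ[ℂ] (Fin 2 → ℂ) :=
  (aeval fun j => (x j : ℂ)).toLinearMap.compLeft (Fin 2)

theorem spinorEval_eq (p : SpinorPoly) (x : Fin 3 → ℝ) : spinorEval p x = spinorEvalLin x p := rfl

section

variable (x : Fin 3 → ℝ)

theorem spinorEvalLin_smul (g : MvPolynomial (Fin 3) ℂ) (f : SpinorPoly) :
    spinorEvalLin x (g • f) = eval (fun j => (x j : ℂ)) g • spinorEvalLin x f := by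
  ext1 i
  simp [← spinorEval_eq, spinorEval]

theorem spinorEvalLin_matAct (A : Matrix (Fin 2) (Fin 2) ℂ) (f : SpinorPoly) :
    spinorEvalLin x (matAct A f) = A.mulVec (spinorEvalLin x f) := by
  ext1 i
  simp [← spinorEval_eq, spinorEval, matAct_apply, Matrix.mulVec, dotProduct, Fin.sum_univ_two]

theorem spinorEvalLin_xHat (δ : ℤ) (f : SpinorPoly) :
    spinorEvalLin x (xHat f) = (vecVarHat δ x).mulVec (spinorEvalLin x f) := by
  ext1 i
  fin_cases i <;>
    simp [← spinorEval_eq, spinorEval, xHat_apply, Matrix.mulVec, dotProduct, Fin.sum_univ_two,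
      vecVarHat, pauli, coord, -mul_eq_mul_right_iff] <;> ring

theorem spinorEvalLin_xHat_pow (δ : ℤ) (N : ℕ) (f : SpinorPoly) :
    spinorEvalLin x ((xHat ^ N) f) = (vecVarHat δ x ^ N).mulVec (spinorEvalLin x f) := by
  induction N with
  | zero => simp
  | succ N ih =>
    rw [pow_succ', Module.End.mul_apply, spinorEvalLin_xHat x δ, ih, Matrix.mulVec_mulVec, pow_succ']

theorem vecVarHat_pow_two_mul (δ : ℤ) (s : ℕ) : vecVarHat δ x ^ (2 * s)
    = ((x 0 ^ 2 + x 1 ^ 2 : ℝ) : ℂ) ^ s • (1 : Matrix (Fin 2) (Fin 2) ℂ) := by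
  have h : vecVarHat δ x ^ 2
      = ((x 0 ^ 2 + x 1 ^ 2 : ℝ) : ℂ) • (1 : Matrix (Fin 2) (Fin 2) ℂ) := by
    rw [pow_two]
    ext i j
    fin_cases i <;> fin_cases j <;>
      simp [vecVarHat, pauli, Matrix.mul_apply, Fin.sum_univ_two] <;>
      ring_nf <;> simp [Complex.I_sq]
  rw [pow_mul, h, smul_pow, one_pow]

theorem vecVar_pow_two_mul {δ : ℤ} (hδ : δ = 1 ∨ δ = -1) (s : ℕ) : vecVar δ x ^ (2 * s)
    = ((sqNorm x ^ s : ℝ) : ℂ) • (1 : Matrix (Fin 2) (Fin 2) ℂ) := by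
  rw [pow_mul, vecVar_sq δ hδ, smul_pow, one_pow, Complex.ofReal_pow]

theorem spinorEvalLin_xHat_pow_two_mul (s : ℕ) (f : SpinorPoly) :
    spinorEvalLin x ((xHat ^ (2 * s)) f)
      = (((x 0 ^ 2 + x 1 ^ 2) ^ s : ℝ) : ℂ) • spinorEvalLin x f := by
  rw [spinorEvalLin_xHat_pow x 1, vecVarHat_pow_two_mul, Matrix.smul_mulVec, Matrix.one_mulVec,
    Complex.ofReal_pow]

theorem spinorEvalLin_xHat_pow_two_mul_add_one (δ : ℤ) (s : ℕ) (f : SpinorPoly) :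
    spinorEvalLin x ((xHat ^ (2 * s + 1)) f)
      = (((x 0 ^ 2 + x 1 ^ 2) ^ s : ℝ) : ℂ) • (vecVarHat δ x).mulVec (spinorEvalLin x f) := by
  rw [pow_succ, Module.End.mul_apply, spinorEvalLin_xHat_pow_two_mul, spinorEvalLin_xHat x δ]

theorem sqNorm_ne_zero (hx : x ≠ 0) : sqNorm x ≠ 0 := by
  intro h
  rw [sqNorm] at h
  refine hx (funext fun i => ?_)
  have h0 := sq_nonneg (x 0)
  have h1 := sq_nonneg (x 1)
  have h2 := sq_nonneg (x 2)
  fin_cases i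
  · exact pow_eq_zero_iff two_ne_zero |>.1 (show x 0 ^ 2 = 0 by linarith)
  · exact pow_eq_zero_iff two_ne_zero |>.1 (show x 1 ^ 2 = 0 by linarith)
  · exact pow_eq_zero_iff two_ne_zero |>.1 (show x 2 ^ 2 = 0 by linarith)

/-- The extension of `x̂^{n-k} Φ` is `B_{n,k} Φ`: as `x̂² = x₁² + x₂²` is a scalar, the terms with
even and with odd powers of `x̂` collect to two Jacobi forms in `x₃²` and `x₁² + x₂²`. -/
theorem spinorEvalLin_ckSum (m : ℕ) {κ₀ κ₁ κₘ : ℝ} (h₀ : 0 < κ₀) (h₁ : 0 < κ₁) (hₘ : 0 < κₘ) {δ : ℤ}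
    (hδ : δ = 1 ∨ δ = -1) (n k : ℕ) (hx : x ≠ 0) (Φ : SpinorPoly) :
    spinorEvalLin x (ckSum κ₀ (k + gammaHat m κ₁ κₘ + 1 / 2) δ (n - k) Φ)
      = (bigB m κ₀ κ₁ κₘ δ n k x).mulVec (spinorEvalLin x Φ) := by
  have hR := sqNorm_ne_zero x hx
  have hu : sqNorm x * (1 - upsilon x) = 2 * x 2 ^ 2 := by
    rw [upsilon]; field_simp; rw [sqNorm]; ring
  have hv : sqNorm x * (1 + upsilon x) = 2 * (x 0 ^ 2 + x 1 ^ 2) := by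
    rw [upsilon]; field_simp; rw [sqNorm]; ring
  have hb : 0 ≤ k + gammaHat m κ₁ κₘ := by rw [gammaHat]; positivity
  rw [ckSum, bigB, map_sum]
  simp only [map_smul, map_sub, spinorEvalLin_smul, spinorEvalLin_matAct, map_pow, eval_X,
    vecVar_pow_two_mul x hδ, add_right_comm _ (1 : ℝ) (gammaHat m κ₁ κₘ)]
  generalize hN : n - k = N
  obtain ⟨t, rfl | rfl⟩ := Nat.even_or_odd' N
  · have e1 := ckSum_even_scalar h₀ hb hu hv t
    have e2 := ckSum_even_vector h₀ hb hu hv t hR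
    have ht : 2 * t / 2 = t := by omega
    rw [if_neg (by simp), ht]
    simp only [Matrix.smul_mulVec, Matrix.smul_mul, Matrix.one_mul, Matrix.sub_mulVec,
      Matrix.one_mulVec, ← Matrix.mulVec_mulVec, smul_sub, smul_smul, ← Complex.ofReal_mul]
    rw [e1, e2, Finset.sum_sub_distrib]
    congr 1
    · rw [Complex.ofReal_sum, Finset.sum_smul]
      refine Finset.sum_congr rfl fun j hj => ?_
      have hj' : j ≤ t := Nat.lt_succ_iff.1 (Finset.mem_range.1 hj)
      rw [show 2 * t - 2 * j = 2 * (t - j) by omega, spinorEvalLin_xHat_pow_two_mul, smul_smul]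
      congr 1
      push_cast
      ring
    · rw [Complex.ofReal_sum, Finset.sum_smul, Finset.sum_range_succ,
        ckCoeff_eq_zero _ _ (show 2 * t < 2 * t + 1 by omega)]
      simp only [mul_zero, Complex.ofReal_zero, zero_smul, add_zero]
      refine Finset.sum_congr rfl fun j hj => ?_
      have hj' := Finset.mem_range.1 hj
      rw [show 2 * t - (2 * j + 1) = 2 * (t - 1 - j) + 1 by omega,
        spinorEvalLin_xHat_pow_two_mul_add_one x δ, smul_smul, Matrix.mulVec_smul, smul_smul]
      congr 1
      push_cast
      ring
  · have e1 := ckSum_odd_vector h₀ hb hu hv t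
    have e2 := ckSum_odd_scalar h₀ hb hu hv t
    have ht : (2 * t + 1) / 2 = t := by omega
    rw [if_pos (by simp), ht]
    simp only [Matrix.smul_mulVec, Matrix.smul_mul, Matrix.one_mul, Matrix.sub_mulVec,
      smul_sub, smul_smul, ← Complex.ofReal_mul]
    have ha' : (t : ℝ) + k + gammaHat m κ₁ κₘ + 1 = t + (k + gammaHat m κ₁ κₘ + 1) := by ring
    simp only [ha', mul_assoc] at e1 e2 ⊢
    rw [e1, e2, Finset.sum_sub_distrib]
    congr 1
    · rw [Complex.ofReal_sum, Finset.sum_smul]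
      refine Finset.sum_congr rfl fun j hj => ?_
      have hj' : j ≤ t := Nat.lt_succ_iff.1 (Finset.mem_range.1 hj)
      rw [show 2 * t + 1 - 2 * j = 2 * (t - j) + 1 by omega,
        spinorEvalLin_xHat_pow_two_mul_add_one x δ, smul_smul]
      congr 1
      push_cast
      ring
    · rw [Complex.ofReal_sum, Finset.sum_smul]
      refine Finset.sum_congr rfl fun j hj => ?_
      have hj' : j ≤ t := Nat.lt_succ_iff.1 (Finset.mem_range.1 hj)
      rw [show 2 * t + 1 - (2 * j + 1) = 2 * (t - j) by omega,
        spinorEvalLin_xHat_pow_two_mul, smul_smul, Matrix.mulVec_smul, smul_smul]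
      congr 1
      push_cast
      ring

end

/-! ### The planar monogenics `Φ_k^±` -/

/-- The spinor-valued polynomial whose values are `Φ_k^+` (`s = 0`) and `Φ_k^-` (`s = 1`). -/
noncomputable def bigPhiPoly (m : ℕ) (κ₁ κₘ : ℝ) (k : ℕ) (s : Fin 2) : SpinorPoly :=
  if s = 0 then ![phiPoly m κ₁ κₘ k Complex.I, 0] else ![0, phiPoly m κ₁ κₘ k (-Complex.I)]

section

variable {m : ℕ} (hm : 2 ≤ m) {κ₀ κ₁ κₘ : ℝ} (h₀ : 0 < κ₀) (h₁ : 0 < κ₁) (hₘ : 0 < κₘ)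
  (hodd : Odd m → κ₁ = κₘ) {δ : ℤ} (hδ : δ = 1 ∨ δ = -1)

include h₁ hₘ in
theorem spinorEvalLin_bigPhiPoly (k : ℕ) (s : Fin 2) (x : Fin 3 → ℝ) :
    spinorEvalLin x (bigPhiPoly m κ₁ κₘ k s) = bigPhi m κ₁ κₘ k s x := by
  have hz : eval (fun j => (x j : ℂ)) (coord Complex.I) = ⟨x 0, x 1⟩ := by
    simp [coord, Complex.ext_iff]
  have hz' : eval (fun j => (x j : ℂ)) (coord (-Complex.I)) = starRingEnd ℂ ⟨x 0, x 1⟩ := by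
    simp [coord, Complex.ext_iff]
  have hp := eval_phiPoly (m := m) h₁ hₘ k Complex.I _ _ hz hz'
  have hn := eval_phiPoly (m := m) h₁ hₘ k (-Complex.I) _ _ hz' (by simpa using hz)
  rw [← phiMinus_eq] at hn
  rw [← spinorEval_eq, bigPhiPoly, bigPhi]
  ext1 i
  split_ifs <;> fin_cases i <;> simp [spinorEval, hp, hn]

include hm h₁ hₘ hodd in
theorem isPlanarMonogenic_bigPhiPoly (k : ℕ) (s : Fin 2) :
    IsPlanarMonogenic m κ₀ κ₁ κₘ δ k (bigPhiPoly m κ₁ κₘ k s) where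
  homogeneous i := by
    rw [bigPhiPoly]
    split_ifs <;> fin_cases i <;>
      first | exact isHomogeneous_phiPoly _ _ _ _ _ | exact isHomogeneous_zero _ _ _
  planar i := by
    rw [bigPhiPoly]
    split_ifs <;> fin_cases i <;>
      first | exact phiPoly_mem_planarPoly _ _ _ _ _ | exact zero_mem _
  diracHat_eq_zero := by
    have hp := planarDunkl_phiPoly hm h₁ hₘ hodd κ₀ k (ε := Complex.I) (by simp)
    have hn := planarDunkl_phiPoly hm h₁ hₘ hodd κ₀ k (ε := -Complex.I) (by simp)
    rw [diracHat_apply, bigPhiPoly]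
    ext1 i
    split_ifs <;> fin_cases i <;> simp [hp, hn]

/-! ### Linear independence and dimension -/

theorem stepFalling_self_ne_zero {κ : ℝ} (hκ : 0 < κ) (N : ℕ) : stepFalling κ N N ≠ 0 := by
  have h := stepFalling_mul_stepFactorial κ (le_refl N)
  exact left_ne_zero_of_mul (h.trans_ne (stepFactorial_pos hκ N).ne')

include hm h₁ hₘ hodd in
/-- The spinors `x̂^{n-k} Φ_k^±` are linearly independent: the power `D̂^{n-k}` kills those with a
larger index and maps `x̂^{n-k} Φ_k^±` to a nonzero multiple of `Φ_k^±`. -/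
theorem linearIndependent_xHat_pow (n : ℕ) : LinearIndependent ℂ
    fun p : Fin (n + 1) × Fin 2 => (xHat ^ (n - (p.1 : ℕ))) (bigPhiPoly m κ₁ κₘ p.1 p.2) := by
  rw [Fintype.linearIndependent_iff]
  intro c hc
  have key : ∀ k : ℕ, ∀ hk : k < n + 1, ∀ s, c (⟨k, hk⟩, s) = 0 := by
    intro k
    induction k using Nat.strong_induction_on with
    | _ k ih =>
      intro hk
      -- `κ₀` and `δ` do not enter the planar operator, so any values will do
      have hD := congrArg ((diracHat m 0 κ₁ κₘ 1) ^ (n - k)) hc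
      rw [map_sum, map_zero, Fintype.sum_prod_type, Finset.sum_eq_single ⟨k, hk⟩] at hD
      · simp only [map_smul] at hD
        rw [Fin.sum_univ_two, (isPlanarMonogenic_bigPhiPoly hm h₁ hₘ hodd k 0).diracHat_pow_xHat_pow
          hodd, (isPlanarMonogenic_bigPhiPoly hm h₁ hₘ hodd k 1).diracHat_pow_xHat_pow hodd,
          Nat.sub_self, pow_zero, Module.End.one_apply, Module.End.one_apply] at hD
        have hs := stepFalling_self_ne_zero (κ := k + gammaHat m κ₁ κₘ + 1 / 2)
          (by rw [gammaHat]; positivity) (n - k)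
        have hs' := Complex.ofReal_ne_zero.2 hs
        have hD0 := congrFun hD 0
        have hD1 := congrFun hD 1
        simp only [bigPhiPoly, if_true, one_ne_zero, if_false, Pi.add_apply, Pi.smul_apply,
          Matrix.cons_val_zero, Matrix.cons_val_one, smul_zero, add_zero, zero_add,
          Pi.zero_apply, smul_smul, smul_eq_zero, mul_eq_zero, hs', or_false,
          phiPoly_ne_zero h₁ hₘ] at hD0 hD1
        intro s
        fin_cases s
        · exact hD0
        · exact hD1
      · intro l _ hl
        refine Finset.sum_eq_zero fun s _ => ?_
        dsimp only
        rcases lt_or_gt_of_ne (fun h => hl (Fin.ext h) : (l : ℕ) ≠ k) with h | h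
        · rw [show (l, s) = (⟨(l : ℕ), l.2⟩, s) from rfl, ih l h l.2 s, zero_smul, map_zero]
        · rw [map_smul, (isPlanarMonogenic_bigPhiPoly hm h₁ hₘ hodd l s).diracHat_pow_xHat_pow
            hodd, stepFalling_eq_zero _ (by have := l.2; omega), Complex.ofReal_zero, zero_smul,
            smul_zero]
      · simp
  rintro ⟨k, s⟩
  exact key k k.2 s

include h₀ hδ in
/-- A monogenic divisible by `x₃^{j+1}` is divisible by `x₃^{j+2}`, since `e₃ 𝒟₃` lowers the power
of `x₃` by one with a nonzero factor and `D̂` does not. -/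
theorem X_two_pow_dvd_succ {f : SpinorPoly} (hf : diracOp m κ₀ κ₁ κₘ δ f = 0) (j : ℕ)
    (h : ∀ i, (X 2 : MvPolynomial (Fin 3) ℂ) ^ (j + 1) ∣ f i) (i : Fin 2) :
    (X 2 : MvPolynomial (Fin 3) ℂ) ^ (j + 2) ∣ f i := by
  choose g hg using h
  obtain rfl : f = (X 2 ^ (j + 1) : MvPolynomial (Fin 3) ℂ) • g := funext hg
  have h1 := congrArg (matAct (pauli δ 2)) hf
  rw [diracOp_apply, diracHat_X_two_pow_smul, map_add, matAct_smul, matAct_three_sq δ hδ,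
    map_zero] at h1
  have h2 := congrFun h1 i
  rw [Pi.add_apply, spinorDunkl_apply, Pi.smul_apply, Pi.smul_apply, smul_eq_mul, smul_eq_mul,
    dunkl_two_X_pow_mul, Pi.zero_apply] at h2
  have hX : (X 2 : MvPolynomial (Fin 3) ℂ) ^ j ≠ 0 := pow_ne_zero _ (X_ne_zero 2)
  set w := matAct (pauli δ 2) (diracHat m κ₀ κ₁ κₘ δ g) i + (pderiv 2 (g i)
        + C ((κ₀ * (-1) ^ (j + 1) : ℝ) : ℂ) * diffQuot (posRoot m 0) (g i)) with hw
  have hstep : (C ((stepNum κ₀ (j + 1) : ℂ)⁻¹) : MvPolynomial (Fin 3) ℂ)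
      * C (stepNum κ₀ (j + 1) : ℂ) = 1 := by
    rw [← C_mul, inv_mul_cancel₀ (Complex.ofReal_ne_zero.2 (stepNum_pos h₀ j).ne'), C_1]
  have h3 : C (stepNum κ₀ (j + 1) : ℂ) * g i = -(X 2 * w) := by
    apply mul_left_cancel₀ hX
    rw [hw]
    linear_combination h2
  refine ⟨-(C ((stepNum κ₀ (j + 1) : ℂ)⁻¹) * w), ?_⟩
  rw [Pi.smul_apply, smul_eq_mul]
  linear_combination X 2 ^ (j + 1) * (C ((stepNum κ₀ (j + 1) : ℂ)⁻¹) * h3 - g i * hstep)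

include h₀ hδ in
/-- A homogeneous monogenic divisible by `x₃` is divisible by every power of `x₃`, hence zero. -/
theorem eq_zero_of_X_two_dvd {n : ℕ} {f : SpinorPoly} (hf : f ∈ monogenics m κ₀ κ₁ κₘ δ n)
    (h : ∀ i, (X 2 : MvPolynomial (Fin 3) ℂ) ∣ f i) : f = 0 := by
  obtain ⟨hD, hn⟩ := hf
  have hpow : ∀ j i, (X 2 : MvPolynomial (Fin 3) ℂ) ^ (j + 1) ∣ f i := by
    intro j
    induction j with
    | zero => simpa using h
    | succ j ih => exact X_two_pow_dvd_succ h₀ hδ hD j ih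
  ext1 i
  by_contra hi
  obtain ⟨g, hg⟩ := hpow n i
  have hi' : f i ≠ 0 := hi
  have hdeg : (f i).totalDegree = n := IsHomogeneous.totalDegree (hn i trivial) hi'
  have hg0 : g ≠ 0 := by rintro rfl; exact hi' (by rw [hg, mul_zero])
  rw [hg, totalDegree_mul_of_isDomain (pow_ne_zero _ (X_ne_zero 2)) hg0, totalDegree_X_pow] at hdeg
  omega

/-- The exponent of the monomial `x₁^a x₂^{n-a}`. -/
noncomputable def planarExponent (n : ℕ) (a : Fin (n + 1)) : Fin 3 →₀ ℕ :=
  Finsupp.single 0 (a : ℕ) + Finsupp.single 1 (n - a)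

theorem X_two_dvd_of_coeff_eq_zero {n : ℕ} {f : MvPolynomial (Fin 3) ℂ} (hf : f.IsHomogeneous n)
    (h : ∀ a, coeff (planarExponent n a) f = 0) : X 2 ∣ f := by
  rw [X_dvd_iff_modMonomial_eq_zero]
  ext d
  rw [coeff_zero]
  by_cases hd : Finsupp.single 2 1 ≤ d
  · exact coeff_modMonomial_of_le f hd
  · rw [coeff_modMonomial_of_not_le f hd]
    have h2 : d 2 = 0 := by
      by_contra h2
      exact hd (Finsupp.single_le_iff.2 (Nat.one_le_iff_ne_zero.2 h2))
    by_cases hdeg : d.degree = n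
    · rw [Finsupp.degree_eq_sum, Fin.sum_univ_three, h2] at hdeg
      convert h ⟨d 0, by omega⟩ using 2
      ext i
      fin_cases i
      · simp [planarExponent]
      · simp [planarExponent]; omega
      · simp [planarExponent, h2]
    · exact hf.coeff_eq_zero hdeg

/-- The coefficients of the restriction of a spinor-valued polynomial to the plane `x₃ = 0`. -/
noncomputable def planarCoeffs (n : ℕ) : SpinorPoly →ₗ[ℂ] (Fin (n + 1) × Fin 2 → ℂ) :=
  LinearMap.pi fun p => lcoeff ℂ (planarExponent n p.1) ∘ₗ LinearMap.proj p.2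

include h₀ hδ in
/-- A monogenic is determined by its restriction to the plane `x₃ = 0`. -/
theorem planarCoeffs_injective (n : ℕ) : Function.Injective
    (planarCoeffs n ∘ₗ (monogenics m κ₀ κ₁ κₘ δ n).subtype) := by
  rw [← LinearMap.ker_eq_bot, LinearMap.ker_eq_bot']
  rintro ⟨f, hf⟩ h
  refine Subtype.ext (eq_zero_of_X_two_dvd h₀ hδ hf fun i => ?_)
  exact X_two_dvd_of_coeff_eq_zero (hf.2 i trivial) fun a => congrFun h (a, i)

include hm h₀ h₁ hₘ hodd hδ in
theorem ckSum_mem_monogenics (n : ℕ) (k : Fin (n + 1)) (s : Fin 2) :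
    ckSum κ₀ ((k : ℕ) + gammaHat m κ₁ κₘ + 1 / 2) δ (n - k) (bigPhiPoly m κ₁ κₘ k s)
      ∈ monogenics m κ₀ κ₁ κₘ δ n := by
  have hΦ := isPlanarMonogenic_bigPhiPoly hm h₁ hₘ hodd (κ₀ := κ₀) (δ := δ) k s
  refine ⟨diracOp_ckSum h₀ hδ hΦ hodd _, fun i _ => ?_⟩
  have h := ckSum_homogeneous (κ₀ := κ₀) hΦ ((k : ℕ) + gammaHat m κ₁ κₘ + 1 / 2) (n - k) i
  rwa [Nat.sub_add_cancel (Nat.lt_succ_iff.1 k.2)] at h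

include hm h₀ h₁ hₘ hodd hδ in
/-- The extensions are independent because their restrictions to `x₃ = 0` are, and they span because
`planarCoeffs_injective` bounds the dimension by their number `2 (n + 1)`. -/
theorem exists_basis_ckSum (n : ℕ) :
    ∃ ψ : Module.Basis (Fin (n + 1) × Fin 2) ℂ (monogenics m κ₀ κ₁ κₘ δ n), ∀ k s,
      (ψ (k, s) : SpinorPoly)
        = ckSum κ₀ ((k : ℕ) + gammaHat m κ₁ κₘ + 1 / 2) δ (n - k) (bigPhiPoly m κ₁ κₘ k s) := by
  set v : Fin (n + 1) × Fin 2 → monogenics m κ₀ κ₁ κₘ δ n :=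
    fun p => ⟨_, ckSum_mem_monogenics hm h₀ h₁ hₘ hodd hδ n p.1 p.2⟩ with hv
  have hli : LinearIndependent ℂ v := by
    refine LinearIndependent.of_comp (planeRestrict.toLinearMap.compLeft (Fin 2)
      ∘ₗ (monogenics m κ₀ κ₁ κₘ δ n).subtype) ?_
    convert linearIndependent_xHat_pow hm h₁ hₘ hodd n using 1
    funext p
    exact planeRestrict_ckSum (isPlanarMonogenic_bigPhiPoly hm h₁ hₘ hodd (κ₀ := κ₀) (δ := δ)
      p.1 p.2).planar _ _
  have hinj := planarCoeffs_injective h₀ hδ (m := m) (κ₁ := κ₁) (κₘ := κₘ) n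
  have : Module.Finite ℂ (monogenics m κ₀ κ₁ κₘ δ n) := Module.Finite.of_injective _ hinj
  have hcard : Fintype.card (Fin (n + 1) × Fin 2)
      = Module.finrank ℂ (monogenics m κ₀ κ₁ κₘ δ n) := by
    refine le_antisymm hli.fintype_card_le_finrank ?_
    have h := LinearMap.finrank_le_finrank_of_injective hinj
    rwa [Module.finrank_fintype_fun_eq_card] at h
  refine ⟨basisOfLinearIndependentOfCardEqFinrank hli hcard, fun k s => ?_⟩
  rw [coe_basisOfLinearIndependentOfCardEqFinrank]

end

end DunklDirac

/-! ### The basis of monogenics -/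

theorem mainTheorem9 (m : ℕ) (hm : 2 ≤ m) (κ₀ κ₁ κₘ : ℝ) (hκ₀ : 0 < κ₀) (hκ₁ : 0 < κ₁)
    (hκₘ : 0 < κₘ) (hodd : Odd m → κ₁ = κₘ) (δ : ℤ) (hδ : δ = 1 ∨ δ = -1) (n : ℕ) :
    ∃ ψ : Module.Basis (Fin (n + 1) × Fin 2) ℂ (DunklDirac.monogenics m κ₀ κ₁ κₘ δ n),
      ∀ (k : Fin (n + 1)) (s : Fin 2),
        (∀ x : Fin 3 → ℝ, x ≠ 0 →
          DunklDirac.spinorEval (ψ (k, s) : DunklDirac.SpinorPoly) x =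
            (DunklDirac.bigB m κ₀ κ₁ κₘ δ n k x).mulVec (DunklDirac.bigPhi m κ₁ κₘ k s x)) ∧
        (∃ q : DunklDirac.SpinorPoly,
          (∀ x : Fin 3 → ℝ, DunklDirac.spinorEval q x =
            (DunklDirac.vecVarHat δ x ^ (n - (k : ℕ))).mulVec
              (DunklDirac.bigPhi m κ₁ κₘ k s x)) ∧
          (ψ (k, s) : DunklDirac.SpinorPoly) = DunklDirac.ckExt m κ₀ κ₁ κₘ δ q) := by
  open DunklDirac in
  obtain ⟨ψ, hψ⟩ := exists_basis_ckSum hm hκ₀ hκ₁ hκₘ hodd hδ n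
  refine ⟨ψ, fun k s => ⟨fun x hx => ?_, (xHat ^ (n - (k : ℕ))) (bigPhiPoly m κ₁ κₘ k s),
    fun x => ?_, ?_⟩⟩
  · rw [hψ, spinorEval_eq, spinorEvalLin_ckSum x m hκ₀ hκ₁ hκₘ hδ n k hx,
      spinorEvalLin_bigPhiPoly hκ₁ hκₘ]
  · rw [spinorEval_eq, spinorEvalLin_xHat_pow x δ, spinorEvalLin_bigPhiPoly hκ₁ hκₘ]
  · rw [hψ, ckExt_xHat_pow hκ₀ (isPlanarMonogenic_bigPhiPoly hm hκ₁ hκₘ hodd k s) hodd]
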